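/- **Theorem (coverage probability of the NOMA-enabled ABS tier).** *Model.* The typical user is at the origin of $\mathbb R^2$. Terrestrial base stations (TBSs) and the horizontal positions of aerial base stations (ABSs) form independent homogeneous Poisson point processes of densities $\lambda_T,\lambda_A>0$; all ABSs have height $h>0$, so an ABS at horizontal distance $x$ is at distance $\sqrt{x^2+h^2}$. Independently for each ABS, its link is LoS with probability $P_L(x)=\big(1+a\exp(-b\tfrac{180}{\pi}\tan^{-1}(\tfrac hx-a))\big)^{-1}$ and NLoS with probability $P_N=1-P_L$ ($a,b>0$). For $S\in\{L,N\}$ a link in state $S$ has additive loss $C_S>0$, path loss exponent $\alpha_S>2$, and an independent channel gain $H\sim\Gamma(m_S,1/m_S)$ (shape, scale), $m_S\in\mathbb N$, $m_S\ge1$. Put $\eta_S=a_nP_AC_S$ and $\eta_T=G_MP_TC_T$, where $P_A,P_T,G_M,C_T,\alpha_T>0$, $0<a_n<a_m$, $a_m+a_n=1$. The average received power is $\eta_SR^{-\alpha_S}$ from an ABS at distance $R$ in state $S$, and $\eta_TR^{-\alpha_T}\mathbf 1(R\le R_B)$ from a TBS at distance $R$ ($R_B>0$). The user is associated with the base station of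 largest average received power. Assume $\eta_Nh^{-\alpha_N}\le\eta_TR_B^{-\alpha_T}$ (so that, almost surely, a user with a TBS within $R_B$ is not associated with an NLoS ABS). Let $A_L$, $A_N$, $A_A$ be the probabilities of association with a LoS ABS, with an NLoS ABS, and with any ABS. *Coverage.* Suppose the serving ABS is in state $S$, at distance $R$, with gain $H$. Let $G=P_AC_SR^{-\alpha_S}H$, let $I$ be the sum of the powers $P_AC_{S_i}R_i^{-\alpha_{S_i}}H_i$ over all other ABSs, and let $\sigma^2>0$ be the noise power, $0\le\beta<1$ the SIC coefficient, $R_f\ge h$ the distance of the fixed user, and $\epsilon_f,\epsilon_t>0$ the target SINRs. The user is covered if either $R\le R_f$ and $$\frac{a_mG}{a_nG+I+\sigma^2}>\epsilon_f,\qquad \frac{a_nG}{I+\sigma^2+\beta a_mG}>\epsilon_t ,$$ or $R>R_f$ and $\dfrac{a_mG}{a_nG+I+\sigma^2}>\epsilon_t$. Let $P_A^C$ be the conditional probability that the user is covered, given that it is associated with an ABS. *Notation.* All square roots of negative numbers below are read as $0$. For $S\in\{L,N\}$ let $$V_S(\tau)=\exp\Big(-2\pi\lambda_A\int_0^{\sqrt{\tau^2-h^2}}xP_S(x)\,dx\Big),\qquad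 f_{R_{S,0}}(r)=2\pi\lambda_A\,r\,P_S(\sqrt{r^2-h^2})\,V_S(r)\quad(r\ge h),$$ and let $Q_T=1-e^{-\pi\lambda_TR_B^2}$, $\tau_{L|N}(r)=(\eta_L/\eta_N)^{1/\alpha_L}r^{\alpha_N/\alpha_L}$, $\tau_{T|L}(r)=(\eta_T/\eta_L)^{1/\alpha_T}r^{\alpha_L/\alpha_T}$, $l_{L,h}=\tau_{L|N}(h)$, $l_{L,T}=(\eta_L/\eta_T)^{1/\alpha_L}R_B^{\alpha_T/\alpha_L}$; $\tau_{N|L}(r)=h$ for $r\le l_{L,h}$ and $\tau_{N|L}(r)=(\eta_N/\eta_L)^{1/\alpha_N}r^{\alpha_L/\alpha_N}$ for $r>l_{L,h}$. For $r\ge h$ define $$f_{\hat R_{N,0}}(r)=\frac{f_{R_{N,0}}(r)}{A_N}V_L(\tau_{L|N}(r))(1-Q_T),$$ $$f_{\hat R_{L,0},1}(r)=\frac{f_{R_{L,0}}(r)}{A_L}(1-Q_T)\cdot\begin{cases}1,&r\le l_{L,h},\\V_N(\tau_{N|L}(r)),&r>l_{L,h},\end{cases}$$ $$f_{\hat R_{L,0},2}(r)=\frac{f_{R_{L,0}}(r)}{A_L}\big[e^{-\pi\lambda_T\tau_{T|L}(r)^2}-(1-Q_T)\big]\cdot\begin{cases}1,&r\le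 \min(l_{L,h},l_{L,T}),\\V_N(\tau_{N|L}(r)),&l_{L,h}<r\le l_{L,T},\\0,&r>l_{L,T}.\end{cases}$$ For $w\ge0$ and $t\ge0$ let $\Lambda_S(t,w)=\exp\Big(-2\pi\lambda_A\int_w^\infty\Big[1-\Big(1+\frac{tP_AC_S}{m_S(x^2+h^2)^{\alpha_S/2}}\Big)^{-m_S}\Big]P_S(x)\,x\,dx\Big)$, and $$\mathcal L_L(t;r)=\Lambda_L(t,\sqrt{r^2-h^2})\,\Lambda_N(t,\sqrt{\tau_{N|L}(r)^2-h^2}),\qquad \mathcal L_N(t;r)=\Lambda_L(t,\sqrt{\tau_{L|N}(r)^2-h^2})\,\Lambda_N(t,\sqrt{r^2-h^2}).$$ For $\epsilon>0$ let, with $\theta=m_S\epsilon r^{\alpha_S}/(P_AC_S)$, $$K_S(\epsilon,r)=\sum_{k=0}^{m_S-1}\sum_{q=0}^{k}\binom kq\frac{\theta^k}{k!}e^{-\theta\sigma^2}(\sigma^2)^q(-1)^{k-q}\frac{\partial^{k-q}}{\partial t^{k-q}}\mathcal L_S(t;r)\Big|_{t=\theta}.$$ Set $P_{near|S}(r)=K_S(\epsilon^*,r)$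 with $\epsilon^*=\max\{\frac{\epsilon_f}{a_m-a_n\epsilon_f},\frac{\epsilon_t}{a_n-\beta a_m\epsilon_t}\}$ if both denominators are positive, and $P_{near|S}(r)=0$ otherwise; set $P_{far|S}(r)=K_S(\frac{\epsilon_t}{a_m-a_n\epsilon_t},r)$ if $a_m-a_n\epsilon_t>0$, and $P_{far|S}(r)=0$ otherwise. Finally let $$P_{cov,LoS}=\sum_{i=1}^2\Big[\int_h^{R_f}P_{near|L}(r)f_{\hat R_{L,0},i}(r)\,dr+\int_{R_f}^\infty P_{far|L}(r)f_{\hat R_{L,0},i}(r)\,dr\Big],$$ $$P_{cov,NLoS}=\int_h^{R_f}P_{near|N}(r)f_{\hat R_{N,0}}(r)\,dr+\int_{R_f}^\infty P_{far|N}(r)f_{\hat R_{N,0}}(r)\,dr.$$ *Claim.* $A_L,A_N>0$, $A_A=A_L+A_N$, all the integrals in $P_{cov,LoS}$ and $P_{cov,NLoS}$ converge absolutely, $P_{cov,LoS}$ and $P_{cov,NLoS}$ are the conditional probabilities of coverage given association with a LoS ABS and with an NLoS ABS, and $$P_A^C=\frac{A_L}{A_A}P_{cov,LoS}+\frac{A_N}{A_A}P_{cov,NLoS}.$$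 -/

import Mathlib

open MeasureTheory ProbabilityTheory Set

namespace NomaHetNet

/-- The state of an air-to-ground link. -/
inductive Link where
  | LoS
  | NLoS

/-- Horizontal plane; the typical user sits at the origin. -/
abbrev Plane := EuclideanSpace ℝ (Fin 2)

/-- The deterministic parameters of the two-tier network. -/
structure Params where
  /-- density of the terrestrial base stations (TBSs) -/
  lamT : ℝ
  /-- density of the aerial base stations (ABSs) -/
  lamA : ℝ
  /-- radius of the mmWave line-of-sight ball -/
  RB : ℝ
  /-- height of the ABSs -/
  h : ℝ
  /-- distance between an ABS and its fixed user -/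
  Rf : ℝ
  /-- first S-curve parameter -/
  a : ℝ
  /-- second S-curve parameter -/
  b : ℝ
  /-- transmit power of a TBS -/
  PT : ℝ
  /-- main-lobe gain of a TBS -/
  GM : ℝ
  /-- additive loss of the TBS links -/
  CT : ℝ
  /-- path loss exponent of the TBS links -/
  alphaT : ℝ
  /-- transmit power of an ABS -/
  PA : ℝ
  /-- additive loss of LoS / NLoS ABS links -/
  C : Link → ℝ
  /-- path loss exponent of LoS / NLoS ABS links -/
  alpha : Link → ℝ
  /-- Nakagami parameter of LoS / NLoS ABS links -/
  m : Link → ℕ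
  /-- power allocation factor of the far user -/
  am : ℝ
  /-- power allocation factor of the near user -/
  an : ℝ
  /-- imperfect SIC coefficient -/
  beta : ℝ
  /-- noise power of the ABS tier -/
  noise : ℝ
  /-- target SINR of the fixed user -/
  epsf : ℝ
  /-- target SINR of the typical user -/
  epst : ℝ

namespace Params

variable (p : Params)

/-- `η_L`, `η_N`. -/
noncomputable def eta (s : Link) : ℝ := p.an * p.PA * p.C s

/-- `η_T`. -/
noncomputable def etaT : ℝ := p.GM * p.PT * p.CT

/-- Standing assumptions on the parameters. The last field says that no NLoS ABS can be received
with more average power than a TBS inside the LoS ball, so that a user with a TBS in the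
ball does not associate with an NLoS ABS. -/
structure Valid : Prop where
  lamT_pos : 0 < p.lamT
  lamA_pos : 0 < p.lamA
  RB_pos : 0 < p.RB
  h_pos : 0 < p.h
  h_le_Rf : p.h ≤ p.Rf
  a_pos : 0 < p.a
  b_pos : 0 < p.b
  PT_pos : 0 < p.PT
  GM_pos : 0 < p.GM
  CT_pos : 0 < p.CT
  alphaT_pos : 0 < p.alphaT
  PA_pos : 0 < p.PA
  C_pos : ∀ s, 0 < p.C s
  two_lt_alpha : ∀ s, 2 < p.alpha s
  one_le_m : ∀ s, 1 ≤ p.m s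
  an_pos : 0 < p.an
  an_lt_am : p.an < p.am
  am_add_an : p.am + p.an = 1
  beta_nonneg : 0 ≤ p.beta
  beta_lt_one : p.beta < 1
  noise_pos : 0 < p.noise
  epsf_pos : 0 < p.epsf
  epst_pos : 0 < p.epst
  nlos_le_tbs :
    p.eta .NLoS * p.h ^ (-p.alpha .NLoS) ≤ p.etaT * p.RB ^ (-p.alphaT)

/-- Probability of a LoS / NLoS link at horizontal distance `x`. -/
noncomputable def linkProb : Link → ℝ → ℝ
  | .LoS, x => 1 / (1 + p.a * Real.exp (-p.b * (180 / Real.pi) * Real.arctan (p.h / x - p.a)))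
  | .NLoS, x =>
      1 - 1 / (1 + p.a * Real.exp (-p.b * (180 / Real.pi) * Real.arctan (p.h / x - p.a)))

end Params

/-! ### The random network -/

/-- `X` enumerates the points of a homogeneous Poisson point process of density `lam` on the plane:
the numbers of points in disjoint Borel sets of finite area are independent and Poisson
distributed with mean `lam` times the area. -/
structure IsHPPP {Ω : Type*} [MeasurableSpace Ω] (μ : Measure Ω) (lam : ℝ)
    (X : ℕ → Ω → Plane) : Prop where
  measurable : ∀ i, Measurable (X i)
  count : ∀ (n : ℕ) (B : Fin n → Set Plane) (c : Fin n → ℕ),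
    (∀ k, MeasurableSet (B k)) → (∀ k, volume (B k) < ⊤) →
    Pairwise (fun k l => Disjoint (B k) (B l)) →
    μ {ω | ∀ k, {i | X i ω ∈ B k}.encard = (c k : ℕ∞)} =
      ∏ k, poissonMeasure (lam * (volume (B k)).toReal).toNNReal {c k}

/-- The random elements of the network on a sample space `Ω`. -/
structure Network (Ω : Type*) where
  /-- positions of the TBSs -/
  tbs : ℕ → Ω → Plane
  /-- horizontal positions of the ABSs -/
  aerial : ℕ → Ω → Plane
  /-- uniform variable that decides whether the link of an ABS is LoS -/
  blockage : ℕ → Ω → ℝ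
  /-- channel gain of an ABS, should its link be LoS / NLoS -/
  fading : Link → ℕ → Ω → ℝ

namespace Network

variable {Ω : Type*} (N : Network Ω) (p : Params)

/-- The marks of the `i`-th ABS. -/
def marks (i : ℕ) (ω : Ω) : ℝ × ℝ × ℝ :=
  (N.blockage i ω, N.fading .LoS i ω, N.fading .NLoS i ω)

/-- The law of the network: TBSs and ABSs form independent homogeneous Poisson point processes, and
the ABSs carry i.i.d. marks, independent of all positions, made of a uniform variable on `[0, 1]`
and of independent `Γ(m, 1/m)` channel gains (shape `m`, rate `m`). -/
structure HasNetworkLaw [MeasurableSpace Ω] (μ : Measure Ω) : Prop where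
  tbs_hppp : IsHPPP μ p.lamT N.tbs
  aerial_hppp : IsHPPP μ p.lamA N.aerial
  marks_measurable : ∀ i, Measurable (N.marks i)
  marks_law : ∀ i, μ.map (N.marks i) =
    (volume.restrict (Icc (0 : ℝ) 1)).prod
      ((gammaMeasure (p.m .LoS) (p.m .LoS)).prod (gammaMeasure (p.m .NLoS) (p.m .NLoS)))
  marks_indep : iIndepFun N.marks μ
  aerial_indep_marks :
    IndepFun (fun ω (i : ℕ) => N.aerial i ω) (fun ω (i : ℕ) => N.marks i ω) μ
  tbs_indep : IndepFun (fun ω (i : ℕ) => N.tbs i ω)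
    (fun ω => ((fun i : ℕ => N.aerial i ω), (fun i : ℕ => N.marks i ω))) μ

/-- The state of the link to the `i`-th ABS: LoS with probability `P_L(x)` at horizontal
distance `x`. -/
noncomputable def state (i : ℕ) (ω : Ω) : Link :=
  if N.blockage i ω ≤ p.linkProb .LoS ‖N.aerial i ω‖ then .LoS else .NLoS

/-- Distance between the typical user and the `i`-th ABS. -/
noncomputable def dist (i : ℕ) (ω : Ω) : ℝ := Real.sqrt (‖N.aerial i ω‖ ^ 2 + p.h ^ 2)

/-- Long-term average power received from the `i`-th ABS. -/
noncomputable def absPower (i : ℕ) (ω : Ω) : ℝ :=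
  p.eta (N.state p i ω) * N.dist p i ω ^ (-p.alpha (N.state p i ω))

/-- Long-term average power received from the `k`-th TBS. -/
noncomputable def tbsPower (k : ℕ) (ω : Ω) : ℝ :=
  if ‖N.tbs k ω‖ ≤ p.RB then p.etaT * ‖N.tbs k ω‖ ^ (-p.alphaT) else 0

/-- The typical user is associated with the `i`-th ABS: it offers the largest average power. -/
def Serves (i : ℕ) (ω : Ω) : Prop :=
  (∀ j, j ≠ i → N.absPower p j ω < N.absPower p i ω) ∧
    ∀ k, N.tbsPower p k ω < N.absPower p i ω

/-- Instantaneous power `P_A C R^{-α} H` received from the `i`-th ABS. -/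
noncomputable def rxPower (i : ℕ) (ω : Ω) : ℝ :=
  p.PA * p.C (N.state p i ω) * N.dist p i ω ^ (-p.alpha (N.state p i ω)) *
    N.fading (N.state p i ω) i ω

open Classical in
/-- Interference from all the (LoS and NLoS) ABSs other than the serving ABS `i`. -/
noncomputable def interference (i : ℕ) (ω : Ω) : ℝ :=
  ∑' j, if j = i then 0 else N.rxPower p j ω

/-- SINR of the near typical user when it decodes the message of the fixed user. -/
noncomputable def sinrNearFixed (i : ℕ) (ω : Ω) : ℝ :=
  p.am * N.rxPower p i ω /
    (p.an * N.rxPower p i ω + N.interference p i ω + p.noise)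

/-- SINR of the near typical user when it decodes its own message after imperfect SIC. -/
noncomputable def sinrNear (i : ℕ) (ω : Ω) : ℝ :=
  p.an * N.rxPower p i ω /
    (N.interference p i ω + p.noise + p.beta * p.am * N.rxPower p i ω)

/-- SINR of the far typical user when it decodes its own message. -/
noncomputable def sinrFar (i : ℕ) (ω : Ω) : ℝ :=
  p.am * N.rxPower p i ω /
    (p.an * N.rxPower p i ω + N.interference p i ω + p.noise)

/-- Successful decoding at the typical user when it is served by the `i`-th ABS. -/
def Covered (i : ℕ) (ω : Ω) : Prop :=
  (N.dist p i ω ≤ p.Rf ∧ p.epsf < N.sinrNearFixed p i ω ∧ p.epst < N.sinrNear p i ω) ∨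
    (p.Rf < N.dist p i ω ∧ p.epst < N.sinrFar p i ω)

/-- The typical user is associated with a LoS / NLoS ABS. -/
def assocEvent (s : Link) : Set Ω := {ω | ∃ i, N.Serves p i ω ∧ N.state p i ω = s}

/-- The typical user is associated with the ABS tier. -/
def assocABS : Set Ω := {ω | ∃ i, N.Serves p i ω}

/-- The typical user is associated with an ABS and is covered by it. -/
def coverEvent : Set Ω := {ω | ∃ i, N.Serves p i ω ∧ N.Covered p i ω}

variable [MeasurableSpace Ω] (μ : Measure Ω)

/-- `A_L`, `A_N`: probability of association with a LoS / NLoS ABS. -/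
noncomputable def assocProb (s : Link) : ℝ := μ.real (N.assocEvent p s)

/-- `A_A`: probability of association with the ABS tier. -/
noncomputable def assocProbABS : ℝ := μ.real (N.assocABS p)

/-- Coverage probability of the ABS tier: conditional probability of coverage given association with
an ABS. -/
noncomputable def coverageABS : ℝ := (cond μ (N.assocABS p)).real (N.coverEvent p)

/-- Conditional probability of coverage given association with a LoS / NLoS ABS. -/
noncomputable def coverageGiven (s : Link) : ℝ :=
  (cond μ (N.assocEvent p s)).real (N.coverEvent p)

end Network

/-! ### The analytical expressions -/

namespace Params

variable (p : Params)

/-- `exp (-2πλ_A ∫_0^u x P(x) dx)` with `u = √(τ² - h²)`: the probability that no LoS / NLoS ABS is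
closer than `τ`. If `τ < h`, then `u = 0` and the value is `1`. -/
noncomputable def voidProb (s : Link) (τ : ℝ) : ℝ :=
  Real.exp (-2 * Real.pi * p.lamA *
    ∫ x in (0 : ℝ)..Real.sqrt (τ ^ 2 - p.h ^ 2), x * p.linkProb s x)

/-- Density, on `[h, ∞)`, of the distance to the nearest LoS / NLoS ABS. -/
noncomputable def nearestPDF (s : Link) (r : ℝ) : ℝ :=
  2 * Real.pi * p.lamA * r * p.linkProb s (Real.sqrt (r ^ 2 - p.h ^ 2)) * p.voidProb s r

/-- `Q_T`: probability that there is a TBS in the LoS ball. -/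
noncomputable def QT : ℝ := 1 - Real.exp (-Real.pi * p.lamT * p.RB ^ 2)

/-- `τ_{L|N}`. -/
noncomputable def tauLN (r : ℝ) : ℝ :=
  (p.eta .LoS / p.eta .NLoS) ^ (1 / p.alpha .LoS) * r ^ (p.alpha .NLoS / p.alpha .LoS)

/-- `l_{L,h}`. -/
noncomputable def lLh : ℝ := p.tauLN p.h

/-- `l_{L,T}`. -/
noncomputable def lLT : ℝ :=
  (p.eta .LoS / p.etaT) ^ (1 / p.alpha .LoS) * p.RB ^ (p.alphaT / p.alpha .LoS)

/-- `τ_{T|L}`. -/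
noncomputable def tauTL (r : ℝ) : ℝ :=
  (p.etaT / p.eta .LoS) ^ (1 / p.alphaT) * r ^ (p.alpha .LoS / p.alphaT)

/-- `τ_{N|L}`. -/
noncomputable def tauNL (r : ℝ) : ℝ :=
  if r ≤ p.lLh then p.h
  else (p.eta .NLoS / p.eta .LoS) ^ (1 / p.alpha .NLoS) * r ^ (p.alpha .LoS / p.alpha .NLoS)

/-- Density, on `[h, ∞)`, of the serving distance given association with a NLoS ABS, where `AN` is
the association probability. -/
noncomputable def servingPDFN (AN r : ℝ) : ℝ :=
  p.nearestPDF .NLoS r / AN * p.voidProb .LoS (p.tauLN r) * (1 - p.QT)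

/-- Part, on `[h, ∞)`, of the density of the serving distance given association with a LoS ABS that
belongs to the absence of TBSs in the LoS ball; `AL` is the association probability. -/
noncomputable def servingPDFL1 (AL r : ℝ) : ℝ :=
  if r ≤ p.lLh then p.nearestPDF .LoS r / AL * (1 - p.QT)
  else p.nearestPDF .LoS r / AL * p.voidProb .NLoS (p.tauNL r) * (1 - p.QT)

/-- Part, on `[h, ∞)`, of the density of the serving distance given association with a LoS ABS that
belongs to the presence of a TBS in the LoS ball; `AL` is the association probability. -/
noncomputable def servingPDFL2 (AL r : ℝ) : ℝ :=
  if p.lLT < p.lLh then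
    if r ≤ p.lLT then
      p.nearestPDF .LoS r / AL *
        (Real.exp (-Real.pi * p.lamT * p.tauTL r ^ 2) - (1 - p.QT))
    else 0
  else
    if r ≤ p.lLh then
      p.nearestPDF .LoS r / AL *
        (Real.exp (-Real.pi * p.lamT * p.tauTL r ^ 2) - (1 - p.QT))
    else if r ≤ p.lLT then
      p.nearestPDF .LoS r / AL *
        (Real.exp (-Real.pi * p.lamT * p.tauTL r ^ 2) - (1 - p.QT)) *
          p.voidProb .NLoS (p.tauNL r)
    else 0

/-- `f_{R̂_{L,0},1}` and `f_{R̂_{L,0},2}`. -/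
noncomputable def servingPDFL (i : Fin 2) (AL r : ℝ) : ℝ :=
  if i = 0 then p.servingPDFL1 AL r else p.servingPDFL2 AL r

/-- Laplace transform at `t` of the interference from the ABSs in state `s` whose horizontal
distance is larger than `w`. -/
noncomputable def laplacePart (s : Link) (t w : ℝ) : ℝ :=
  Real.exp (-2 * Real.pi * p.lamA * ∫ x in Ioi w,
    (1 - ((1 + t * p.PA * p.C s /
      (p.m s * (x ^ 2 + p.h ^ 2) ^ (p.alpha s / 2))) ^ p.m s)⁻¹) * p.linkProb s x * x)

/-- `L_{I_A}`: Laplace transform at `t` of the interference of the ABS tier, when the typical user is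
associated with a LoS / NLoS ABS at distance `r`. -/
noncomputable def laplaceIA : Link → ℝ → ℝ → ℝ
  | .LoS, r, t =>
      p.laplacePart .LoS t (Real.sqrt (r ^ 2 - p.h ^ 2)) *
        p.laplacePart .NLoS t (Real.sqrt (p.tauNL r ^ 2 - p.h ^ 2))
  | .NLoS, r, t =>
      p.laplacePart .LoS t (Real.sqrt (p.tauLN r ^ 2 - p.h ^ 2)) *
        p.laplacePart .NLoS t (Real.sqrt (r ^ 2 - p.h ^ 2))

/-- `m ε r^α / (P_A C)`. -/
noncomputable def theta (s : Link) (ε r : ℝ) : ℝ :=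
  p.m s * ε * r ^ p.alpha s / (p.PA * p.C s)

/-- Exact coverage probability at serving distance `r` with effective threshold `ε`; the
moment `E[exp (-t I_A) I_A^n]` is written `(-1)^n` times the `n`-th derivative at `t` of the
Laplace transform. -/
noncomputable def covAt (s : Link) (ε r : ℝ) : ℝ :=
  ∑ k ∈ Finset.range (p.m s), ∑ q ∈ Finset.range (k + 1),
    (k.choose q : ℝ) * (p.theta s ε r ^ k / k.factorial) *
      Real.exp (-p.theta s ε r * p.noise) * p.noise ^ q *
      ((-1) ^ (k - q) * iteratedDeriv (k - q) (p.laplaceIA s r) (p.theta s ε r))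

/-- `ε*`. -/
noncomputable def epsStar : ℝ :=
  max (p.epsf / (p.am - p.an * p.epsf)) (p.epst / (p.an - p.beta * p.am * p.epst))

/-- `ε_t^f`. -/
noncomputable def epsFar : ℝ := p.epst / (p.am - p.an * p.epst)

/-- `P_{cov,near|LoS}(r)`, `P_{cov,near|NLoS}(r)`. -/
noncomputable def covNear (s : Link) (r : ℝ) : ℝ :=
  if 0 < p.am - p.an * p.epsf ∧ 0 < p.an - p.beta * p.am * p.epst then p.covAt s p.epsStar r
  else 0

/-- `P_{cov,far|LoS}(r)`, `P_{cov,far|NLoS}(r)`. -/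
noncomputable def covFar (s : Link) (r : ℝ) : ℝ :=
  if 0 < p.am - p.an * p.epst then p.covAt s p.epsFar r else 0

/-- `P_{cov,LoS}`, where `AL` is the LoS association probability. -/
noncomputable def covLoS (AL : ℝ) : ℝ :=
  ∑ i : Fin 2, ((∫ r in p.h..p.Rf, p.covNear .LoS r * p.servingPDFL i AL r) +
    ∫ r in Ioi p.Rf, p.covFar .LoS r * p.servingPDFL i AL r)

/-- `P_{cov,NLoS}`, where `AN` is the NLoS association probability. -/
noncomputable def covNLoS (AN : ℝ) : ℝ :=
  (∫ r in p.h..p.Rf, p.covNear .NLoS r * p.servingPDFN AN r) +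
    ∫ r in Ioi p.Rf, p.covFar .NLoS r * p.servingPDFN AN r

end Params

end NomaHetNet

open scoped ENNReal NNReal

namespace NomaHetNet

/-! The engine is the Mecke formula: summing, over the ABSs, a functional of one ABS and of all the
others gives the integral, against the intensity measure, of the same functional of an added point
and of the whole process. Here the others matter only through their largest average power
(`bestOther`) and their total instantaneous power (`totalOther`). The indicator that the maximum is
at most `u`, times the exponential of `-n` times the sum, is a product over points, and these
products determine the joint law of maximum and sum. So it is enough to have the Laplace functional
and the Mecke formula for products (`IsHPPP.lintegral_infProd`, `IsHPPP.mecke_infProd`, and their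
marked versions). These follow from the Poisson counts for step functions and then by monotone
limits; `mecke_iSup_tsum` passes to all measurable functionals.

Take the functional "this ABS is at least as strong as the others, stronger than every TBS, and
covers the user". Ties are null and the server is unique, so the Mecke sum is a probability
(`measure_exists_serves`). The TBSs are independent of the ABSs and contribute the void probability
`tbsVoid` of a disc. In polar coordinates there remains, for a server in state `s` at distance `r`,
an expectation over its gain and over the other ABSs. Comparisons of powers become exclusion radii
`guard`, and the Laplace functional gives `absVoid * laplaceIA` (`lintegral_best_total`).

Coverage means that the gain exceeds a multiple of interference plus noise. For an integer shape the
gamma tail is a polynomial times an exponential, so its mean involves only the tilted moments of the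
interference, which are derivatives of `laplaceIA`; this is `covAt` (`lintegral_gainLaw_Ioi`). The
piecewise densities of the statement are pieces of the single function `servingDensity`, and the
last identity is the law of total probability. Working in `[0, ∞]` removes integrability questions
until the end, where the integrals converge because they represent probabilities. -/

/-! ### Exponentials and infinite products in `[0, ∞]` -/

/-- The function `x ↦ e^{-x}` on `[0, ∞]`. -/
noncomputable def expNeg (x : ℝ≥0∞) : ℝ≥0∞ := EReal.exp (-(x : EReal))

lemma expNeg_ofReal {x : ℝ} (hx : 0 ≤ x) :
    expNeg (ENNReal.ofReal x) = ENNReal.ofReal (Real.exp (-x)) := by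
  have : ((ENNReal.ofReal x : ℝ≥0∞) : EReal) = (x : EReal) := by
    rw [EReal.coe_ennreal_ofReal, max_eq_left hx]
  rw [expNeg, this, ← EReal.coe_neg, EReal.exp_coe]

lemma expNeg_eq {x : ℝ≥0∞} (hx : x ≠ ⊤) :
    expNeg x = ENNReal.ofReal (Real.exp (-x.toReal)) := by
  conv_lhs => rw [← ENNReal.ofReal_toReal hx]
  exact expNeg_ofReal ENNReal.toReal_nonneg

@[simp] lemma expNeg_zero : expNeg 0 = 1 := by simp [expNeg]

lemma expNeg_add (x y : ℝ≥0∞) : expNeg (x + y) = expNeg x * expNeg y := by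
  rw [expNeg, expNeg, expNeg, EReal.exp_neg, EReal.coe_ennreal_add, EReal.exp_add,
    ENNReal.mul_inv, EReal.exp_neg, EReal.exp_neg]
  · left; simp [EReal.exp_eq_zero_iff]
  · right; simp [EReal.exp_eq_zero_iff]

lemma expNeg_sum {ι : Type*} (s : Finset ι) (f : ι → ℝ≥0∞) :
    expNeg (∑ i ∈ s, f i) = ∏ i ∈ s, expNeg (f i) := by
  classical
  induction s using Finset.induction_on with
  | empty => simp
  | insert a s ha ih => rw [Finset.sum_insert ha, Finset.prod_insert ha, expNeg_add, ih]

lemma expNeg_nsmul (n : ℕ) (x : ℝ≥0∞) : expNeg (n * x) = expNeg x ^ n := by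
  have := expNeg_sum (Finset.range n) (fun _ => x)
  simpa using this

lemma expNeg_strictAnti : StrictAnti expNeg := fun x y h => by
  rw [expNeg, expNeg, EReal.exp_lt_exp_iff, EReal.neg_lt_neg_iff]
  exact_mod_cast h

lemma expNeg_le_one (x : ℝ≥0∞) : expNeg x ≤ 1 := by
  simpa using expNeg_strictAnti.antitone (zero_le (a := x))

lemma continuous_expNeg : Continuous expNeg :=
  ENNReal.continuous_exp.comp (continuous_neg.comp continuous_coe_ennreal_ereal)

lemma measurable_expNeg : Measurable expNeg := continuous_expNeg.measurable

lemma expNeg_iSup (f : ℕ → ℝ≥0∞) : expNeg (⨆ n, f n) = ⨅ n, expNeg (f n) :=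
  expNeg_strictAnti.antitone.map_ciSup_of_continuousAt continuous_expNeg.continuousAt
    (OrderTop.bddAbove _)

/-- The reason for taking an infimum of partial products as the infinite product: with factors at
most 1 it needs no convergence condition, and a divergent sum simply gives 0. -/
lemma expNeg_tsum (f : ℕ → ℝ≥0∞) :
    expNeg (∑' i, f i) = ⨅ n, ∏ i ∈ Finset.range n, expNeg (f i) := by
  rw [ENNReal.tsum_eq_iSup_nat, expNeg_iSup]
  simp_rw [expNeg_sum]

/-- Infinite product of numbers in `[0, 1]`. -/
noncomputable def infProd (a : ℕ → ℝ≥0∞) : ℝ≥0∞ := ⨅ n, ∏ j ∈ Finset.range n, a j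

lemma antitone_prod_range {a : ℕ → ℝ≥0∞} (ha : ∀ j, a j ≤ 1) :
    Antitone fun n => ∏ j ∈ Finset.range n, a j := by
  refine antitone_nat_of_succ_le fun n => ?_
  rw [Finset.prod_range_succ]
  exact mul_le_of_le_one_right' (ha n)

lemma infProd_le_one (a : ℕ → ℝ≥0∞) : infProd a ≤ 1 :=
  (iInf_le _ 0).trans (by simp)

/-- The partial products are decreasing and become constant once the range contains `T`. -/
lemma infProd_eq_prod {a : ℕ → ℝ≥0∞} (ha : ∀ j, a j ≤ 1) (T : Finset ℕ)
    (hT : ∀ j, j ∉ T → a j = 1) : infProd a = ∏ j ∈ T, a j := by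
  obtain ⟨n, hn⟩ : ∃ n, T ⊆ Finset.range n := T.exists_nat_subset_range
  have key : ∀ m, n ≤ m → ∏ j ∈ Finset.range m, a j = ∏ j ∈ T, a j := fun m hm =>
    (Finset.prod_subset (hn.trans (Finset.range_mono hm)) fun j _ hj => hT j hj).symm
  refine le_antisymm ((iInf_le _ n).trans (key n le_rfl).le) (le_iInf fun m => ?_)
  rcases le_total n m with h | h
  · exact (key m h).ge
  · rw [← key n le_rfl]
    exact antitone_prod_range ha h

/-- Two infima commute, and a finite product of bounded decreasing sequences is continuous along
them. It carries product functionals through decreasing approximations. -/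
lemma infProd_iInf {a : ℕ → ℕ → ℝ≥0∞} (ha : ∀ n j, a n j ≤ 1)
    (hanti : ∀ j, Antitone fun n => a n j) :
    infProd (fun j => ⨅ n, a n j) = ⨅ n, infProd (a n) := by
  unfold infProd
  rw [iInf_comm]
  congr 1
  ext m
  have h1 : Filter.Tendsto (fun n => ∏ j ∈ Finset.range m, a n j) Filter.atTop
      (nhds (∏ j ∈ Finset.range m, ⨅ n, a n j)) := by
    refine ENNReal.tendsto_finsetProd_of_ne_top _ (fun j _ => tendsto_atTop_iInf (hanti j)) ?_
    intro j _
    exact ((iInf_le _ 0).trans (ha 0 j)).trans_lt ENNReal.one_lt_top |>.ne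
  have h2 : Antitone fun n => ∏ j ∈ Finset.range m, a n j := fun n n' h =>
    Finset.prod_le_prod' fun j _ => hanti j h
  exact tendsto_nhds_unique h1 (tendsto_atTop_iInf h2)

lemma measurable_infProd {Ω : Type*} [MeasurableSpace Ω] {f : ℕ → Ω → ℝ≥0∞}
    (hf : ∀ j, Measurable (f j)) : Measurable fun ω => infProd fun j => f j ω :=
  Measurable.iInf fun _ => Finset.measurable_fun_prod _ fun j _ => hf j

/-- The sequence `a` with its `i`-th term replaced by `1`. -/
def except (i : ℕ) (a : ℕ → ℝ≥0∞) (j : ℕ) : ℝ≥0∞ := if j = i then 1 else a j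

lemma except_le_one {a : ℕ → ℝ≥0∞} (ha : ∀ j, a j ≤ 1) (i j : ℕ) : except i a j ≤ 1 := by
  unfold except; split_ifs <;> simp [ha]

lemma measurable_except {Ω : Type*} [MeasurableSpace Ω] {f : ℕ → Ω → ℝ≥0∞}
    (hf : ∀ j, Measurable (f j)) (i j : ℕ) : Measurable fun ω => except i (fun j => f j ω) j := by
  unfold except; split_ifs
  · exact measurable_const
  · exact hf j

/-! ### Poisson sums -/

lemma tsum_poisson_pow (r : ℝ≥0) {g : ℝ≥0∞} (hg : g ≤ 1) :
    ∑' c : ℕ, poissonMeasure r {c} * g ^ c = expNeg (r * (1 - g)) := by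
  lift g to ℝ≥0 using (hg.trans_lt ENNReal.one_lt_top).ne
  have hg' : (g : ℝ) ≤ 1 := by exact_mod_cast hg
  have h1 : (r : ℝ≥0∞) * (1 - g) = ENNReal.ofReal (r * (1 - g)) := by
    rw [ENNReal.ofReal_mul (NNReal.coe_nonneg r), ENNReal.ofReal_sub _ (NNReal.coe_nonneg g)]; simp
  rw [h1, expNeg_ofReal (mul_nonneg (NNReal.coe_nonneg r) (by linarith))]
  have h2 : ∀ c : ℕ, poissonMeasure r {c} * (g : ℝ≥0∞) ^ c =
      ENNReal.ofReal (Real.exp (-r) * ((r * g) ^ c / c.factorial)) := fun c => by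
    rw [poissonMeasure_singleton, ← ENNReal.ofReal_coe_nnreal (p := g),
      ← ENNReal.ofReal_pow (NNReal.coe_nonneg g), ← ENNReal.ofReal_mul (by positivity)]
    congr 1; rw [mul_pow]; ring
  simp_rw [h2]
  have hs := NormedSpace.expSeries_div_hasSum_exp ((r : ℝ) * g)
  rw [← Real.exp_eq_exp_ℝ] at hs
  have hs' := hs.mul_left (Real.exp (-r))
  rw [← ENNReal.ofReal_tsum_of_nonneg (fun c => by positivity) hs'.summable, hs'.tsum_eq,
    ← Real.exp_add]
  congr 2; ring

/-- This is the derivative in `g` of the generating function above: the factor `c` counts the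
choices of a distinguished point, the power `c - 1` the points left. The truncated subtraction at `c
= 0` is harmless because the factor `c` vanishes. -/
lemma tsum_poisson_mul_pow_pred (r : ℝ≥0) {g : ℝ≥0∞} (hg : g ≤ 1) :
    ∑' c : ℕ, poissonMeasure r {c} * (c * g ^ (c - 1)) = r * expNeg (r * (1 - g)) := by
  rw [tsum_eq_zero_add' ENNReal.summable, ← tsum_poisson_pow r hg, ← ENNReal.tsum_mul_left]
  simp only [Nat.cast_zero, zero_mul, mul_zero, zero_add, Nat.add_sub_cancel]
  refine tsum_congr fun c => ?_
  have : poissonMeasure r {c + 1} * ((c + 1 : ℕ) : ℝ≥0∞) = r * poissonMeasure r {c} := by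
    rw [poissonMeasure_singleton, poissonMeasure_singleton, ← ENNReal.ofReal_natCast,
      ← ENNReal.ofReal_coe_nnreal (p := r), ← ENNReal.ofReal_mul (by positivity),
      ← ENNReal.ofReal_mul (NNReal.coe_nonneg r)]
    congr 1
    rw [Nat.factorial_succ, Nat.cast_mul]
    field_simp
    ring
  rw [← mul_assoc, this, mul_assoc]

/-! ### Counts of a Poisson point process -/

/-- As a number in `[0, ∞]` the count is a sum of indicators; since `ℕ∞` is countable, measurable
fibres suffice. -/
lemma measurable_encard {Ω E : Type*} [MeasurableSpace Ω] [MeasurableSpace E] {X : ℕ → Ω → E}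
    (hX : ∀ i, Measurable (X i)) {B : Set E} (hB : MeasurableSet B) :
    Measurable fun ω => {i | X i ω ∈ B}.encard := by
  have h : Measurable fun ω => (({i | X i ω ∈ B}.encard : ℕ∞) : ℝ≥0∞) := by
    have : (fun ω => (({i | X i ω ∈ B}.encard : ℕ∞) : ℝ≥0∞)) =
        fun ω => ∑' i, B.indicator 1 (X i ω) := by
      ext ω
      rw [← ENNReal.tsum_set_one, tsum_subtype {i | X i ω ∈ B} (fun _ => (1 : ℝ≥0∞))]
      rfl
    rw [this]
    exact Measurable.tsum fun i => (measurable_one.indicator hB).comp (hX i)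
  refine measurable_to_countable' fun c => ?_
  have : (fun ω => {i | X i ω ∈ B}.encard) ⁻¹' {c} =
      (fun ω => (({i | X i ω ∈ B}.encard : ℕ∞) : ℝ≥0∞)) ⁻¹' {(c : ℝ≥0∞)} := by
    ext ω; simp
  rw [this]
  exact h (measurableSet_singleton _)

section Counts

variable {Ω : Type*} [MeasurableSpace Ω] {μ : Measure Ω} [IsProbabilityMeasure μ] {lam : ℝ}
  {X : ℕ → Ω → Plane} {ι : Type*} [Fintype ι] {B : ι → Set Plane}

lemma IsHPPP.count_eq (hX : IsHPPP μ lam X) (hB : ∀ k, MeasurableSet (B k))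
    (hfin : ∀ k, volume (B k) < ⊤) (hdisj : Pairwise fun k l => Disjoint (B k) (B l))
    (c : ι → ℕ) :
    μ {ω | ∀ k, {i | X i ω ∈ B k}.encard = (c k : ℕ∞)} =
      ∏ k, poissonMeasure (lam * (volume (B k)).toReal).toNNReal {c k} := by
  let e := Fintype.equivFin ι
  have := hX.count _ (fun k => B (e.symm k)) (fun k => c (e.symm k)) (fun k => hB _)
    (fun k => hfin _) (fun k l h => hdisj (e.symm.injective.ne h))
  rw [← e.symm.prod_comp]
  rw [← this]
  congr 1
  ext ω
  exact e.symm.forall_congr_right.symm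

/-- `IsHPPP.count` prescribes only the probabilities of finite counts. They are the masses of a
product of Poisson laws, so they add up to 1 and leave nothing for infinite counts. -/
lemma IsHPPP.ae_count_ne_top (hX : IsHPPP μ lam X) (hB : ∀ k, MeasurableSet (B k))
    (hfin : ∀ k, volume (B k) < ⊤) (hdisj : Pairwise fun k l => Disjoint (B k) (B l)) :
    ∀ᵐ ω ∂μ, ∀ k, {i | X i ω ∈ B k}.encard ≠ ⊤ := by
  have hm : ∀ c : ι → ℕ, MeasurableSet {ω | ∀ k, {i | X i ω ∈ B k}.encard = (c k : ℕ∞)} :=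
    fun c => by
      rw [ofPred_forall]
      exact MeasurableSet.iInter fun k =>
        measurable_encard hX.measurable (hB k) (measurableSet_singleton _)
  have h1 : μ (⋃ c : ι → ℕ, {ω | ∀ k, {i | X i ω ∈ B k}.encard = (c k : ℕ∞)}) = 1 := by
    rw [measure_iUnion _ hm]
    · simp_rw [hX.count_eq hB hfin hdisj]
      have : ∀ c : ι → ℕ, ∏ k, poissonMeasure (lam * (volume (B k)).toReal).toNNReal {c k} =
          Measure.pi (fun k => poissonMeasure (lam * (volume (B k)).toReal).toNNReal) {c} :=
        fun c => (Measure.pi_singleton _ _).symm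
      simp_rw [this]
      rw [← measure_iUnion _ fun c => measurableSet_singleton c]
      · rw [iUnion_of_singleton, measure_univ]
      · intro c c' h
        simpa using h
    · intro c c' h
      refine Set.disjoint_left.2 fun ω h1 h2 => h ?_
      ext k
      have := (h1 k).symm.trans (h2 k)
      exact_mod_cast this
  rw [← prob_compl_eq_zero_iff (MeasurableSet.iUnion hm)] at h1
  filter_upwards [measure_eq_zero_iff_ae_notMem.1 h1] with ω hω k
  simp only [mem_compl_iff, not_not, mem_iUnion] at hω
  obtain ⟨c, hc⟩ := hω
  rw [hc k]
  exact ENat.natCast_ne_top _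

/-- The vector of counts has the product of the Poisson laws as its law, because singletons
determine a measure on a countable space. Reading an infinite count as 0 through `toNat` changes
only a null set. -/
lemma IsHPPP.lintegral_prod_count (hX : IsHPPP μ lam X) (hB : ∀ k, MeasurableSet (B k))
    (hfin : ∀ k, volume (B k) < ⊤) (hdisj : Pairwise fun k l => Disjoint (B k) (B l))
    (u : ι → ℕ → ℝ≥0∞) :
    ∫⁻ ω, ∏ k, u k {i | X i ω ∈ B k}.encard.toNat ∂μ =
      ∏ k, ∑' c, poissonMeasure (lam * (volume (B k)).toReal).toNNReal {c} * u k c := by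
  set P := fun k => poissonMeasure (lam * (volume (B k)).toReal).toNNReal with hP
  set C : Ω → ι → ℕ := fun ω k => {i | X i ω ∈ B k}.encard.toNat with hC
  have hCm : Measurable C := measurable_pi_lambda _ fun k =>
    (measurable_of_countable ENat.toNat).comp (measurable_encard hX.measurable (hB k))
  have hmap : μ.map C = Measure.pi P := by
    refine Measure.ext_of_singleton fun c => ?_
    rw [Measure.map_apply hCm (measurableSet_singleton _), Measure.pi_singleton,
      ← hX.count_eq hB hfin hdisj]
    refine measure_congr ?_
    filter_upwards [hX.ae_count_ne_top hB hfin hdisj] with ω hω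
    refine propext ⟨fun h k => ?_, fun h => ?_⟩
    · have h' : C ω = c := h
      rw [← h', hC]
      exact (ENat.natCast_toNat (hω k)).symm
    · show C ω = c
      ext k
      simp only [hC]
      rw [h k]; rfl
  have h1 : ∫⁻ ω, ∏ k, u k (C ω k) ∂μ = ∫⁻ c, ∏ k, u k (c k) ∂Measure.pi P := by
    rw [← hmap, lintegral_map (measurable_of_countable _) hCm]
  have hind : iIndepFun (fun k (c : ι → ℕ) => u k (c k)) (Measure.pi P) :=
    iIndepFun_pi (X := u) fun k => (measurable_of_countable _).aemeasurable
  rw [h1, lintegral_prod_eq_prod_lintegral_of_indepFun _ _ hind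
    fun k => measurable_of_countable _]
  refine Finset.prod_congr rfl fun k _ => ?_
  rw [(measurePreserving_eval P k).lintegral_comp (measurable_of_countable (u k)),
    lintegral_countable']
  exact tsum_congr fun c => mul_comm _ _

end Counts

/-! ### Product functionals of a Poisson point process -/

section Pathwise

variable {E ι : Type*} [Fintype ι] {B : ι → Set E} {γ : ι → ℝ≥0∞} {g : E → ℝ≥0∞} {x : ℕ → E}

/-- For a step function the product depends on the configuration only through the counts of the
cells. In the second identity each of the points in the cell `k₀` contributes the same product, with
one factor `γ k₀` missing. -/
lemma infProd_eq_prod_pow [DecidableEq ι] (hdisj : Pairwise fun k l => Disjoint (B k) (B l))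
    (hg : ∀ y, g y ≤ 1) (hgB : ∀ k, ∀ y ∈ B k, g y = γ k) (hg1 : ∀ y, (∀ k, y ∉ B k) → g y = 1)
    (hfin : ∀ k, {i | x i ∈ B k}.encard ≠ ⊤) :
    infProd (fun j => g (x j)) = ∏ k, γ k ^ {i | x i ∈ B k}.encard.toNat ∧
    ∀ k₀, ∑' i, (B k₀).indicator 1 (x i) * infProd (except i fun j => g (x j)) =
      ∏ k, if k = k₀ then ({i | x i ∈ B k}.encard.toNat *
        γ k ^ ({i | x i ∈ B k}.encard.toNat - 1) : ℝ≥0∞)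
        else γ k ^ {i | x i ∈ B k}.encard.toNat := by
  have hF : ∀ k, {i | x i ∈ B k}.Finite := fun k => Set.encard_ne_top_iff.1 (hfin k)
  set T : ι → Finset ℕ := fun k => (hF k).toFinset with hT
  have hmem : ∀ k i, i ∈ T k ↔ x i ∈ B k := fun k i => by simp [hT]
  have hcard : ∀ k, {i | x i ∈ B k}.encard.toNat = (T k).card := fun k => by
    rw [(hF k).encard_eq_coe_toFinset_card]; rfl
  have hTd : Set.PairwiseDisjoint (↑(Finset.univ : Finset ι)) T := fun k _ l _ hkl =>
    Finset.disjoint_left.2 fun i hi hi' =>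
      Set.disjoint_left.1 (hdisj hkl) ((hmem k i).1 hi) ((hmem l i).1 hi')
  simp_rw [hcard]
  constructor
  · rw [infProd_eq_prod (fun j => hg _) (Finset.univ.biUnion T), Finset.prod_biUnion hTd]
    · refine Finset.prod_congr rfl fun k _ => ?_
      exact Finset.prod_eq_pow_card fun i hi => hgB k _ ((hmem k i).1 hi)
    · intro j hj
      refine hg1 _ fun k hk => hj ?_
      exact Finset.mem_biUnion.2 ⟨k, Finset.mem_univ _, (hmem k j).2 hk⟩
  · intro k₀
    set c : ℝ≥0∞ := ∏ k, if k = k₀ then γ k ^ ((T k).card - 1) else γ k ^ (T k).card with hc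
    have hterm : ∀ i ∈ T k₀, infProd (except i fun j => g (x j)) = c := by
      intro i hi
      rw [infProd_eq_prod (except_le_one (fun j => hg _) i) (Finset.univ.biUnion T),
        Finset.prod_biUnion hTd]
      · refine Finset.prod_congr rfl fun k _ => ?_
        split_ifs with hk
        · subst hk
          rw [← Finset.mul_prod_erase _ _ hi, except, if_pos rfl, one_mul,
            ← Finset.card_erase_of_mem hi]
          refine Finset.prod_eq_pow_card fun j hj => ?_
          rw [except, if_neg (Finset.ne_of_mem_erase hj)]
          exact hgB k _ ((hmem k j).1 (Finset.mem_of_mem_erase hj))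
        · refine Finset.prod_eq_pow_card fun j hj => ?_
          rw [except, if_neg]
          · exact hgB k _ ((hmem k j).1 hj)
          · rintro rfl
            exact Set.disjoint_left.1 (hdisj hk) ((hmem k j).1 hj) ((hmem k₀ j).1 hi)
      · intro j hj
        unfold except
        split_ifs
        · rfl
        · refine hg1 _ fun k hk => hj ?_
          exact Finset.mem_biUnion.2 ⟨k, Finset.mem_univ _, (hmem k j).2 hk⟩
    rw [tsum_eq_sum (s := T k₀)]
    · rw [Finset.sum_congr rfl (g := fun _ => c)]
      · rw [Finset.sum_const, nsmul_eq_mul, hc, ← Finset.mul_prod_erase _ _ (Finset.mem_univ k₀),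
          ← Finset.mul_prod_erase _ _ (Finset.mem_univ k₀), if_pos rfl, if_pos rfl, mul_assoc]
        congr 2
        refine Finset.prod_congr rfl fun k hk => ?_
        rw [if_neg (Finset.ne_of_mem_erase hk), if_neg (Finset.ne_of_mem_erase hk)]
      · intro i hi
        rw [hterm i hi, indicator_of_mem ((hmem k₀ i).1 hi)]
        simp
    · intro i hi
      rw [indicator_of_notMem (fun h => hi ((hmem k₀ i).2 h)), zero_mul]

end Pathwise

section Simple

variable {Ω : Type*} [MeasurableSpace Ω] {μ : Measure Ω} [IsProbabilityMeasure μ] {lam : ℝ}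
  {X : ℕ → Ω → Plane}

lemma coe_mean (hlam : 0 ≤ lam) {B : Set Plane} (hB : volume B < ⊤) :
    (((lam * (volume B).toReal).toNNReal : ℝ≥0) : ℝ≥0∞) = ENNReal.ofReal lam * volume B := by
  change ENNReal.ofReal _ = _
  rw [ENNReal.ofReal_mul hlam, ENNReal.ofReal_toReal hB.ne]

lemma IsHPPP.lintegral_step (hX : IsHPPP μ lam X) (hlam : 0 ≤ lam) {ι : Type*} [Fintype ι]
    {B : ι → Set Plane} {γ : ι → ℝ≥0∞} {g : Plane → ℝ≥0∞}
    (hB : ∀ k, MeasurableSet (B k)) (hvol : ∀ k, volume (B k) < ⊤)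
    (hdisj : Pairwise fun k l => Disjoint (B k) (B l))
    (hg : ∀ y, g y ≤ 1) (hgB : ∀ k, ∀ y ∈ B k, g y = γ k) (hg1 : ∀ y, (∀ k, y ∉ B k) → g y = 1)
    (hγ : ∀ k, γ k ≤ 1) :
    ∫⁻ ω, infProd (fun j => g (X j ω)) ∂μ =
      expNeg (ENNReal.ofReal lam * ∫⁻ y, (1 - g y)) ∧
    ∀ k₀, ∫⁻ ω, ∑' i, (B k₀).indicator 1 (X i ω) * infProd (except i fun j => g (X j ω)) ∂μ =
      ENNReal.ofReal lam * volume (B k₀) *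
        expNeg (ENNReal.ofReal lam * ∫⁻ y, (1 - g y)) := by
  classical
  have hint : ENNReal.ofReal lam * ∫⁻ y, (1 - g y) =
      ∑ k, ENNReal.ofReal lam * volume (B k) * (1 - γ k) := by
    have : ∀ y, 1 - g y = ∑ k, (B k).indicator (fun _ => 1 - γ k) y := by
      intro y
      by_cases h : ∃ k, y ∈ B k
      · obtain ⟨k, hk⟩ := h
        rw [Finset.sum_eq_single k, indicator_of_mem hk, hgB k y hk]
        · intro l _ hl
          exact indicator_of_notMem (fun h => Set.disjoint_left.1 (hdisj hl) h hk) _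
        · simp
      · push Not at h
        rw [hg1 y h, tsub_self, Finset.sum_eq_zero]
        intro k _
        exact indicator_of_notMem (h k) _
    simp_rw [this]
    rw [lintegral_finsetSum _ fun k _ => measurable_const.indicator (hB k), Finset.mul_sum]
    refine Finset.sum_congr rfl fun k _ => ?_
    rw [lintegral_indicator_const (hB k), mul_assoc, mul_comm (1 - γ k)]
  rw [hint, expNeg_sum]
  have hae := hX.ae_count_ne_top hB hvol hdisj
  constructor
  · rw [lintegral_congr_ae (hae.mono fun ω hω =>
      (infProd_eq_prod_pow (x := fun i => X i ω) hdisj hg hgB hg1 hω).1)]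
    rw [hX.lintegral_prod_count hB hvol hdisj fun k c => γ k ^ c]
    refine Finset.prod_congr rfl fun k _ => ?_
    rw [tsum_poisson_pow _ (hγ k), coe_mean hlam (hvol k)]
  · intro k₀
    rw [lintegral_congr_ae (hae.mono fun ω hω =>
      (infProd_eq_prod_pow (x := fun i => X i ω) hdisj hg hgB hg1 hω).2 k₀)]
    rw [hX.lintegral_prod_count hB hvol hdisj fun k c =>
      if k = k₀ then (c * γ k ^ (c - 1) : ℝ≥0∞) else γ k ^ c]
    rw [← Finset.mul_prod_erase _ _ (Finset.mem_univ k₀),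
      ← Finset.mul_prod_erase _ (fun k => expNeg _) (Finset.mem_univ k₀), ← mul_assoc]
    congr 1
    · simp only [if_true]
      rw [tsum_poisson_mul_pow_pred _ (hγ k₀), coe_mean hlam (hvol k₀)]
    · refine Finset.prod_congr rfl fun k hk => ?_
      simp only [if_neg (Finset.ne_of_mem_erase hk)]
      rw [tsum_poisson_pow _ (hγ k), coe_mean hlam (hvol k)]

/-- The cells are the level sets of `g` inside `D`, each cut in two by `A` (the Boolean index), so
that `A` is itself a union of cells. -/
lemma IsHPPP.lintegral_finite_range (hX : IsHPPP μ lam X) (hlam : 0 ≤ lam)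
    {g : Plane → ℝ≥0∞} (hgm : Measurable g) (hg : ∀ y, g y ≤ 1) (hrange : (range g).Finite)
    {D A : Set Plane} (hD : MeasurableSet D) (hDvol : volume D < ⊤) (hgD : ∀ y ∉ D, g y = 1)
    (hA : MeasurableSet A) (hAD : A ⊆ D) :
    ∫⁻ ω, infProd (fun j => g (X j ω)) ∂μ =
      expNeg (ENNReal.ofReal lam * ∫⁻ y, (1 - g y)) ∧
    ∫⁻ ω, ∑' i, A.indicator 1 (X i ω) * infProd (except i fun j => g (X j ω)) ∂μ =
      ENNReal.ofReal lam * volume A * expNeg (ENNReal.ofReal lam * ∫⁻ y, (1 - g y)) := by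
  classical
  have : Fintype (range g) := hrange.fintype
  let B : (range g) × Bool → Set Plane := fun k =>
    g ⁻¹' {k.1.1} ∩ (if k.2 then A else D \ A)
  have hB : ∀ k, MeasurableSet (B k) := fun k => by
    refine (hgm (measurableSet_singleton _)).inter ?_
    split_ifs
    exacts [hA, hD.diff hA]
  have hBD : ∀ k, B k ⊆ D := fun k => by
    rintro y ⟨_, hy⟩
    split_ifs at hy
    exacts [hAD hy, hy.1]
  have hdisj : Pairwise fun k l => Disjoint (B k) (B l) := by
    rintro ⟨v, b⟩ ⟨w, c⟩ hne
    refine Set.disjoint_left.2 ?_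
    rintro y ⟨hy1, hy2⟩ ⟨hy3, hy4⟩
    have hvw : v = w := Subtype.ext (hy1.symm.trans hy3)
    cases b <;> cases c <;> simp_all
  have hcover : ∀ y ∈ D, ∃ k, y ∈ B k := fun y hy => by
    by_cases h : y ∈ A
    · exact ⟨(⟨g y, y, rfl⟩, true), rfl, by simpa using h⟩
    · exact ⟨(⟨g y, y, rfl⟩, false), rfl, by simpa using ⟨hy, h⟩⟩
  have hvol : ∀ k, volume (B k) < ⊤ := fun k => (measure_mono (hBD k)).trans_lt hDvol
  obtain ⟨h1, h2⟩ := hX.lintegral_step hlam (γ := fun k => k.1.1) hB hvol hdisj hg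
    (fun k y hy => by simpa using hy.1) (fun y hy => hgD y fun h => by
      obtain ⟨k, hk⟩ := hcover y h
      exact hy k hk) (fun k => by obtain ⟨y, hy⟩ := k.1.2; rw [← hy]; exact hg y)
  refine ⟨h1, ?_⟩
  have hAB : A = ⋃ v : range g, B (v, true) := by
    ext y
    simp [B]
  have hdisj' : Pairwise (Function.onFun Disjoint fun v : range g => B (v, true)) :=
    fun v w h => hdisj (by simpa using h)
  have hind : ∀ y, A.indicator (1 : Plane → ℝ≥0∞) y =
      ∑ v : range g, (B (v, true)).indicator 1 y := by
    intro y
    by_cases h : y ∈ A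
    · rw [Finset.sum_eq_single ⟨g y, y, rfl⟩, indicator_of_mem h, indicator_of_mem, Pi.one_apply]
      · exact ⟨rfl, by simpa using h⟩
      · intro v _ hv
        refine indicator_of_notMem (fun hy => hv ?_) _
        exact Subtype.ext hy.1.symm
      · simp
    · rw [indicator_of_notMem h, Finset.sum_eq_zero]
      intro v _
      refine indicator_of_notMem (fun hy => h ?_) _
      simpa using hy.2
  have hmeas : ∀ i, Measurable fun ω => infProd (except i fun j => g (X j ω)) := fun i =>
    measurable_infProd fun j => measurable_except (fun j => hgm.comp (hX.measurable j)) i j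
  have hsum : ∀ ω, ∑' i, A.indicator 1 (X i ω) * infProd (except i fun j => g (X j ω)) =
      ∑ v : range g, ∑' i, (B (v, true)).indicator 1 (X i ω) *
        infProd (except i fun j => g (X j ω)) := by
    intro ω
    simp_rw [hind, Finset.sum_mul]
    exact Summable.tsum_finsetSum fun _ _ => ENNReal.summable
  simp_rw [hsum]
  rw [lintegral_finsetSum]
  · simp_rw [h2]
    rw [← Finset.sum_mul, ← Finset.mul_sum]
    congr 2
    conv_rhs => rw [hAB]
    rw [measure_iUnion hdisj' fun v => hB _, tsum_fintype]
  · intro v _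
    exact Measurable.tsum fun i =>
      ((measurable_one.indicator (hB _)).comp (hX.measurable i)).mul (hmeas i)

end Simple

/-- Every measurable set is an increasing union of sets of finite `ν`-measure. No finiteness of `m₁`
and `m₂` has to be known beforehand. -/
lemma ext_of_measure_lt_top {E : Type*} [MeasurableSpace E] {m₁ m₂ : Measure E} (ν : Measure E)
    [SigmaFinite ν]
    (h : ∀ A, MeasurableSet A → ν A < ⊤ → m₁ A = m₂ A) : m₁ = m₂ := by
  refine Measure.ext fun s hs => ?_
  have hs' : s = ⋃ n, s ∩ spanningSets ν n := by
    rw [← inter_iUnion, iUnion_spanningSets, inter_univ]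
  have hmono : Monotone fun n => s ∩ spanningSets ν n := fun a b hab =>
    inter_subset_inter_right _ (monotone_spanningSets ν hab)
  rw [hs', hmono.measure_iUnion, hmono.measure_iUnion]
  refine iSup_congr fun n => h _ (hs.inter (measurableSet_spanningSets ν n)) ?_
  exact (measure_mono inter_subset_right).trans_lt (measure_spanningSets_lt_top ν n)

/-! ### From step functions to measurable functions -/

section General

variable {Ω : Type*} [MeasurableSpace Ω] {μ : Measure Ω} [IsProbabilityMeasure μ] {lam : ℝ}
  {X : ℕ → Ω → Plane}

lemma IsHPPP.lintegral_infProd_indicator (hX : IsHPPP μ lam X) (hlam : 0 ≤ lam)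
    {g : Plane → ℝ≥0∞} (hgm : Measurable g) (hg : ∀ y, g y ≤ 1)
    {A : Set Plane} (hA : MeasurableSet A) (hAvol : volume A < ⊤) :
    ∫⁻ ω, infProd (fun j => g (X j ω)) ∂μ =
      expNeg (ENNReal.ofReal lam * ∫⁻ y, (1 - g y)) ∧
    ∑' i, ∫⁻ ω, A.indicator 1 (X i ω) * infProd (except i fun j => g (X j ω)) ∂μ =
      ENNReal.ofReal lam * volume A * expNeg (ENNReal.ofReal lam * ∫⁻ y, (1 - g y)) := by
  let D : ℕ → Set Plane := fun n => Metric.ball 0 n ∪ A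
  have hD : ∀ n, MeasurableSet (D n) := fun n => Metric.isOpen_ball.measurableSet.union hA
  have hDvol : ∀ n, volume (D n) < ⊤ := fun n =>
    measure_union_lt_top Metric.isBounded_ball.measure_lt_top hAvol
  have hDmono : Monotone D := fun m n h =>
    union_subset_union_left _ (Metric.ball_subset_ball (by exact_mod_cast h))
  -- Simple functions increasing to `1 - g`, cut off to a set of finite area; then `1 - s n`
  -- decreases to `g`, has finite range and equals 1 off `D n`.
  let s : ℕ → SimpleFunc Plane ℝ≥0∞ := fun n => (SimpleFunc.eapprox (fun y => 1 - g y) n).restrict (D n)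
  have hs : ∀ n y, s n y = (D n).indicator (SimpleFunc.eapprox (fun y => 1 - g y) n) y := fun n y =>
    congrFun (SimpleFunc.coe_restrict _ (hD n)) y
  have hsmono : ∀ y, Monotone fun n => s n y := by
    intro y m n h
    simp only [hs]
    refine (indicator_le_indicator_of_subset (hDmono h) (fun _ => zero_le) y).trans ?_
    exact indicator_le_indicator (SimpleFunc.monotone_eapprox _ h y)
  have hssup : ∀ y, ⨆ n, s n y = 1 - g y := by
    intro y
    refine tendsto_nhds_unique (tendsto_atTop_iSup (hsmono y)) ?_
    refine (SimpleFunc.tendsto_eapprox (measurable_const.sub hgm) y).congr' ?_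
    obtain ⟨N, hN⟩ := exists_nat_gt ‖y‖
    filter_upwards [Filter.eventually_ge_atTop N] with n hn
    have hy : y ∈ D n := by
      left
      rw [mem_ball_zero_iff]
      exact hN.trans_le (by exact_mod_cast hn)
    rw [hs, indicator_of_mem hy]
    rfl
  have hsle : ∀ n y, s n y ≤ 1 := fun n y =>
    (le_iSup (fun n => s n y) n).trans ((hssup y).le.trans tsub_le_self)
  let gn : ℕ → Plane → ℝ≥0∞ := fun n y => 1 - s n y
  have hgnm : ∀ n, Measurable (gn n) := fun n => measurable_const.sub (s n).measurable
  have hgn1 : ∀ n y, gn n y ≤ 1 := fun n y => tsub_le_self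
  have hgnanti : ∀ y, Antitone fun n => gn n y := fun y m n h => tsub_le_tsub_left (hsmono y h) 1
  have hgninf : ∀ y, ⨅ n, gn n y = g y := by
    intro y
    rw [← ENNReal.sub_iSup ENNReal.one_ne_top, hssup,
      ENNReal.sub_sub_cancel ENNReal.one_ne_top (hg y)]
  have hsub : ∀ n y, 1 - gn n y = s n y := fun n y =>
    ENNReal.sub_sub_cancel ENNReal.one_ne_top (hsle n y)
  have hkey : ∀ n, _ := fun n => hX.lintegral_finite_range hlam (hgnm n) (hgn1 n)
    (by
      have := ((s n).map fun a => 1 - a).finite_range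
      rwa [SimpleFunc.coe_map] at this) (hD n) (hDvol n)
    (fun y hy => by simp only [gn, hs, indicator_of_notMem hy, tsub_zero]) hA subset_union_right
  have hlim : ⨅ n, expNeg (ENNReal.ofReal lam * ∫⁻ y, (1 - gn n y)) =
      expNeg (ENNReal.ofReal lam * ∫⁻ y, (1 - g y)) := by
    simp_rw [hsub]
    rw [← expNeg_iSup, ← ENNReal.mul_iSup, ← lintegral_iSup (fun n => (s n).measurable)
      fun m n h y => hsmono y h]
    simp_rw [hssup]
  have hinf : ∀ a : ℕ → Plane, infProd (fun j => g (a j)) = ⨅ n, infProd fun j => gn n (a j) :=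
    fun a => by
      rw [← infProd_iInf (a := fun n j => gn n (a j)) (fun n j => hgn1 n _) fun j => hgnanti _]
      simp_rw [hgninf]
  have hinf' : ∀ i (a : ℕ → Plane), infProd (except i fun j => g (a j)) =
      ⨅ n, infProd (except i fun j => gn n (a j)) := fun i a => by
    rw [← infProd_iInf]
    · congr 1
      ext j
      unfold except
      split_ifs
      · simp
      · rw [hgninf]
    · exact fun n j => except_le_one (fun j => hgn1 n _) i j
    · intro j m n h
      simp only [except]
      split_ifs
      · rfl
      · exact hgnanti _ h
  have hprodanti : ∀ i (a : ℕ → Plane), Antitone fun n => infProd (except i fun j => gn n (a j)) :=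
    fun i a m n h => iInf_mono fun k => Finset.prod_le_prod' fun j _ => by
      unfold except
      split_ifs
      · rfl
      · exact hgnanti _ h
  constructor
  · simp_rw [hinf]
    rw [lintegral_iInf]
    · simp_rw [fun n => (hkey n).1]
      exact hlim
    · exact fun n => measurable_infProd fun j => (hgnm n).comp (hX.measurable j)
    · exact fun m n h ω => iInf_mono fun k => Finset.prod_le_prod' fun j _ => hgnanti _ h
    · refine ne_top_of_le_ne_top ENNReal.one_ne_top ?_
      refine (lintegral_mono fun ω => infProd_le_one _).trans ?_
      simp
  · have hAm : ∀ i, Measurable fun ω => A.indicator (1 : Plane → ℝ≥0∞) (X i ω) := fun i =>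
      (measurable_one.indicator hA).comp (hX.measurable i)
    have hcm : ∀ n i, Measurable fun ω => infProd (except i fun j => gn n (X j ω)) := fun n i =>
      measurable_infProd fun j => measurable_except (fun j => (hgnm n).comp (hX.measurable j)) i j
    have hstep : ∀ n, ∑' i, ∫⁻ ω, A.indicator 1 (X i ω) *
        infProd (except i fun j => gn n (X j ω)) ∂μ = ENNReal.ofReal lam * volume A *
          expNeg (ENNReal.ofReal lam * ∫⁻ y, (1 - gn n y)) := fun n => by
      rw [← (hkey n).2, lintegral_tsum]
      exact fun i => ((hAm i).mul (hcm n i)).aemeasurable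
    have hterm : ∀ i, ∫⁻ ω, A.indicator 1 (X i ω) * infProd (except i fun j => g (X j ω)) ∂μ =
        ⨅ n, ∫⁻ ω, A.indicator 1 (X i ω) * infProd (except i fun j => gn n (X j ω)) ∂μ := by
      intro i
      rw [← lintegral_iInf]
      · refine lintegral_congr fun ω => ?_
        rw [hinf' i fun j => X j ω, ENNReal.mul_iInf]
        intro h
        by_cases h' : X i ω ∈ A <;> simp [h'] at h
      · exact fun n => (hAm i).mul (hcm n i)
      · exact fun m n h ω => mul_le_mul_right (hprodanti i _ h) _
      · refine ne_top_of_le_ne_top ENNReal.one_ne_top ?_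
        refine (lintegral_mono (g := fun _ => 1) fun ω => ?_).trans (by simp)
        refine mul_le_one' ?_ (infProd_le_one _)
        exact indicator_le_self' (fun _ _ => zero_le) _
    simp_rw [hterm]
    -- The sum over points is an integral against the counting measure, so decreasing monotone
    -- convergence applies to it; its finiteness condition is where `volume A < ⊤` enters.
    rw [← lintegral_count, lintegral_iInf]
    · simp_rw [lintegral_count, hstep]
      rw [← hlim, ENNReal.mul_iInf]
      exact fun h => absurd h (ENNReal.mul_ne_top ENNReal.ofReal_ne_top hAvol.ne)
    · exact fun n => measurable_of_countable _
    · exact fun m n h i => lintegral_mono fun ω => mul_le_mul_right (hprodanti i _ h) _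
    · rw [lintegral_count, hstep]
      exact ENNReal.mul_ne_top (ENNReal.mul_ne_top ENNReal.ofReal_ne_top hAvol.ne)
        (ne_top_of_le_ne_top ENNReal.one_ne_top (expNeg_le_one _))

/-- Laplace functional of a homogeneous Poisson point process. -/
lemma IsHPPP.lintegral_infProd (hX : IsHPPP μ lam X) (hlam : 0 ≤ lam)
    {g : Plane → ℝ≥0∞} (hgm : Measurable g) (hg : ∀ y, g y ≤ 1) :
    ∫⁻ ω, infProd (fun j => g (X j ω)) ∂μ = expNeg (ENNReal.ofReal lam * ∫⁻ y, (1 - g y)) :=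
  (hX.lintegral_infProd_indicator hlam hgm hg MeasurableSet.empty (by simp)).1

/-- Mecke formula for product functionals of a homogeneous Poisson point process. -/
lemma IsHPPP.mecke_infProd (hX : IsHPPP μ lam X) (hlam : 0 ≤ lam)
    {g φ : Plane → ℝ≥0∞} (hgm : Measurable g) (hg : ∀ y, g y ≤ 1) (hφ : Measurable φ) :
    ∑' i, ∫⁻ ω, φ (X i ω) * infProd (except i fun j => g (X j ω)) ∂μ =
      ENNReal.ofReal lam * (∫⁻ y, φ y) * expNeg (ENNReal.ofReal lam * ∫⁻ y, (1 - g y)) := by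
  have hcm : ∀ i, Measurable fun ω => infProd (except i fun j => g (X j ω)) := fun i =>
    measurable_infProd fun j => measurable_except (fun j => hgm.comp (hX.measurable j)) i j
  -- With `φ` an indicator both sides are measures of the underlying set. They agree on sets of
  -- finite area, hence everywhere, and may then be integrated against any `φ`.
  have hm : Measure.sum (fun i => (μ.withDensity fun ω =>
      infProd (except i fun j => g (X j ω))).map (X i)) =
      (ENNReal.ofReal lam * expNeg (ENNReal.ofReal lam * ∫⁻ y, (1 - g y))) •
        (volume : Measure Plane) := by
    refine ext_of_measure_lt_top volume fun A hA hAvol => ?_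
    rw [Measure.sum_apply _ hA, Measure.smul_apply, smul_eq_mul, mul_right_comm,
      ← (hX.lintegral_infProd_indicator hlam hgm hg hA hAvol).2]
    refine tsum_congr fun i => ?_
    rw [Measure.map_apply (hX.measurable i) hA, withDensity_apply _ (hX.measurable i hA),
      ← MeasureTheory.lintegral_indicator (hX.measurable i hA)]
    refine lintegral_congr fun ω => ?_
    by_cases h : X i ω ∈ A
    · rw [indicator_of_mem (by exact h), indicator_of_mem h]; simp
    · rw [indicator_of_notMem (by exact h), indicator_of_notMem h]; simp
  have := congrArg (fun m => ∫⁻ y, φ y ∂m) hm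
  simp only [lintegral_sum_measure, lintegral_smul_measure, smul_eq_mul] at this
  rw [mul_right_comm, ← this]
  refine tsum_congr fun i => ?_
  rw [lintegral_map hφ (hX.measurable i)]
  refine Eq.trans ?_ (lintegral_withDensity_eq_lintegral_mul _ (hcm i)
    (hφ.comp (hX.measurable i))).symm
  exact lintegral_congr fun ω => mul_comm _ _

end General

lemma tendsto_prod_range_infProd {a : ℕ → ℝ≥0∞} (ha : ∀ j, a j ≤ 1) :
    Filter.Tendsto (fun n => ∏ j ∈ Finset.range n, a j) Filter.atTop (nhds (infProd a)) :=
  tendsto_atTop_iInf (antitone_prod_range ha)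

/-- The partial products beyond index `i` factor in this way, and multiplication by the finite
number `a i` preserves the limit. -/
lemma infProd_eq_mul_except {a : ℕ → ℝ≥0∞} (ha : ∀ j, a j ≤ 1) (i : ℕ) :
    infProd a = a i * infProd (except i a) := by
  refine tendsto_nhds_unique (tendsto_prod_range_infProd ha) ?_
  refine (ENNReal.Tendsto.const_mul (tendsto_prod_range_infProd (except_le_one ha i))
    (Or.inr (ne_top_of_le_ne_top ENNReal.one_ne_top (ha i)))).congr' ?_
  filter_upwards [Filter.eventually_gt_atTop i] with n hn
  have hi : i ∈ Finset.range n := Finset.mem_range.2 hn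
  rw [← Finset.mul_prod_erase _ a hi, ← Finset.mul_prod_erase _ (except i a) hi]
  simp only [except, if_true, one_mul]
  congr 1
  exact Finset.prod_congr rfl fun j hj => if_neg (Finset.ne_of_mem_erase hj)

/-! ### Marked Poisson point processes -/

section Marked

variable {Ω : Type*} [MeasurableSpace Ω] {μ : Measure Ω} [IsProbabilityMeasure μ]
  {F K : Type*} [MeasurableSpace F] [MeasurableSpace K] {κ : Measure K} [IsProbabilityMeasure κ]

/-- Given the positions, the marks are still independent with law `κ`, so the conditional mean of
the product is the product of the means. The functions may depend on the index because the Mecke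
formula treats one index differently. -/
lemma lintegral_prod_range_marked {X : ℕ → Ω → F} {M : ℕ → Ω → K} (hX : ∀ i, Measurable (X i))
    (hM : ∀ i, Measurable (M i)) (hlaw : ∀ i, μ.map (M i) = κ) (hind : iIndepFun M μ)
    (hXM : IndepFun (fun ω i => X i ω) (fun ω i => M i ω) μ)
    {u : ℕ → F × K → ℝ≥0∞} (hu : ∀ j, Measurable (u j)) (n : ℕ) :
    ∫⁻ ω, ∏ j ∈ Finset.range n, u j (X j ω, M j ω) ∂μ =
      ∫⁻ ω, ∏ j ∈ Finset.range n, ∫⁻ m, u j (X j ω, m) ∂κ ∂μ := by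
  have hX' : Measurable fun ω i => X i ω := measurable_pi_lambda _ hX
  have hM' : Measurable fun ω i => M i ω := measurable_pi_lambda _ hM
  have hG : Measurable fun z : (ℕ → F) × (ℕ → K) => ∏ j ∈ Finset.range n, u j (z.1 j, z.2 j) :=
    Finset.measurable_fun_prod _ fun j _ => (hu j).comp (by fun_prop)
  have h1 := (indepFun_iff_map_prod_eq_prod_map_map hX'.aemeasurable hM'.aemeasurable).1 hXM
  have h2 : ∫⁻ ω, ∏ j ∈ Finset.range n, u j (X j ω, M j ω) ∂μ =
      ∫⁻ z, ∏ j ∈ Finset.range n, u j (z.1 j, z.2 j)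
        ∂(μ.map fun ω => ((fun i => X i ω), fun i => M i ω)) :=
    (lintegral_map hG (hX'.prodMk hM')).symm
  have : IsProbabilityMeasure (μ.map fun ω i => M i ω) :=
    Measure.isProbabilityMeasure_map hM'.aemeasurable
  rw [h2, h1, lintegral_prod _ hG.aemeasurable, lintegral_map hG.lintegral_prod_right' hX']
  refine lintegral_congr fun ω => ?_
  refine (lintegral_map (hG.comp measurable_prodMk_left) hM').trans ?_
  have hm : ∀ j, Measurable fun m => u j (X j ω, m) := fun j => (hu j).comp measurable_prodMk_left
  have := lintegral_prod_eq_prod_lintegral_of_indepFun (Finset.range n)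
    (fun j ω' => u j (X j ω, M j ω')) (hind.comp _ hm) fun j => (hm j).comp (hM j)
  refine this.trans (Finset.prod_congr rfl fun j _ => ?_)
  rw [← hlaw j, lintegral_map (hm j) (hM j)]

lemma lintegral_infProd_marked {X : ℕ → Ω → F} {M : ℕ → Ω → K} (hX : ∀ i, Measurable (X i))
    (hM : ∀ i, Measurable (M i)) (hlaw : ∀ i, μ.map (M i) = κ) (hind : iIndepFun M μ)
    (hXM : IndepFun (fun ω i => X i ω) (fun ω i => M i ω) μ)
    {u : ℕ → F × K → ℝ≥0∞} (hu : ∀ j, Measurable (u j)) (hu1 : ∀ j y, u j y ≤ 1) :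
    ∫⁻ ω, infProd (fun j => u j (X j ω, M j ω)) ∂μ =
      ∫⁻ ω, infProd (fun j => ∫⁻ m, u j (X j ω, m) ∂κ) ∂μ := by
  have hbar : ∀ j x, ∫⁻ m, u j (x, m) ∂κ ≤ 1 := fun j x =>
    (lintegral_mono fun m => hu1 j (x, m)).trans (by simp)
  unfold infProd
  rw [lintegral_iInf, lintegral_iInf]
  · exact iInf_congr fun n => lintegral_prod_range_marked hX hM hlaw hind hXM hu n
  · exact fun n => Finset.measurable_fun_prod _ fun j _ =>
      (hu j).lintegral_prod_right'.comp (hX j)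
  · exact fun m n h ω => antitone_prod_range (fun j => hbar j _) h
  · simp
  · exact fun n => Finset.measurable_fun_prod _ fun j _ => (hu j).comp ((hX j).prodMk (hM j))
  · exact fun m n h ω => antitone_prod_range (fun j => hu1 j _) h
  · simp

variable {lam : ℝ} {X : ℕ → Ω → Plane} {M : ℕ → Ω → K}

/-- Intensity measure of a marked homogeneous Poisson point process. -/
noncomputable def intensity (lam : ℝ) (κ : Measure K) : Measure (Plane × K) :=
  (ENNReal.ofReal lam • (volume : Measure Plane)).prod κ

instance : SigmaFinite (ENNReal.ofReal lam • (volume : Measure Plane)) :=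
  inferInstanceAs (SigmaFinite (lam.toNNReal • (volume : Measure Plane)))

instance : SigmaFinite (intensity lam κ) := by unfold intensity; infer_instance

lemma lintegral_intensity {φ : Plane × K → ℝ≥0∞} (hφ : Measurable φ) :
    ∫⁻ y, φ y ∂intensity lam κ = ENNReal.ofReal lam * ∫⁻ x, ∫⁻ m, φ (x, m) ∂κ := by
  rw [intensity, lintegral_prod _ hφ.aemeasurable, lintegral_smul_measure, smul_eq_mul]

lemma lintegral_one_sub_intensity {g : Plane × K → ℝ≥0∞} (hgm : Measurable g)
    (hg : ∀ y, g y ≤ 1) :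
    ∫⁻ y, (1 - g y) ∂intensity lam κ = ENNReal.ofReal lam * ∫⁻ x, (1 - ∫⁻ m, g (x, m) ∂κ) := by
  refine (lintegral_intensity (φ := fun y => 1 - g y) (measurable_const.sub hgm)).trans ?_
  congr 1
  refine lintegral_congr fun x => ?_
  have : ∫⁻ m, g (x, m) ∂κ ≠ ⊤ := ne_top_of_le_ne_top ENNReal.one_ne_top
    ((lintegral_mono fun m => hg (x, m)).trans (by simp))
  rw [lintegral_sub (g := fun m => g (x, m)) (hgm.comp measurable_prodMk_left) this (ae_of_all _ fun m => hg (x, m))]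
  simp

/-- Laplace functional of a marked Poisson point process. -/
lemma marked_lintegral_infProd (hX : IsHPPP μ lam X) (hlam : 0 ≤ lam)
    (hM : ∀ i, Measurable (M i)) (hlaw : ∀ i, μ.map (M i) = κ) (hind : iIndepFun M μ)
    (hXM : IndepFun (fun ω i => X i ω) (fun ω i => M i ω) μ)
    {g : Plane × K → ℝ≥0∞} (hgm : Measurable g) (hg : ∀ y, g y ≤ 1) :
    ∫⁻ ω, infProd (fun j => g (X j ω, M j ω)) ∂μ =
      expNeg (∫⁻ y, (1 - g y) ∂intensity lam κ) := by
  rw [lintegral_infProd_marked hX.measurable hM hlaw hind hXM (u := fun _ => g) (fun _ => hgm)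
    (fun _ => hg), lintegral_one_sub_intensity hgm hg]
  exact hX.lintegral_infProd hlam hgm.lintegral_prod_right' fun x =>
    (lintegral_mono fun m => hg (x, m)).trans (by simp)

/-- Mecke formula for product functionals of a marked Poisson point process. -/
lemma marked_mecke_infProd (hX : IsHPPP μ lam X) (hlam : 0 ≤ lam)
    (hM : ∀ i, Measurable (M i)) (hlaw : ∀ i, μ.map (M i) = κ) (hind : iIndepFun M μ)
    (hXM : IndepFun (fun ω i => X i ω) (fun ω i => M i ω) μ)
    {g φ : Plane × K → ℝ≥0∞} (hgm : Measurable g) (hg : ∀ y, g y ≤ 1) (hφm : Measurable φ)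
    (hφ : ∀ y, φ y ≤ 1) :
    ∑' i, ∫⁻ ω, φ (X i ω, M i ω) * infProd (except i fun j => g (X j ω, M j ω)) ∂μ =
      (∫⁻ y, φ y ∂intensity lam κ) * expNeg (∫⁻ y, (1 - g y) ∂intensity lam κ) := by
  rw [lintegral_one_sub_intensity hgm hg, lintegral_intensity hφm,
    ← hX.mecke_infProd hlam hgm.lintegral_prod_right' (fun x =>
    (lintegral_mono fun m => hg (x, m)).trans (by simp)) hφm.lintegral_prod_right']
  refine tsum_congr fun i => ?_
  -- The term `φ (Y i)` times the product of `g` over the other points is one infinite product with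
  -- an exceptional factor at `i`. This is where `φ ≤ 1` is needed.
  let u : ℕ → Plane × K → ℝ≥0∞ := fun j => if j = i then φ else g
  have hu : ∀ j, Measurable (u j) := fun j => by simp only [u]; split_ifs <;> assumption
  have hu1 : ∀ j y, u j y ≤ 1 := fun j y => by simp only [u]; split_ifs; exacts [hφ y, hg y]
  have hbar : ∀ j x, ∫⁻ m, u j (x, m) ∂κ ≤ 1 := fun j x =>
    (lintegral_mono fun m => hu1 j (x, m)).trans (by simp)
  have key := lintegral_infProd_marked hX.measurable hM hlaw hind hXM hu hu1
  simp_rw [infProd_eq_mul_except (fun j => hu1 j _) i,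
    infProd_eq_mul_except (fun j => hbar j _) i] at key
  have e1 : ∀ ω, except i (fun j => u j (X j ω, M j ω)) =
      except i fun j => g (X j ω, M j ω) := fun ω => by
    ext j
    unfold except
    split_ifs with h
    · rfl
    · simp [u, h]
  have e2 : ∀ ω, except i (fun j => ∫⁻ m, u j (X j ω, m) ∂κ) =
      except i fun j => ∫⁻ m, g (X j ω, m) ∂κ := fun ω => by
    ext j
    unfold except
    split_ifs with h
    · rfl
    · simp [u, h]
  simp_rw [e1, e2] at key
  simpa [u] using key

end Marked

/-! ### Uniqueness of laws on `[0, ∞]` -/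

open BoundedContinuousFunction in
/-- Finite measures on `[0, ∞]` with the same Laplace transform at the natural numbers coincide. -/
lemma ext_of_lintegral_expNeg {m₁ m₂ : Measure ℝ≥0∞} [IsFiniteMeasure m₁] [IsFiniteMeasure m₂]
    (h : ∀ n : ℕ, ∫⁻ x, expNeg (n * x) ∂m₁ = ∫⁻ x, expNeg (n * x) ∂m₂) : m₁ = m₂ := by
  have hc : Continuous fun x => (expNeg x).toReal :=
    ENNReal.continuousOn_toReal.comp_continuous continuous_expNeg fun x =>
      ne_top_of_le_ne_top ENNReal.one_ne_top (expNeg_le_one x)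
  let e : ℝ≥0∞ →ᵇ ℝ := mkOfCompact ⟨fun x => (expNeg x).toReal, hc⟩
  have he : ∀ x, e x = (expNeg x).toReal := fun x => rfl
  -- Polynomials in `e^{-x}` form an algebra that separates the points of the compact space `[0,
  -- ∞]`, and the `n`-th power is `e^{-nx}`, whose integrals are the hypothesis.
  let A : StarSubalgebra ℝ (ℝ≥0∞ →ᵇ ℝ) :=
    { (Polynomial.aeval (R := ℝ) e).range with
      star_mem' := fun {a} ha => by
        have : star a = a := by ext x; simp
        rw [this]; exact ha }
  refine ext_of_forall_mem_subalgebra_integral_eq_of_polish (𝕜 := ℝ) (A := A) ?_ ?_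
  · intro x y hxy
    refine ⟨fun x => (expNeg x).toReal, ⟨⟨fun x => (expNeg x).toReal, hc⟩, ?_, rfl⟩, ?_⟩
    · refine ⟨e, ?_, rfl⟩
      exact ⟨Polynomial.X, Polynomial.aeval_X e⟩
    · intro heq
      refine hxy (expNeg_strictAnti.injective ?_)
      exact (ENNReal.toReal_eq_toReal_iff' (ne_top_of_le_ne_top ENNReal.one_ne_top (expNeg_le_one x))
        (ne_top_of_le_ne_top ENNReal.one_ne_top (expNeg_le_one y))).1 heq
  · rintro _ ⟨q, rfl⟩
    have hpow : ∀ n : ℕ, ∫ x, (e ^ n : ℝ≥0∞ →ᵇ ℝ) x ∂m₁ = ∫ x, (e ^ n : ℝ≥0∞ →ᵇ ℝ) x ∂m₂ := by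
      intro n
      have e1 : ∀ x, (e ^ n : ℝ≥0∞ →ᵇ ℝ) x = (expNeg (n * x)).toReal := fun x => by
        rw [expNeg_nsmul, ENNReal.toReal_pow]; rfl
      have hm : Measurable fun x : ℝ≥0∞ => expNeg (n * x) :=
        measurable_expNeg.comp (measurable_const_mul _)
      have hlt : ∀ x : ℝ≥0∞, expNeg (n * x) < ⊤ := fun x =>
        (expNeg_le_one _).trans_lt ENNReal.one_lt_top
      simp_rw [e1]
      rw [integral_toReal hm.aemeasurable (ae_of_all _ hlt),
        integral_toReal hm.aemeasurable (ae_of_all _ hlt), h n]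
    change ∫ x, (Polynomial.aeval e q : ℝ≥0∞ →ᵇ ℝ) x ∂m₁ =
      ∫ x, (Polynomial.aeval e q : ℝ≥0∞ →ᵇ ℝ) x ∂m₂
    induction q using Polynomial.induction_on' with
    | add p q hp hq =>
      simp only [map_add, BoundedContinuousFunction.add_apply]
      rw [integral_add (BoundedContinuousFunction.integrable _ _)
        (BoundedContinuousFunction.integrable _ _), integral_add
        (BoundedContinuousFunction.integrable _ _) (BoundedContinuousFunction.integrable _ _),
        hp, hq]
    | monomial n a =>
      have e2 : Polynomial.aeval e (Polynomial.monomial n a) = a • e ^ n := by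
        rw [Polynomial.aeval_monomial]; ext x; simp
      simp only [e2, BoundedContinuousFunction.smul_apply, integral_smul, hpow]

/-- One coordinate at a time: for fixed `u` the Laplace transform determines the measure in the
second coordinate; then, for a fixed set there, half-lines determine it in the first. -/
lemma ext_of_Iic_expNeg {m₁ m₂ : Measure (ℝ≥0∞ × ℝ≥0∞)} [IsFiniteMeasure m₁] [IsFiniteMeasure m₂]
    (h : ∀ (u : ℝ≥0∞) (n : ℕ), ∫⁻ z, (Iic u).indicator 1 z.1 * expNeg (n * z.2) ∂m₁ =
      ∫⁻ z, (Iic u).indicator 1 z.1 * expNeg (n * z.2) ∂m₂) : m₁ = m₂ := by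
  have key : ∀ u {B : Set ℝ≥0∞}, MeasurableSet B → m₁ (Iic u ×ˢ B) = m₂ (Iic u ×ˢ B) := by
    intro u B hB
    have hS : MeasurableSet (Iic u ×ˢ (univ : Set ℝ≥0∞)) := measurableSet_Iic.prod .univ
    have h1 : (m₁.restrict (Iic u ×ˢ univ)).map Prod.snd =
        (m₂.restrict (Iic u ×ˢ univ)).map Prod.snd := by
      refine ext_of_lintegral_expNeg fun n => ?_
      have hm : Measurable fun x : ℝ≥0∞ => expNeg (n * x) :=
        measurable_expNeg.comp (measurable_const_mul _)
      rw [lintegral_map hm measurable_snd, lintegral_map hm measurable_snd,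
        ← lintegral_indicator hS, ← lintegral_indicator hS]
      have e : ∀ z : ℝ≥0∞ × ℝ≥0∞, (Iic u ×ˢ univ).indicator (fun z => expNeg (n * z.2)) z =
          (Iic u).indicator 1 z.1 * expNeg (n * z.2) := fun z => by
        by_cases hz : z.1 ≤ u
        · rw [indicator_of_mem (by simpa using hz), indicator_of_mem (by simpa using hz)]; simp
        · rw [indicator_of_notMem (by simpa using hz), indicator_of_notMem (by simpa using hz)]
          simp
      simp_rw [e]
      exact h u n
    have h2 := congrArg (fun m => m B) h1
    simp only [Measure.map_apply measurable_snd hB,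
      Measure.restrict_apply (measurable_snd hB)] at h2
    convert h2 using 2 <;>
    · ext z; simp [and_comm]
  refine Measure.ext_prod fun {s t} hs ht => ?_
  have h1 : (m₁.restrict (univ ×ˢ t)).map Prod.fst = (m₂.restrict (univ ×ˢ t)).map Prod.fst := by
    refine Measure.ext_of_Iic _ _ fun u => ?_
    rw [Measure.map_apply measurable_fst measurableSet_Iic,
      Measure.map_apply measurable_fst measurableSet_Iic,
      Measure.restrict_apply (measurable_fst measurableSet_Iic),
      Measure.restrict_apply (measurable_fst measurableSet_Iic)]
    convert key u ht using 2 <;>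
    · ext z; simp
  have h2 := congrArg (fun m => m s) h1
  simp only [Measure.map_apply measurable_fst hs,
    Measure.restrict_apply (measurable_fst hs)] at h2
  convert h2 using 2 <;>
  · ext z; simp

/-! ### The strongest competitor and the total interference -/

/-- A maximum is at most `u` exactly when every term is, so tests of this kind on (maximum, sum) are
product functionals. -/
lemma indicator_iSup_mul_expNeg (a b : ℕ → ℝ≥0∞) (u c : ℝ≥0∞) :
    (Iic u).indicator 1 (⨆ j, a j) * expNeg (c * ∑' j, b j) =
      infProd fun j => (Iic u).indicator 1 (a j) * expNeg (c * b j) := by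
  by_cases h : ∀ j, a j ≤ u
  · rw [indicator_of_mem (by simpa using h)]
    have : ∀ j, (Iic u).indicator (1 : ℝ≥0∞ → ℝ≥0∞) (a j) = 1 := fun j =>
      indicator_of_mem (h j) _
    simp_rw [this]
    rw [← ENNReal.tsum_mul_left, expNeg_tsum]
    simp [infProd]
  · rw [indicator_of_notMem (by simpa using h), zero_mul]
    push Not at h
    obtain ⟨j, hj⟩ := h
    refine (le_antisymm ?_ zero_le).symm
    refine (iInf_le _ (j + 1)).trans ?_
    rw [Finset.prod_eq_zero (Finset.self_mem_range_succ j)]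
    rw [indicator_of_notMem (by simpa using hj), zero_mul]

/-- The sequence `a` with its `i`-th term replaced by `0`. -/
def omitAt (i : ℕ) (a : ℕ → ℝ≥0∞) (j : ℕ) : ℝ≥0∞ := if j = i then 0 else a j

lemma measurable_omitAt {Ω : Type*} [MeasurableSpace Ω] {f : ℕ → Ω → ℝ≥0∞}
    (hf : ∀ j, Measurable (f j)) (i j : ℕ) : Measurable fun ω => omitAt i (fun j => f j ω) j := by
  unfold omitAt; split_ifs
  · exact measurable_const
  · exact hf j

section Mecke

variable {Ω E : Type*} [MeasurableSpace Ω] [MeasurableSpace E] {μ : Measure Ω}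
  [IsProbabilityMeasure μ] {ν : Measure E} [SigmaFinite ν] {Y : ℕ → Ω → E} {v w : E → ℝ≥0∞}

/-- Mecke formula for functionals of a point, of the maximum of `v` over the other points and of
the sum of `w` over the other points. -/
lemma mecke_iSup_tsum (hY : ∀ i, Measurable (Y i)) (hv : Measurable v) (hw : Measurable w)
    (hL : ∀ g : E → ℝ≥0∞, Measurable g → (∀ y, g y ≤ 1) →
      ∫⁻ ω, infProd (fun j => g (Y j ω)) ∂μ = expNeg (∫⁻ y, (1 - g y) ∂ν))
    (hMk : ∀ φ g : E → ℝ≥0∞, Measurable φ → Measurable g → (∀ y, φ y ≤ 1) → (∀ y, g y ≤ 1) →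
      ∑' i, ∫⁻ ω, φ (Y i ω) * infProd (except i fun j => g (Y j ω)) ∂μ =
        (∫⁻ y, φ y ∂ν) * expNeg (∫⁻ y, (1 - g y) ∂ν))
    {Φ : E × (ℝ≥0∞ × ℝ≥0∞) → ℝ≥0∞} (hΦ : Measurable Φ) :
    ∑' i, ∫⁻ ω, Φ (Y i ω, ⨆ j, omitAt i (fun j => v (Y j ω)) j,
        ∑' j, omitAt i (fun j => w (Y j ω)) j) ∂μ =
      ∫⁻ y, ∫⁻ ω, Φ (y, ⨆ j, v (Y j ω), ∑' j, w (Y j ω)) ∂μ ∂ν := by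
  set Z : Ω → ℝ≥0∞ × ℝ≥0∞ := fun ω => (⨆ j, v (Y j ω), ∑' j, w (Y j ω)) with hZdef
  have hZ : Measurable Z := (Measurable.iSup fun j => hv.comp (hY j)).prodMk
    (Measurable.tsum fun j => hw.comp (hY j))
  set W : ℕ → Ω → E × (ℝ≥0∞ × ℝ≥0∞) := fun i ω => (Y i ω,
    ⨆ j, omitAt i (fun j => v (Y j ω)) j, ∑' j, omitAt i (fun j => w (Y j ω)) j) with hWdef
  have hW : ∀ i, Measurable (W i) := fun i => (hY i).prodMk
    ((Measurable.iSup fun j => measurable_omitAt (fun j => hv.comp (hY j)) i j).prodMk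
      (Measurable.tsum fun j => measurable_omitAt (fun j => hw.comp (hY j)) i j))
  have hPZ : IsProbabilityMeasure (μ.map Z) := Measure.isProbabilityMeasure_map hZ.aemeasurable
  set m := Measure.sum fun i => μ.map (W i) with hm
  let G : ℝ≥0∞ → ℕ → E → ℝ≥0∞ := fun u n y => (Iic u).indicator 1 (v y) * expNeg (n * w y)
  have hG : ∀ u n, Measurable (G u n) := fun u n =>
    ((measurable_one.indicator measurableSet_Iic).comp hv).mul
      (measurable_expNeg.comp (hw.const_mul _))
  have hG1 : ∀ u n y, G u n y ≤ 1 := fun u n y =>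
    mul_le_one' (indicator_le_self' (fun _ _ => zero_le) _) (expNeg_le_one _)
  have hJ : ∀ u (n : ℕ), Measurable fun z : ℝ≥0∞ × ℝ≥0∞ =>
      (Iic u).indicator 1 z.1 * expNeg (n * z.2) := fun u n =>
    ((measurable_one.indicator measurableSet_Iic).comp measurable_fst).mul
      (measurable_expNeg.comp (measurable_snd.const_mul _))
  have hprod : m = ν.prod (μ.map Z) := by
    -- Counting the points in `s` together with what they see of the others gives, on the product
    -- tests, the same integrals as `ν s` copies of the law of `Z`.
    have hfin : ∀ s, MeasurableSet s → ν s < ⊤ →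
        (m.restrict (s ×ˢ univ)).map Prod.snd = ν s • μ.map Z := by
      intro s hs hνs
      have hsu : MeasurableSet (s ×ˢ (univ : Set (ℝ≥0∞ × ℝ≥0∞))) := hs.prod .univ
      have hind : ∀ (ψ : ℝ≥0∞ × ℝ≥0∞ → ℝ≥0∞), Measurable ψ →
          ∫⁻ z, ψ z ∂((m.restrict (s ×ˢ univ)).map Prod.snd) =
            ∑' i, ∫⁻ ω, s.indicator 1 (Y i ω) * ψ (W i ω).2 ∂μ := by
        intro ψ hψ
        rw [lintegral_map hψ measurable_snd, ← lintegral_indicator hsu, hm, lintegral_sum_measure]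
        refine tsum_congr fun i => ?_
        refine (lintegral_map ((hψ.comp measurable_snd).indicator hsu) (hW i)).trans ?_
        refine lintegral_congr fun ω => ?_
        by_cases h : Y i ω ∈ s
        · rw [indicator_of_mem h, indicator_of_mem (by simpa [hWdef] using h)]; simp
        · rw [indicator_of_notMem h, indicator_of_notMem (by simpa [hWdef] using h)]; simp
      have hs1 : ∀ y, s.indicator (1 : E → ℝ≥0∞) y ≤ 1 :=
        fun y => indicator_le_self' (fun _ _ => zero_le) _
      have hlaw : ∀ (u : ℝ≥0∞) (n : ℕ), ∫⁻ z, (Iic u).indicator 1 z.1 * expNeg (n * z.2)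
          ∂((m.restrict (s ×ˢ univ)).map Prod.snd) =
          ∫⁻ z, (Iic u).indicator 1 z.1 * expNeg (n * z.2) ∂(ν s • μ.map Z) := by
        intro u n
        rw [hind _ (hJ u n), lintegral_smul_measure, lintegral_map (hJ u n) hZ]
        simp only [hZdef, hWdef, indicator_iSup_mul_expNeg]
        rw [hL (G u n) (hG u n) (hG1 u n)]
        have := hMk (s.indicator 1) (G u n) (measurable_one.indicator hs) (hG u n) hs1 (hG1 u n)
        rw [lintegral_indicator_one hs] at this
        rw [smul_eq_mul, ← this]
        refine tsum_congr fun i => lintegral_congr fun ω => ?_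
        congr 2
        ext j
        -- The omitted point has value 0 for both `v` and `w`; the indicator of `Iic u` and `expNeg`
        -- turn this into the factor 1 used by `except`.
        unfold omitAt except
        split_ifs with hj
        · simp
        · rfl
      have hf1 : IsFiniteMeasure ((m.restrict (s ×ˢ univ)).map Prod.snd) := by
        constructor
        -- For `u = ⊤` and `n = 0` the test function is identically 1, so the identity compares
        -- total masses and gives finiteness.
        have := hlaw ⊤ 0
        simp at this
        rw [Measure.map_apply measurable_snd .univ, preimage_univ, Measure.restrict_apply .univ,
          univ_inter]
        rw [Measure.map_apply measurable_snd .univ, preimage_univ, Measure.restrict_apply .univ,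
          univ_inter] at this
        exact this.trans_lt hνs
      have hf2 : IsFiniteMeasure (ν s • μ.map Z) := by
        constructor
        rw [Measure.smul_apply, measure_univ, smul_eq_mul, mul_one]
        exact hνs
      exact ext_of_Iic_expNeg hlaw
    symm
    refine Measure.prod_eq fun s t hs ht => ?_
    have h1 : (m.restrict (univ ×ˢ t)).map Prod.fst = (μ.map Z t) • ν := by
      refine ext_of_measure_lt_top ν fun A hA hνA => ?_
      have h2 := congrArg (fun m => m t) (hfin A hA hνA)
      simp only [Measure.map_apply measurable_snd ht,
        Measure.restrict_apply (measurable_snd ht), Measure.smul_apply, smul_eq_mul] at h2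
      rw [Measure.map_apply measurable_fst hA, Measure.restrict_apply (measurable_fst hA),
        Measure.smul_apply, smul_eq_mul, mul_comm, ← h2]
      congr 1
      ext z; simp [and_comm]
    have h2 := congrArg (fun m => m s) h1
    simp only [Measure.map_apply measurable_fst hs,
      Measure.restrict_apply (measurable_fst hs), Measure.smul_apply, smul_eq_mul] at h2
    rw [mul_comm, ← h2]
    congr 1
    ext z; simp
  have := congrArg (fun m => ∫⁻ z, Φ z ∂m) hprod
  simp only [hm, lintegral_sum_measure] at this
  rw [lintegral_prod _ hΦ.aemeasurable] at this
  simp_rw [lintegral_map hΦ (hW _)] at this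
  rw [this]
  exact lintegral_congr fun y => lintegral_map (hΦ.comp measurable_prodMk_left) hZ

end Mecke

/-! ### Gamma distributions -/

lemma ae_nonneg_gammaMeasure (a r : ℝ) : ∀ᵐ x ∂gammaMeasure a r, 0 ≤ x := by
  rw [ae_iff]
  have : {x : ℝ | ¬ 0 ≤ x} = Iio 0 := by ext; simp
  rw [this, gammaMeasure, withDensity_apply _ measurableSet_Iio]
  exact lintegral_gammaPDF_of_nonpos le_rfl

lemma measurable_gammaPDF (a r : ℝ) : Measurable (gammaPDF a r) :=
  (measurable_gammaPDFReal a r).ennreal_ofReal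

lemma lintegral_gammaMeasure (a r : ℝ) {f : ℝ → ℝ≥0∞} (hf : Measurable f) :
    ∫⁻ x, f x ∂gammaMeasure a r = ∫⁻ x, gammaPDF a r x * f x := by
  rw [gammaMeasure, lintegral_withDensity_eq_lintegral_mul _ (measurable_gammaPDF a r) hf]
  rfl

lemma lintegral_id_gammaMeasure {a r : ℝ} (ha : 0 < a) (hr : 0 < r) :
    ∫⁻ x, ENNReal.ofReal x ∂gammaMeasure a r = ENNReal.ofReal (a / r) := by
  rw [lintegral_gammaMeasure _ _ ENNReal.measurable_ofReal]
  -- Multiplication by `x` raises the shape by one, up to the constant `a / r`.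
  have h : ∀ x, x ≠ 0 → gammaPDF a r x * ENNReal.ofReal x =
      ENNReal.ofReal (a / r) * gammaPDF (a + 1) r x := by
    intro x hx0
    rcases lt_or_ge x 0 with hx | hx
    · rw [gammaPDF_of_neg hx, gammaPDF_of_neg hx]; simp
    · rw [gammaPDF_of_nonneg hx, gammaPDF_of_nonneg hx, ← ENNReal.ofReal_mul
        (by have := Real.Gamma_pos_of_pos ha; positivity), ← ENNReal.ofReal_mul (by positivity)]
      congr 1
      have hx' : 0 < x := lt_of_le_of_ne hx (Ne.symm hx0)
      have h1 : x ^ (a + 1 - 1) = x ^ (a - 1) * x := by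
        rw [← Real.rpow_add_one hx0]; ring_nf
      rw [h1, Real.rpow_add_one hr.ne', Real.Gamma_add_one ha.ne']
      have := (Real.Gamma_pos_of_pos ha).ne'
      field_simp
  have hae : ∀ᵐ x : ℝ, gammaPDF a r x * ENNReal.ofReal x =
      ENNReal.ofReal (a / r) * gammaPDF (a + 1) r x := by
    filter_upwards [Measure.ae_ne volume 0] with x hx using h x hx
  rw [lintegral_congr_ae hae, lintegral_const_mul _ (measurable_gammaPDF _ _),
    lintegral_gammaPDF_eq_one (by linarith) hr, mul_one]

/-- Laplace transform of a gamma distribution. -/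
lemma lintegral_expNeg_gammaMeasure {m : ℕ} (hm : 1 ≤ m) {r c : ℝ} (hr : 0 < r) (hc : 0 ≤ c) :
    ∫⁻ x, expNeg (ENNReal.ofReal (c * x)) ∂gammaMeasure m r =
      ENNReal.ofReal (((1 + c / r) ^ m)⁻¹) := by
  have hm' : (0 : ℝ) < m := by exact_mod_cast hm
  rw [lintegral_gammaMeasure _ _ (f := fun x => expNeg (ENNReal.ofReal (c * x)))
    (measurable_expNeg.comp (ENNReal.measurable_ofReal.comp (measurable_const_mul c)))]
  -- Exponential tilting only changes the rate from `r` to `r + c`.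
  have h : ∀ x, gammaPDF m r x * expNeg (ENNReal.ofReal (c * x)) =
      ENNReal.ofReal (((1 + c / r) ^ m)⁻¹) * gammaPDF m (r + c) x := by
    intro x
    rcases lt_or_ge x 0 with hx | hx
    · rw [gammaPDF_of_neg hx, gammaPDF_of_neg hx]; simp
    · rw [gammaPDF_of_nonneg hx, gammaPDF_of_nonneg hx, expNeg_ofReal (by positivity),
        ← ENNReal.ofReal_mul (by have := Real.Gamma_pos_of_pos hm'; positivity),
        ← ENNReal.ofReal_mul (by positivity)]
      congr 1
      have h1 : Real.exp (-((r + c) * x)) = Real.exp (-(r * x)) * Real.exp (-(c * x)) := by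
        rw [← Real.exp_add]; ring_nf
      rw [h1, Real.rpow_natCast, Real.rpow_natCast]
      have h2 : (1 + c / r) = (r + c) / r := by field_simp
      rw [h2, div_pow]
      have : r + c ≠ 0 := by positivity
      field_simp
  simp_rw [h]
  rw [lintegral_const_mul _ (measurable_gammaPDF _ _),
    lintegral_gammaPDF_eq_one hm' (by linarith), mul_one]

/-- Tail of a gamma distribution with integer shape. -/
lemma gammaMeasure_Ioi {m : ℕ} (hm : 1 ≤ m) {r x : ℝ} (hr : 0 < r) (hx : 0 ≤ x) :
    gammaMeasure m r (Ioi x) = ENNReal.ofReal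
      (Real.exp (-(r * x)) * ∑ k ∈ Finset.range m, (r * x) ^ k / k.factorial) := by
  obtain ⟨n, rfl⟩ : ∃ n, m = n + 1 := ⟨m - 1, by omega⟩
  set F : ℝ → ℝ := fun y =>
    -(Real.exp (-(r * y)) * ∑ k ∈ Finset.range (n + 1), (r * y) ^ k / k.factorial) with hF
  -- Minus the claimed tail is an antiderivative of the density; in the induction on the shape the
  -- derivatives of successive terms telescope.
  have hderiv : ∀ n : ℕ, ∀ y, HasDerivAt (fun y =>
      -(Real.exp (-(r * y)) * ∑ k ∈ Finset.range (n + 1), (r * y) ^ k / k.factorial))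
      (r ^ (n + 1) / n.factorial * y ^ n * Real.exp (-(r * y))) y := by
    intro n y
    have h0 : HasDerivAt (fun y => r * y) r y := by
      simpa using (hasDerivAt_id y).const_mul r
    have hE : HasDerivAt (fun y => Real.exp (-(r * y))) (Real.exp (-(r * y)) * -r) y := h0.neg.exp
    induction n with
    | zero => simpa [mul_comm] using hE.fun_neg
    | succ n ih =>
      have hP := ((h0.pow (n + 1)).div_const ((n + 1).factorial : ℝ))
      have := ih.sub (hE.mul hP)
      refine (this.congr_deriv ?_).congr_of_eventuallyEq (Filter.Eventually.of_forall fun z => ?_)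
      · simp only [Nat.factorial_succ, Nat.cast_mul, Nat.cast_succ, Nat.add_sub_cancel, Pi.pow_apply]
        have : (n.factorial : ℝ) ≠ 0 := by positivity
        have : (n + 1 : ℝ) ≠ 0 := by positivity
        field_simp
        ring
      · simp only [Finset.sum_range_succ _ (n + 1), Pi.sub_apply, Pi.mul_apply, Pi.pow_apply]
        ring
  have hlim : Filter.Tendsto F Filter.atTop (nhds 0) := by
    have h1 : Filter.Tendsto (fun z : ℝ => ∑ k ∈ Finset.range (n + 1),
        (z ^ k * Real.exp (-z)) / k.factorial) Filter.atTop (nhds 0) := by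
      have : (0 : ℝ) = ∑ k ∈ Finset.range (n + 1), 0 / (k.factorial : ℝ) := by simp
      rw [this]
      exact tendsto_finsetSum _ fun k _ =>
        (Real.tendsto_pow_mul_exp_neg_atTop_nhds_zero k).div_const _
    have h2 := (h1.comp (Filter.tendsto_id.const_mul_atTop hr)).neg
    rw [neg_zero] at h2
    refine h2.congr fun y => ?_
    simp only [hF, Function.comp, id, Finset.mul_sum]
    congr 1
    refine Finset.sum_congr rfl fun k _ => ?_
    ring
  have hpos : ∀ y ∈ Ioi x, 0 ≤ r ^ (n + 1) / n.factorial * y ^ n * Real.exp (-(r * y)) :=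
    fun y hy => by
      have : 0 < y := hx.trans_lt hy
      positivity
  have hcont : ContinuousWithinAt F (Ici x) x := (hderiv n x).continuousAt.continuousWithinAt
  have hint := integrableOn_Ioi_deriv_of_nonneg hcont (fun y _ => hderiv n y) hpos hlim
  have hval := integral_Ioi_of_hasDerivAt_of_nonneg hcont (fun y _ => hderiv n y) hpos hlim
  rw [gammaMeasure, withDensity_apply _ measurableSet_Ioi]
  have hpdf : ∀ y ∈ Ioi x, gammaPDF ((n + 1 : ℕ) : ℝ) r y =
      ENNReal.ofReal (r ^ (n + 1) / n.factorial * y ^ n * Real.exp (-(r * y))) := by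
    intro y hy
    have hy0 : 0 < y := hx.trans_lt hy
    rw [gammaPDF_of_nonneg hy0.le]
    have h1 : ((n + 1 : ℕ) : ℝ) - 1 = n := by push_cast; ring
    rw [h1, Real.rpow_natCast, Real.rpow_natCast]
    have h2 : Real.Gamma ((n + 1 : ℕ) : ℝ) = n.factorial := by
      push_cast; exact Real.Gamma_nat_eq_factorial n
    rw [h2]
  rw [setLIntegral_congr_fun measurableSet_Ioi hpdf,
    ← ofReal_integral_eq_lintegral_ofReal hint
      ((ae_restrict_iff' measurableSet_Ioi).2 (ae_of_all _ hpos)), hval]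
  simp [hF]

/-! ### Polar coordinates -/

lemma lintegral_norm_plane {f : ℝ → ℝ≥0∞} (hf : Measurable f) :
    ∫⁻ x : Plane, f ‖x‖ = ENNReal.ofReal (2 * Real.pi) * ∫⁻ t in Ioi 0, ENNReal.ofReal t * f t := by
  have hdim : Module.finrank ℝ Plane = 2 := by simp
  have hm : Measurable fun z : Metric.sphere (0 : Plane) 1 × Ioi (0 : ℝ) => f z.2 :=
    hf.comp (measurable_subtype_coe.comp measurable_snd)
  calc ∫⁻ x : Plane, f ‖x‖ = ∫⁻ x : ({(0)}ᶜ : Set Plane), f ‖x.1‖ ∂(volume.comap Subtype.val) := by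
        rw [lintegral_subtype_comap (measurableSet_singleton (0 : Plane)).compl fun x => f ‖x‖,
          restrict_compl_singleton]
    _ = ∫⁻ z, f z.2 ∂((volume : Measure Plane).toSphere.prod (.volumeIoiPow 1)) := by
        have := (volume : Measure Plane).measurePreserving_homeomorphUnitSphereProd
        rw [hdim] at this
        rw [← this.lintegral_comp hm]
        simp [homeomorphUnitSphereProd_apply_snd_coe]
    _ = ENNReal.ofReal (2 * Real.pi) * ∫⁻ x : Ioi (0 : ℝ), f x ∂(Measure.volumeIoiPow 1) := by
        rw [lintegral_prod _ hm.aemeasurable]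
        simp only
        rw [lintegral_const, Measure.toSphere_apply_univ, hdim,
          EuclideanSpace.volume_ball_fin_two, mul_comm, ENNReal.ofReal_mul (by norm_num)]
        simp
    _ = _ := by
        rw [← lintegral_subtype_comap measurableSet_Ioi fun t => ENNReal.ofReal t * f t]
        congr 1
        rw [Measure.volumeIoiPow]
        refine (lintegral_withDensity_eq_lintegral_mul _
          (measurable_subtype_coe.pow_const _).ennreal_ofReal
          (hf.comp measurable_subtype_coe)).trans ?_
        simp

/-- Passage from horizontal distance `t` to true distance `r = √(t² + h²)`, for which `t dt = r dr`.
-/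
lemma lintegral_sqrt_sq_add_sq {h : ℝ} (hh : 0 < h) (f : ℝ → ℝ≥0∞) :
    ∫⁻ t in Ioi 0, ENNReal.ofReal t * f t =
      ∫⁻ r in Ioi h, ENNReal.ofReal r * f (Real.sqrt (r ^ 2 - h ^ 2)) := by
  have himg : (fun r => Real.sqrt (r ^ 2 - h ^ 2)) '' Ioi h = Ioi 0 := by
    ext t
    constructor
    · rintro ⟨r, hr, rfl⟩
      have hr' : h < r := hr
      exact Real.sqrt_pos.2 (by nlinarith)
    · intro ht
      have ht' : (0 : ℝ) < t := ht
      refine ⟨Real.sqrt (t ^ 2 + h ^ 2), ?_, ?_⟩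
      · exact Real.lt_sqrt_of_sq_lt (by nlinarith)
      · simp only
        rw [Real.sq_sqrt (by positivity), add_sub_cancel_right, Real.sqrt_sq ht'.le]
  have hder : ∀ r ∈ Ioi h, HasDerivWithinAt (fun r => Real.sqrt (r ^ 2 - h ^ 2))
      (2 * r / (2 * Real.sqrt (r ^ 2 - h ^ 2))) (Ioi h) r := by
    intro r hr
    have hr' : h < r := hr
    have h1 : HasDerivAt (fun r : ℝ => r ^ 2 - h ^ 2) (2 * r) r := by
      simpa using (hasDerivAt_pow 2 r).sub_const (h ^ 2)
    exact (h1.sqrt (by nlinarith : (0 : ℝ) < r ^ 2 - h ^ 2).ne').hasDerivWithinAt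
  have hinj : InjOn (fun r => Real.sqrt (r ^ 2 - h ^ 2)) (Ioi h) := by
    intro r hr r' hr' heq
    have h1 : h < r := hr
    have h2 : h < r' := hr'
    have := (Real.sqrt_inj (by nlinarith) (by nlinarith)).1 heq
    nlinarith [sq_nonneg (r - r')]
  rw [← himg, lintegral_image_eq_lintegral_abs_deriv_mul measurableSet_Ioi hder hinj]
  refine setLIntegral_congr_fun measurableSet_Ioi fun r hr => ?_
  have hr' : h < r := hr
  have hs : 0 < Real.sqrt (r ^ 2 - h ^ 2) := Real.sqrt_pos.2 (by nlinarith)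
  have hr0 : 0 < r := hh.trans hr'
  rw [← mul_assoc, ← ENNReal.ofReal_mul (abs_nonneg _), abs_of_pos (by positivity)]
  congr 2
  field_simp

/-! ### Link states and marks -/

namespace Params

variable (p : Params)

lemma linkProb_NLoS (x : ℝ) : p.linkProb .NLoS x = 1 - p.linkProb .LoS x := rfl

lemma measurable_linkProb (s : Link) : Measurable (p.linkProb s) := by
  have h : Measurable (p.linkProb .LoS) := by
    unfold linkProb
    have : Measurable fun x : ℝ => p.h / x := measurable_const.div measurable_id
    fun_prop
  cases s
  · exact h
  · exact measurable_const.sub h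

variable {p}

lemma linkProb_LoS_mem (hp : p.Valid) (x : ℝ) : p.linkProb .LoS x ∈ Ioo 0 1 := by
  have := hp.a_pos
  have h : 0 < p.a * Real.exp (-p.b * (180 / Real.pi) * Real.arctan (p.h / x - p.a)) := by
    positivity
  constructor
  · unfold linkProb; positivity
  · unfold linkProb
    rw [div_lt_one (by positivity)]
    linarith

lemma linkProb_pos (hp : p.Valid) (s : Link) (x : ℝ) : 0 < p.linkProb s x := by
  cases s
  · exact (linkProb_LoS_mem hp x).1
  · rw [linkProb_NLoS]; linarith [(linkProb_LoS_mem hp x).2]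

lemma linkProb_le_one (hp : p.Valid) (s : Link) (x : ℝ) : p.linkProb s x ≤ 1 := by
  cases s
  · exact (linkProb_LoS_mem hp x).2.le
  · rw [linkProb_NLoS]; linarith [(linkProb_LoS_mem hp x).1]

variable (p)

/-- Law of the marks of an ABS. -/
noncomputable def markLaw : Measure (ℝ × ℝ × ℝ) :=
  (volume.restrict (Icc (0 : ℝ) 1)).prod
    ((gammaMeasure (p.m .LoS) (p.m .LoS)).prod (gammaMeasure (p.m .NLoS) (p.m .NLoS)))

/-- State of the link to an ABS at `x` with marks `k`. -/
noncomputable def linkState (x : Plane) (k : ℝ × ℝ × ℝ) : Link :=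
  if k.1 ≤ p.linkProb .LoS ‖x‖ then .LoS else .NLoS

/-- The channel gain recorded in the marks for a link in state `s`. -/
def gain : Link → ℝ × ℝ × ℝ → ℝ
  | .LoS, k => k.2.1
  | .NLoS, k => k.2.2

/-- The gamma law of the channel gain of a link in state `s`. -/
noncomputable def gainLaw (s : Link) : Measure ℝ := gammaMeasure (p.m s) (p.m s)

variable {p}

lemma m_pos (hp : p.Valid) (s : Link) : (0 : ℝ) < p.m s := by exact_mod_cast hp.one_le_m s

lemma isProbabilityMeasure_gainLaw (hp : p.Valid) (s : Link) :
    IsProbabilityMeasure (p.gainLaw s) :=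
  isProbabilityMeasure_gammaMeasure (m_pos hp s) (m_pos hp s)

lemma isProbabilityMeasure_markLaw (hp : p.Valid) : IsProbabilityMeasure p.markLaw := by
  have h1 := isProbabilityMeasure_gainLaw hp .LoS
  have h2 := isProbabilityMeasure_gainLaw hp .NLoS
  unfold gainLaw at h1 h2
  have h3 : IsProbabilityMeasure (volume.restrict (Icc (0 : ℝ) 1)) := ⟨by simp⟩
  unfold markLaw
  infer_instance

lemma measurable_gain (s : Link) : Measurable (gain s) := by
  cases s <;> unfold gain <;> fun_prop

lemma measurable_ite_linkState {φ : Link → Plane × (ℝ × ℝ × ℝ) → ℝ≥0∞}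
    (hφ : ∀ s, Measurable (φ s)) :
    Measurable fun y : Plane × (ℝ × ℝ × ℝ) => φ (p.linkState y.1 y.2) y := by
  have hS : MeasurableSet {y : Plane × (ℝ × ℝ × ℝ) | y.2.1 ≤ p.linkProb .LoS ‖y.1‖} :=
    measurableSet_le (by fun_prop) ((p.measurable_linkProb _).comp (by fun_prop))
  have : (fun y : Plane × (ℝ × ℝ × ℝ) => φ (p.linkState y.1 y.2) y) =
      fun y => if y.2.1 ≤ p.linkProb .LoS ‖y.1‖ then φ .LoS y else φ .NLoS y := by
    ext y
    unfold linkState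
    split_ifs <;> rfl
  rw [this]
  exact Measurable.ite hS (hφ _) (hφ _)

/-- Integration over the marks: the state of the link is `s` with probability `linkProb s`, and
the channel gain then has law `gainLaw s`. -/
lemma lintegral_markLaw (hp : p.Valid) (x : Plane) {φ : Link → ℝ → ℝ≥0∞}
    (hφ : ∀ s, Measurable (φ s)) :
    ∫⁻ k, φ (p.linkState x k) (gain (p.linkState x k) k) ∂p.markLaw =
      ENNReal.ofReal (p.linkProb .LoS ‖x‖) * ∫⁻ H, φ .LoS H ∂p.gainLaw .LoS +
      ENNReal.ofReal (p.linkProb .NLoS ‖x‖) * ∫⁻ H, φ .NLoS H ∂p.gainLaw .NLoS := by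
  have i1 := isProbabilityMeasure_gainLaw hp .LoS
  have i2 := isProbabilityMeasure_gainLaw hp .NLoS
  have hP := linkProb_LoS_mem hp ‖x‖
  set P := p.linkProb .LoS ‖x‖ with hPdef
  -- The uniform mark selects the state and is independent of both gains, so each summand is a
  -- product of functions of independent coordinates.
  have e : ∀ k, φ (p.linkState x k) (gain (p.linkState x k) k) =
      (Iic P).indicator 1 k.1 * φ .LoS k.2.1 + (Ioi P).indicator 1 k.1 * φ .NLoS k.2.2 := by
    intro k
    unfold linkState
    split_ifs with h
    · rw [indicator_of_mem (by exact h), indicator_of_notMem (by simpa using h)]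
      simp [gain]
    · rw [indicator_of_notMem (by exact h), indicator_of_mem (by simpa using h)]
      simp [gain]
  have hI : Measurable ((Iic P).indicator (1 : ℝ → ℝ≥0∞)) := measurable_one.indicator measurableSet_Iic
  have hI' : Measurable ((Ioi P).indicator (1 : ℝ → ℝ≥0∞)) := measurable_one.indicator measurableSet_Ioi
  have m1 : Measurable fun k : ℝ × ℝ => φ .LoS k.1 := (hφ _).comp measurable_fst
  have m2 : Measurable fun k : ℝ × ℝ => φ .NLoS k.2 := (hφ _).comp measurable_snd
  have a1 : ∫⁻ k, φ .LoS k.1 ∂((p.gainLaw .LoS).prod (p.gainLaw .NLoS)) =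
      ∫⁻ H, φ .LoS H ∂p.gainLaw .LoS := by
    rw [lintegral_prod _ m1.aemeasurable]; simp
  have a2 : ∫⁻ k, φ .NLoS k.2 ∂((p.gainLaw .LoS).prod (p.gainLaw .NLoS)) =
      ∫⁻ H, φ .NLoS H ∂p.gainLaw .NLoS := by
    rw [lintegral_prod _ m2.aemeasurable]; simp
  have v1 : volume (Iic P ∩ Icc 0 1) = ENNReal.ofReal P := by
    have : Iic P ∩ Icc 0 1 = Icc 0 P := by
      ext b; simp only [mem_inter_iff, mem_Iic, mem_Icc]
      constructor
      · rintro ⟨h1, h2, h3⟩; exact ⟨h2, h1⟩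
      · rintro ⟨h1, h2⟩; exact ⟨h2, h1, h2.trans hP.2.le⟩
    rw [this, Real.volume_Icc, sub_zero]
  have v2 : volume (Ioi P ∩ Icc 0 1) = ENNReal.ofReal (p.linkProb .NLoS ‖x‖) := by
    have : Ioi P ∩ Icc 0 1 = Ioc P 1 := by
      ext b; simp only [mem_inter_iff, mem_Ioi, mem_Icc, mem_Ioc]
      constructor
      · rintro ⟨h1, h2, h3⟩; exact ⟨h1, h3⟩
      · rintro ⟨h1, h2⟩; exact ⟨h1, hP.1.le.trans h1.le, h2⟩
    rw [this, Real.volume_Ioc, linkProb_NLoS]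
  have hM : p.markLaw = (volume.restrict (Icc (0 : ℝ) 1)).prod
    ((p.gainLaw .LoS).prod (p.gainLaw .NLoS)) := rfl
  simp_rw [e]
  rw [lintegral_add_left (f := fun k : ℝ × ℝ × ℝ => (Iic P).indicator 1 k.1 * φ .LoS k.2.1)
    ((hI.comp measurable_fst).mul (m1.comp measurable_snd)), hM,
    lintegral_prod_mul (g := fun k : ℝ × ℝ => φ .LoS k.1) hI.aemeasurable m1.aemeasurable,
    lintegral_prod_mul (g := fun k : ℝ × ℝ => φ .NLoS k.2) hI'.aemeasurable m2.aemeasurable, a1, a2,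
    lintegral_indicator_one measurableSet_Iic, lintegral_indicator_one measurableSet_Ioi,
    Measure.restrict_apply measurableSet_Iic, Measure.restrict_apply measurableSet_Ioi, v1, v2]

/-- Integration of a function of the horizontal distance, the state and the channel gain against
the intensity of the marked ABSs. -/
lemma lintegral_intensity_markLaw (hp : p.Valid) {φ : Link → ℝ → ℝ → ℝ≥0∞}
    (hφ : ∀ s, Measurable (Function.uncurry (φ s))) :
    ∫⁻ y : Plane × (ℝ × ℝ × ℝ), φ (p.linkState y.1 y.2) ‖y.1‖ (gain (p.linkState y.1 y.2) y.2)
        ∂intensity p.lamA p.markLaw =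
      ENNReal.ofReal (2 * Real.pi * p.lamA) * ∫⁻ t in Ioi 0, ENNReal.ofReal t *
        (ENNReal.ofReal (p.linkProb .LoS t) * ∫⁻ H, φ .LoS t H ∂p.gainLaw .LoS +
          ENNReal.ofReal (p.linkProb .NLoS t) * ∫⁻ H, φ .NLoS t H ∂p.gainLaw .NLoS) := by
  have i0 := isProbabilityMeasure_markLaw hp
  have i1 := fun s => isProbabilityMeasure_gainLaw hp s
  have hm : Measurable fun y : Plane × (ℝ × ℝ × ℝ) =>
      φ (p.linkState y.1 y.2) ‖y.1‖ (gain (p.linkState y.1 y.2) y.2) :=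
    measurable_ite_linkState (φ := fun s y => φ s ‖y.1‖ (gain s y.2)) fun s =>
      (hφ s).comp (measurable_fst.norm.prodMk ((measurable_gain s).comp measurable_snd))
  rw [lintegral_intensity hm]
  simp_rw [lintegral_markLaw hp _ (φ := fun s => φ s _) fun s =>
    (hφ s).comp measurable_prodMk_left]
  have hf : ∀ s, Measurable fun t => ∫⁻ H, φ s t H ∂p.gainLaw s := fun s =>
    (hφ s).lintegral_prod_right'
  rw [lintegral_norm_plane (f := fun t => ENNReal.ofReal (p.linkProb .LoS t) *
      ∫⁻ H, φ .LoS t H ∂p.gainLaw .LoS + ENNReal.ofReal (p.linkProb .NLoS t) *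
      ∫⁻ H, φ .NLoS t H ∂p.gainLaw .NLoS), ← mul_assoc,
    ← ENNReal.ofReal_mul hp.lamA_pos.le, mul_comm p.lamA]
  exact ((p.measurable_linkProb _).ennreal_ofReal.mul (hf _)).add
    ((p.measurable_linkProb _).ennreal_ofReal.mul (hf _))

end Params

namespace Params

/-! ### The Laplace functional of the interference -/

/-- There is an explicit antiderivative, a multiple of `(x² + h²)^(1 - α/2)`; it tends to 0 because
`α > 2`. -/
lemma integrableOn_mul_rpow {h α : ℝ} (hh : 0 < h) (hα : 2 < α) :
    IntegrableOn (fun x : ℝ => x * (x ^ 2 + h ^ 2) ^ (-(α / 2))) (Ioi 0) := by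
  have hder : ∀ x : ℝ, HasDerivAt (fun x : ℝ => (x ^ 2 + h ^ 2) ^ (1 - α / 2) / (2 - α))
      (x * (x ^ 2 + h ^ 2) ^ (-(α / 2))) x := by
    intro x
    have h1 : HasDerivAt (fun x : ℝ => x ^ 2 + h ^ 2) (2 * x) x := by
      simpa using (hasDerivAt_pow 2 x).add_const (h ^ 2)
    have h2 := (h1.rpow_const (p := 1 - α / 2) (Or.inl (by positivity))).div_const (2 - α)
    refine h2.congr_deriv ?_
    have : 2 - α ≠ 0 := by linarith
    have e : 1 - α / 2 - 1 = -(α / 2) := by ring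
    rw [e]
    field_simp
  refine integrableOn_Ioi_deriv_of_nonneg (l := 0) (hder 0).continuousAt.continuousWithinAt
    (fun x _ => hder x) (fun x hx => ?_) ?_
  · have : (0 : ℝ) < x := hx
    positivity
  · have h1 : Filter.Tendsto (fun x : ℝ => x ^ 2 + h ^ 2) Filter.atTop Filter.atTop :=
      Filter.tendsto_atTop_add_const_right _ _ (Filter.tendsto_pow_atTop two_ne_zero)
    have h2 := (tendsto_rpow_neg_atTop (y := α / 2 - 1) (by linarith)).comp h1
    have h3 := h2.div_const (2 - α)
    rw [zero_div] at h3
    refine h3.congr fun x => ?_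
    simp only [Function.comp]
    congr 2
    ring

variable (p : Params)

/-- Average received power, divided by the power allocation factor, of an ABS in state `s` at
horizontal distance `x`. -/
noncomputable def rxGain (s : Link) (x : ℝ) : ℝ :=
  p.PA * p.C s * Real.sqrt (x ^ 2 + p.h ^ 2) ^ (-p.alpha s)

/-- Laplace transform at `t` of the power received from an ABS in state `s` at horizontal
distance `x`. -/
noncomputable def laplaceOne (s : Link) (t x : ℝ) : ℝ :=
  ((1 + t * p.PA * p.C s / (p.m s * (x ^ 2 + p.h ^ 2) ^ (p.alpha s / 2))) ^ p.m s)⁻¹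

lemma measurable_rxGain (s : Link) : Measurable (p.rxGain s) := by
  unfold rxGain; fun_prop

lemma measurable_laplaceOne (s : Link) (t : ℝ) : Measurable (p.laplaceOne s t) := by
  unfold laplaceOne
  have : Measurable fun x : ℝ =>
      t * p.PA * p.C s / (p.m s * (x ^ 2 + p.h ^ 2) ^ (p.alpha s / 2)) :=
    measurable_const.div (by fun_prop)
  fun_prop

variable {p}

lemma rxGain_eq (hp : p.Valid) (s : Link) (x : ℝ) :
    p.rxGain s x = p.PA * p.C s * (x ^ 2 + p.h ^ 2) ^ (-(p.alpha s / 2)) := by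
  have := hp.h_pos
  rw [rxGain, Real.sqrt_eq_rpow, ← Real.rpow_mul (by positivity)]
  ring_nf

lemma rxGain_pos (hp : p.Valid) (s : Link) (x : ℝ) : 0 < p.rxGain s x := by
  have := hp.h_pos
  have := hp.PA_pos
  have := hp.C_pos s
  rw [rxGain_eq hp]
  positivity

lemma laplaceOne_eq (hp : p.Valid) (s : Link) (t x : ℝ) :
    p.laplaceOne s t x = ((1 + t * p.rxGain s x / p.m s) ^ p.m s)⁻¹ := by
  have := hp.h_pos
  have h1 : (0 : ℝ) < x ^ 2 + p.h ^ 2 := by positivity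
  rw [laplaceOne, rxGain_eq hp, Real.rpow_neg h1.le]
  have := (Real.rpow_pos_of_pos h1 (p.alpha s / 2)).ne'
  have := (m_pos hp s).ne'
  congr 3
  field_simp

/-- Bernoulli's inequality gives `1 - (1 + a)^(-m) ≤ m a`. The bound makes the exponent of
`laplacePart` integrable at infinity. -/
lemma laplaceOne_mem (hp : p.Valid) (s : Link) {t : ℝ} (ht : 0 ≤ t) (x : ℝ) :
    p.laplaceOne s t x ∈ Icc 0 1 ∧ 1 - p.laplaceOne s t x ≤ t * p.rxGain s x := by
  have hm := m_pos hp s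
  have hr := rxGain_pos hp s x
  set a := t * p.rxGain s x / p.m s with ha
  have ha0 : 0 ≤ a := by positivity
  have h1 : 1 ≤ (1 + a) ^ p.m s := one_le_pow₀ (by linarith)
  rw [laplaceOne_eq hp]
  refine ⟨⟨by positivity, inv_le_one_of_one_le₀ h1⟩, ?_⟩
  have h2 : 1 + (p.m s : ℝ) * (-a) ≤ (1 + a)⁻¹ ^ p.m s := by
    have h3 : 1 + (p.m s : ℝ) * ((1 + a)⁻¹ - 1) ≤ (1 + ((1 + a)⁻¹ - 1)) ^ p.m s := by
      refine one_add_mul_le_pow ?_ _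
      have : 0 < (1 + a)⁻¹ := by positivity
      linarith
    have h4 : -a ≤ (1 + a)⁻¹ - 1 := by
      have : (1 + a)⁻¹ - 1 = -(a / (1 + a)) := by field_simp; ring
      rw [this]
      have : a / (1 + a) ≤ a := div_le_self ha0 (by linarith)
      linarith
    rw [add_sub_cancel] at h3
    nlinarith
  rw [inv_pow] at h2
  have h5 : (p.m s : ℝ) * a = t * p.rxGain s x := by rw [ha]; field_simp
  linarith

lemma lintegral_expNeg_gainLaw (hp : p.Valid) (s : Link) {t : ℝ} (ht : 0 ≤ t) (x : ℝ) :
    ∫⁻ H, expNeg (ENNReal.ofReal t * ENNReal.ofReal (p.rxGain s x * H)) ∂p.gainLaw s =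
      ENNReal.ofReal (p.laplaceOne s t x) := by
  rw [laplaceOne_eq hp, gainLaw, ← lintegral_expNeg_gammaMeasure (hp.one_le_m s) (m_pos hp s)
    (mul_nonneg ht (rxGain_pos hp s x).le)]
  refine lintegral_congr fun H => ?_
  rw [← ENNReal.ofReal_mul ht, mul_assoc]

lemma integrableOn_mul_rxGain (hp : p.Valid) (s : Link) :
    IntegrableOn (fun x => x * p.rxGain s x) (Ioi 0) := by
  refine IntegrableOn.congr_fun ((integrableOn_mul_rpow hp.h_pos (hp.two_lt_alpha s)).const_mul
    (p.PA * p.C s)) (fun x _ => ?_) measurableSet_Ioi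
  simp only [rxGain_eq hp]
  ring

lemma integrableOn_laplacePart (hp : p.Valid) (s : Link) {t w : ℝ} (ht : 0 ≤ t) (hw : 0 ≤ w) :
    IntegrableOn (fun x => (1 - p.laplaceOne s t x) * p.linkProb s x * x) (Ioi w) := by
  refine Integrable.mono' (((integrableOn_mul_rxGain hp s).mono_set
    (Ioi_subset_Ioi hw)).const_mul t) ?_ ?_
  · exact (((measurable_const.sub (p.measurable_laplaceOne s t)).mul
      (p.measurable_linkProb s)).mul measurable_id).aestronglyMeasurable
  · refine (ae_restrict_iff' measurableSet_Ioi).2 (ae_of_all _ fun x hx => ?_)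
    have hx0 : 0 < x := hw.trans_lt hx
    obtain ⟨h1, h2⟩ := laplaceOne_mem hp s ht x
    have h3 := linkProb_pos hp s x
    have h4 := linkProb_le_one hp s x
    have h5 : 0 ≤ 1 - p.laplaceOne s t x := by linarith [h1.2]
    rw [Real.norm_of_nonneg (by positivity)]
    calc (1 - p.laplaceOne s t x) * p.linkProb s x * x
        ≤ (t * p.rxGain s x) * 1 * x := by
          have := (rxGain_pos hp s x).le
          gcongr
      _ = t * (x * p.rxGain s x) := by ring

lemma intervalIntegrable_mul_linkProb (hp : p.Valid) (s : Link) (u w : ℝ) :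
    IntervalIntegrable (fun x => x * p.linkProb s x) volume u w := by
  refine IntervalIntegrable.continuousOn_mul ?_ continuousOn_id
  refine (intervalIntegrable_const (c := (1 : ℝ))).mono_fun
    (p.measurable_linkProb s).aestronglyMeasurable (ae_of_all _ fun x => ?_)
  simp only
  rw [Real.norm_of_nonneg (linkProb_pos hp s x).le]
  simpa using linkProb_le_one hp s x

/-- Below `w` an ABS is forbidden and contributes its whole intensity to the exponent; beyond `w` it
contributes one minus the Laplace transform of its power. Only the null point `x = w` escapes this
description. -/
lemma lintegral_linkProb_mul_sub (hp : p.Valid) (s : Link) {t w : ℝ} (ht : 0 ≤ t) (hw : 0 ≤ w) :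
    ∫⁻ x in Ioi 0, ENNReal.ofReal x * (ENNReal.ofReal (p.linkProb s x) *
      (1 - (if w ≤ x then 1 else 0) * ENNReal.ofReal (p.laplaceOne s t x))) =
    ENNReal.ofReal ((∫ x in (0 : ℝ)..w, x * p.linkProb s x) +
      ∫ x in Ioi w, (1 - p.laplaceOne s t x) * p.linkProb s x * x) := by
  have hsplit : Ioi (0 : ℝ) = Ioc 0 w ∪ Ioi w := (Ioc_union_Ioi_eq_Ioi hw).symm
  rw [hsplit, lintegral_union measurableSet_Ioi
    (disjoint_left.2 fun x hx hx' => not_lt.2 hx.2 hx'), ENNReal.ofReal_add]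
  · congr 1
    · rw [intervalIntegral.integral_of_le hw, ofReal_integral_eq_lintegral_ofReal
        (intervalIntegrable_mul_linkProb hp s 0 w).1]
      · refine lintegral_congr_ae ?_
        filter_upwards [ae_restrict_mem measurableSet_Ioc,
          ae_restrict_of_ae (Measure.ae_ne volume w)] with x hx hxw
        rw [if_neg (not_le.2 (lt_of_le_of_ne hx.2 hxw)), ENNReal.ofReal_mul hx.1.le]
        simp
      · refine (ae_restrict_iff' measurableSet_Ioc).2 (ae_of_all _ fun x hx => ?_)
        exact mul_nonneg hx.1.le (linkProb_pos hp s x).le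
    · rw [ofReal_integral_eq_lintegral_ofReal (integrableOn_laplacePart hp s ht hw)]
      · refine setLIntegral_congr_fun measurableSet_Ioi fun x hx => ?_
        have hx' : w < x := hx
        have h1 := (laplaceOne_mem hp s ht x).1
        rw [if_pos hx'.le, one_mul, ← ENNReal.ofReal_one, ← ENNReal.ofReal_sub _ h1.1,
          ← ENNReal.ofReal_mul (linkProb_pos hp s x).le, ← ENNReal.ofReal_mul (hw.trans hx'.le)]
        congr 1
        ring
      · refine (ae_restrict_iff' measurableSet_Ioi).2 (ae_of_all _ fun x hx => ?_)
        have h1 := (laplaceOne_mem hp s ht x).1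
        have h2 := linkProb_pos hp s x
        have h3 : 0 < x := hw.trans_lt hx
        have h4 : 0 ≤ 1 - p.laplaceOne s t x := by linarith [h1.2]
        positivity
  · exact intervalIntegral.integral_nonneg hw fun x hx =>
      mul_nonneg hx.1 (linkProb_pos hp s x).le
  · refine setIntegral_nonneg measurableSet_Ioi fun x hx => ?_
    have h1 := (laplaceOne_mem hp s ht x).1
    have h2 := linkProb_pos hp s x
    have h3 : 0 < x := hw.trans_lt hx
    have h4 : 0 ≤ 1 - p.laplaceOne s t x := by linarith [h1.2]
    positivity

/-- Probability that no ABS in state `s` is closer, horizontally, than `w`, times the Laplace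
transform at `t` of the interference from the ABSs in state `s` beyond `w`. -/
noncomputable def voidLaplace (p : Params) (s : Link) (t w : ℝ) : ℝ :=
  Real.exp (-2 * Real.pi * p.lamA * ∫ x in (0 : ℝ)..w, x * p.linkProb s x) * p.laplacePart s t w

/-- The right side of the Laplace functional for "no ABS of state `s` within `w s`, tilted by
`e^{-tI}`". Averaging over the marks splits the exponent into a LoS and a NLoS part. -/
lemma expNeg_lintegral_one_sub (hp : p.Valid) {t : ℝ} (ht : 0 ≤ t) {w : Link → ℝ}
    (hw : ∀ s, 0 ≤ w s) :
    expNeg (∫⁻ y : Plane × (ℝ × ℝ × ℝ), (1 - (if w (p.linkState y.1 y.2) ≤ ‖y.1‖ then 1 else 0) *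
      expNeg (ENNReal.ofReal t * ENNReal.ofReal
        (p.rxGain (p.linkState y.1 y.2) ‖y.1‖ * gain (p.linkState y.1 y.2) y.2)))
        ∂intensity p.lamA p.markLaw) =
    ENNReal.ofReal (p.voidLaplace .LoS t (w .LoS) * p.voidLaplace .NLoS t (w .NLoS)) := by
  have i1 := fun s => isProbabilityMeasure_gainLaw hp s
  have hlam := hp.lamA_pos
  have hmeas : ∀ s, Measurable fun z : ℝ × ℝ =>
      expNeg (ENNReal.ofReal t * ENNReal.ofReal (p.rxGain s z.1 * z.2)) := fun s =>
    measurable_expNeg.comp ((((p.measurable_rxGain s).comp measurable_fst).mul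
      measurable_snd).ennreal_ofReal.const_mul _)
  have hite : ∀ s, Measurable fun x : ℝ => if w s ≤ x then (1 : ℝ≥0∞) else 0 := fun s =>
    Measurable.ite measurableSet_Ici measurable_const measurable_const
  have hin : ∀ s x, ∫⁻ H, (1 - (if w s ≤ x then 1 else 0) *
      expNeg (ENNReal.ofReal t * ENNReal.ofReal (p.rxGain s x * H))) ∂p.gainLaw s =
      1 - (if w s ≤ x then 1 else 0) * ENNReal.ofReal (p.laplaceOne s t x) := by
    intro s x
    have hm : Measurable fun H => expNeg (ENNReal.ofReal t * ENNReal.ofReal (p.rxGain s x * H)) :=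
      measurable_expNeg.comp ((measurable_const_mul _).ennreal_ofReal.const_mul _)
    have hle : ∀ H, (if w s ≤ x then (1 : ℝ≥0∞) else 0) *
        expNeg (ENNReal.ofReal t * ENNReal.ofReal (p.rxGain s x * H)) ≤ 1 := fun H =>
      mul_le_one' (by split_ifs <;> simp) (expNeg_le_one _)
    have hfin : ∫⁻ H, (if w s ≤ x then (1 : ℝ≥0∞) else 0) *
        expNeg (ENNReal.ofReal t * ENNReal.ofReal (p.rxGain s x * H)) ∂p.gainLaw s ≠ ⊤ :=
      ne_top_of_le_ne_top ENNReal.one_ne_top ((lintegral_mono hle).trans (by simp))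
    refine (lintegral_sub (f := fun _ => (1 : ℝ≥0∞)) (hm.const_mul _) hfin
      (ae_of_all _ hle)).trans ?_
    rw [lintegral_const_mul _ hm, lintegral_expNeg_gainLaw hp s ht]
    simp
  rw [lintegral_intensity_markLaw hp (φ := fun s x H => 1 - (if w s ≤ x then 1 else 0) *
      expNeg (ENNReal.ofReal t * ENNReal.ofReal (p.rxGain s x * H)))]
  · simp_rw [hin, mul_add]
    rw [lintegral_add_left, lintegral_linkProb_mul_sub hp .LoS ht (hw _),
      lintegral_linkProb_mul_sub hp .NLoS ht (hw _)]
    · have hnn : ∀ s, 0 ≤ (∫ x in (0 : ℝ)..w s, x * p.linkProb s x) +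
          ∫ x in Ioi (w s), (1 - p.laplaceOne s t x) * p.linkProb s x * x := by
        intro s
        refine add_nonneg (intervalIntegral.integral_nonneg (hw s) fun x hx =>
          mul_nonneg hx.1 (linkProb_pos hp s x).le)
          (setIntegral_nonneg measurableSet_Ioi fun x hx => ?_)
        have h1 := (laplaceOne_mem hp s ht x).1
        have h2 := linkProb_pos hp s x
        have h3 : 0 < x := (hw s).trans_lt hx
        have h4 : 0 ≤ 1 - p.laplaceOne s t x := by linarith [h1.2]
        positivity
      rw [← ENNReal.ofReal_add (hnn _) (hnn _), ← ENNReal.ofReal_mul (by positivity),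
        expNeg_ofReal (mul_nonneg (by positivity) (add_nonneg (hnn _) (hnn _)))]
      congr 1
      unfold voidLaplace laplacePart
      rw [← Real.exp_add, ← Real.exp_add, ← Real.exp_add]
      congr 1
      simp only [laplaceOne]
      ring
    · exact ENNReal.measurable_ofReal.mul ((p.measurable_linkProb _).ennreal_ofReal.mul
        (measurable_const.sub ((hite _).mul (p.measurable_laplaceOne _ _).ennreal_ofReal)))
  · exact fun s => measurable_const.sub (((hite s).comp measurable_fst).mul (hmeas s))

/-- The gains have mean 1, so this mean power is an integral of the path loss: `h > 0` removes the
singularity at the origin and the exponents above 2 give convergence at infinity. -/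
lemma lintegral_rx_lt_top (hp : p.Valid) :
    ∫⁻ y : Plane × (ℝ × ℝ × ℝ), ENNReal.ofReal
        (p.rxGain (p.linkState y.1 y.2) ‖y.1‖ * gain (p.linkState y.1 y.2) y.2)
        ∂intensity p.lamA p.markLaw < ⊤ := by
  have hin : ∀ s x, ∫⁻ H, ENNReal.ofReal (p.rxGain s x * H) ∂p.gainLaw s =
      ENNReal.ofReal (p.rxGain s x) := by
    intro s x
    simp_rw [ENNReal.ofReal_mul (rxGain_pos hp s x).le]
    rw [lintegral_const_mul _ ENNReal.measurable_ofReal, gainLaw,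
      lintegral_id_gammaMeasure (m_pos hp s) (m_pos hp s), div_self (m_pos hp s).ne']
    simp
  rw [lintegral_intensity_markLaw hp (φ := fun s x H => ENNReal.ofReal (p.rxGain s x * H))]
  · simp_rw [hin]
    refine ENNReal.mul_lt_top ENNReal.ofReal_lt_top ?_
    have hint := fun s => (integrableOn_mul_rxGain hp s).lintegral_lt_top
    calc _ ≤ ∫⁻ x in Ioi 0, (ENNReal.ofReal (x * p.rxGain .LoS x) +
          ENNReal.ofReal (x * p.rxGain .NLoS x)) := by
          refine setLIntegral_mono' measurableSet_Ioi fun x hx => ?_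
          have hx' : (0 : ℝ) < x := hx
          rw [mul_add, ENNReal.ofReal_mul hx'.le, ENNReal.ofReal_mul hx'.le]
          gcongr
          · exact mul_le_of_le_one_left' (by simpa using linkProb_le_one hp _ x)
          · exact mul_le_of_le_one_left' (by simpa using linkProb_le_one hp _ x)
      _ < ⊤ := by
          rw [lintegral_add_left (f := fun x => ENNReal.ofReal (x * p.rxGain .LoS x))
            (measurable_id.mul (p.measurable_rxGain _)).ennreal_ofReal]
          exact ENNReal.add_lt_top.2 ⟨hint _, hint _⟩
  · exact fun s => (((p.measurable_rxGain s).comp measurable_fst).mul measurable_snd).ennreal_ofReal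

end Params

namespace Params

variable (p : Params)

/-! ### Association thresholds -/

/-- Long-term average power received from an ABS in state `s` at distance `r`. -/
noncomputable def avgPower (s : Link) (r : ℝ) : ℝ := p.eta s * r ^ (-p.alpha s)

/-- If the serving ABS is in state `s₀` at distance `r`, then the other ABSs in state `s` have
horizontal distance at least `guard s₀ r s`. -/
noncomputable def guard : Link → ℝ → Link → ℝ
  | .LoS, r, .LoS => Real.sqrt (r ^ 2 - p.h ^ 2)
  | .LoS, r, .NLoS => Real.sqrt (p.tauNL r ^ 2 - p.h ^ 2)
  | .NLoS, r, .LoS => Real.sqrt (p.tauLN r ^ 2 - p.h ^ 2)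
  | .NLoS, r, .NLoS => Real.sqrt (r ^ 2 - p.h ^ 2)

lemma guard_nonneg (s₀ s : Link) (r : ℝ) : 0 ≤ p.guard s₀ r s := by
  cases s₀ <;> cases s <;> exact Real.sqrt_nonneg _

variable {p}

lemma eta_pos (hp : p.Valid) (s : Link) : 0 < p.eta s := by
  have := hp.an_pos
  have := hp.PA_pos
  have := hp.C_pos s
  unfold eta
  positivity

lemma etaT_pos (hp : p.Valid) : 0 < p.etaT := by
  have := hp.GM_pos
  have := hp.PT_pos
  have := hp.CT_pos
  unfold etaT
  positivity

lemma alpha_pos (hp : p.Valid) (s : Link) : 0 < p.alpha s := by linarith [hp.two_lt_alpha s]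

lemma avgPower_pos (hp : p.Valid) (s : Link) {r : ℝ} (hr : 0 < r) : 0 < p.avgPower s r :=
  mul_pos (eta_pos hp s) (Real.rpow_pos_of_pos hr _)

lemma mul_rpow_neg_le_iff_mul_rpow {c d α β x r : ℝ} (hx : 0 < x) (hr : 0 < r) :
    c * x ^ (-α) ≤ d * r ^ (-β) ↔ c * r ^ β ≤ d * x ^ α := by
  have := Real.rpow_pos_of_pos hx α
  have := Real.rpow_pos_of_pos hr β
  rw [Real.rpow_neg hx.le, Real.rpow_neg hr.le, ← div_eq_mul_inv, ← div_eq_mul_inv,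
    div_le_div_iff₀ (by positivity) (by positivity)]

lemma rpow_threshold {c d α β r : ℝ} (hc : 0 < c) (hd : 0 < d) (hα : 0 < α) (hr : 0 < r) :
    ((c / d) ^ (1 / α) * r ^ (β / α)) ^ α = c / d * r ^ β := by
  rw [Real.mul_rpow (by positivity) (by positivity), ← Real.rpow_mul (by positivity),
    ← Real.rpow_mul hr.le, one_div, inv_mul_cancel₀ hα.ne', Real.rpow_one,
    div_mul_cancel₀ _ hα.ne']

lemma mul_rpow_neg_le_iff_threshold_le {c d α β x r : ℝ} (hc : 0 < c) (hd : 0 < d) (hα : 0 < α)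
    (hx : 0 < x) (hr : 0 < r) :
    c * x ^ (-α) ≤ d * r ^ (-β) ↔ (c / d) ^ (1 / α) * r ^ (β / α) ≤ x := by
  rw [← Real.rpow_le_rpow_iff (by positivity) hx.le hα, rpow_threshold hc hd hα hr,
    mul_rpow_neg_le_iff_mul_rpow hx hr, div_mul_eq_mul_div, div_le_iff₀ hd, mul_comm d]

lemma mul_rpow_neg_le_iff_le_threshold {c d α β x r : ℝ} (hc : 0 < c) (hd : 0 < d) (hβ : 0 < β)
    (hx : 0 < x) (hr : 0 < r) :
    c * x ^ (-α) ≤ d * r ^ (-β) ↔ r ≤ (d / c) ^ (1 / β) * x ^ (α / β) := by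
  rw [← Real.rpow_le_rpow_iff hr.le (by positivity) hβ, rpow_threshold hd hc hβ hx,
    mul_rpow_neg_le_iff_mul_rpow hx hr, div_mul_eq_mul_div, le_div_iff₀ hc, mul_comm (r ^ β)]

lemma le_sqrt_add_iff {T x h : ℝ} (hT : 0 ≤ T) (hx : 0 ≤ x) :
    T ≤ Real.sqrt (x ^ 2 + h ^ 2) ↔ Real.sqrt (T ^ 2 - h ^ 2) ≤ x := by
  rw [Real.le_sqrt hT (by positivity), Real.sqrt_le_left hx]
  constructor <;> intro <;> linarith

lemma sqrt_add_pos {h : ℝ} (hh : 0 < h) (x : ℝ) : 0 < Real.sqrt (x ^ 2 + h ^ 2) :=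
  Real.sqrt_pos.2 (by positivity)

/-- Average power decreases with distance, so comparing powers means comparing the distance with a
threshold. A threshold below `h` excludes nothing, which agrees with the square root of a negative
number being 0. -/
lemma avgPower_le_iff_guard (hp : p.Valid) (s₀ s : Link) {r x : ℝ} (hr : 0 < r) (hx : 0 ≤ x) :
    p.avgPower s (Real.sqrt (x ^ 2 + p.h ^ 2)) ≤ p.avgPower s₀ r ↔ p.guard s₀ r s ≤ x := by
  have hd := sqrt_add_pos hp.h_pos x
  have e1 := eta_pos hp s
  have e2 := eta_pos hp s₀
  have hs := alpha_pos hp s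
  unfold avgPower
  rw [mul_rpow_neg_le_iff_threshold_le e1 e2 hs hd hr, le_sqrt_add_iff (by positivity) hx]
  have same : ∀ s, (p.eta s / p.eta s) ^ (1 / p.alpha s) * r ^ (p.alpha s / p.alpha s) = r := by
    intro s
    rw [div_self (eta_pos hp s).ne', div_self (alpha_pos hp s).ne', Real.one_rpow, Real.rpow_one,
      one_mul]
  cases s₀ <;> cases s
  · rw [same]; rfl
  · change _ ↔ Real.sqrt (p.tauNL r ^ 2 - p.h ^ 2) ≤ x
    unfold tauNL
    split_ifs with h
    · have hle : (p.eta .NLoS / p.eta .LoS) ^ (1 / p.alpha .NLoS) *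
          r ^ (p.alpha .LoS / p.alpha .NLoS) ≤ p.h := by
        rw [← mul_rpow_neg_le_iff_threshold_le e1 e2 hs hp.h_pos hr,
          mul_rpow_neg_le_iff_le_threshold e1 e2 (alpha_pos hp .LoS) hp.h_pos hr]
        exact h
      rw [sub_self, Real.sqrt_zero, Real.sqrt_eq_zero_of_nonpos]
      have : 0 ≤ (p.eta .NLoS / p.eta .LoS) ^ (1 / p.alpha .NLoS) *
          r ^ (p.alpha .LoS / p.alpha .NLoS) := by positivity
      nlinarith
    · rfl
  · rfl
  · rw [same]; rfl

/-! ### Association with a TBS -/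

lemma tbs_threshold_NLoS (hp : p.Valid) {r x : ℝ} (hr : p.h ≤ r) (hx : 0 < x) (hxR : x ≤ p.RB) :
    p.avgPower .NLoS r ≤ p.etaT * x ^ (-p.alphaT) := by
  refine le_trans ?_ (hp.nlos_le_tbs.trans ?_)
  · refine mul_le_mul_of_nonneg_left ?_ (eta_pos hp _).le
    exact Real.rpow_le_rpow_of_nonpos hp.h_pos hr (by linarith [alpha_pos hp .NLoS])
  · refine mul_le_mul_of_nonneg_left ?_ (etaT_pos hp).le
    exact Real.rpow_le_rpow_of_nonpos hx hxR (by linarith [hp.alphaT_pos])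

lemma tbs_threshold_LoS (hp : p.Valid) {r x : ℝ} (hr : 0 < r) (hx : 0 < x) :
    p.avgPower .LoS r ≤ p.etaT * x ^ (-p.alphaT) ↔ x ≤ p.tauTL r :=
  mul_rpow_neg_le_iff_le_threshold (eta_pos hp _) (etaT_pos hp) hp.alphaT_pos hr hx

/-- Both inequalities compare the power of a LoS ABS at `r` with that of a TBS at `RB`. It decides
which term of the minimum in `tbsGuard` is active. -/
lemma tauTL_le_iff (hp : p.Valid) {r : ℝ} (hr : 0 < r) : p.tauTL r ≤ p.RB ↔ r ≤ p.lLT := by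
  unfold tauTL lLT
  rw [← mul_rpow_neg_le_iff_threshold_le (etaT_pos hp) (eta_pos hp _) hp.alphaT_pos hp.RB_pos hr,
    mul_rpow_neg_le_iff_le_threshold (etaT_pos hp) (eta_pos hp _) (alpha_pos hp _) hp.RB_pos hr]

end Params

/-! ### Void probabilities, and the ABS tier as a marked point process -/

namespace Params

variable (p : Params)

/-- Radius of the disc that has to be free of TBSs if the user is to be associated with an ABS in
state `s` at distance `r`. -/
noncomputable def tbsGuard : Link → ℝ → ℝ
  | .LoS, r => min p.RB (p.tauTL r)
  | .NLoS, _ => p.RB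

/-- Probability that no TBS is received with more power than an ABS in state `s` at distance
`r`. -/
noncomputable def tbsVoid (s : Link) (r : ℝ) : ℝ :=
  Real.exp (-Real.pi * p.lamT * p.tbsGuard s r ^ 2)

/-- Probability that no ABS is received with more power than an ABS in state `s` at distance
`r`. -/
noncomputable def absVoid (s : Link) (r : ℝ) : ℝ :=
  Real.exp (-2 * Real.pi * p.lamA * ∫ x in (0 : ℝ)..p.guard s r .LoS, x * p.linkProb .LoS x) *
    Real.exp (-2 * Real.pi * p.lamA * ∫ x in (0 : ℝ)..p.guard s r .NLoS, x * p.linkProb .NLoS x)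

lemma absVoid_pos (s : Link) (r : ℝ) : 0 < p.absVoid s r := by
  unfold absVoid; positivity

lemma voidLaplace_mul_voidLaplace (s : Link) (r t : ℝ) :
    p.voidLaplace .LoS t (p.guard s r .LoS) * p.voidLaplace .NLoS t (p.guard s r .NLoS) =
      p.absVoid s r * p.laplaceIA s r t := by
  cases s <;>
  · simp only [voidLaplace, absVoid, laplaceIA, guard]
    ring

/-- Average power received from an ABS at position `y.1` with marks `y.2`. -/
noncomputable def avgOf (y : Plane × (ℝ × ℝ × ℝ)) : ℝ≥0∞ :=
  ENNReal.ofReal (p.avgPower (p.linkState y.1 y.2) (Real.sqrt (‖y.1‖ ^ 2 + p.h ^ 2)))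

/-- Instantaneous power received from an ABS at position `y.1` with marks `y.2`. -/
noncomputable def rxOf (y : Plane × (ℝ × ℝ × ℝ)) : ℝ≥0∞ :=
  ENNReal.ofReal (p.rxGain (p.linkState y.1 y.2) ‖y.1‖ * gain (p.linkState y.1 y.2) y.2)

lemma measurable_avgPower (s : Link) : Measurable (p.avgPower s) := by
  unfold avgPower; fun_prop

lemma measurable_avgOf : Measurable p.avgOf :=
  measurable_ite_linkState
    (φ := fun s y => ENNReal.ofReal (p.avgPower s (Real.sqrt (‖y.1‖ ^ 2 + p.h ^ 2))))
    fun s => ((p.measurable_avgPower s).comp (by fun_prop)).ennreal_ofReal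

lemma measurable_rxOf : Measurable p.rxOf :=
  measurable_ite_linkState (φ := fun s y => ENNReal.ofReal (p.rxGain s ‖y.1‖ * gain s y.2))
    fun s => (((p.measurable_rxGain s).comp measurable_fst.norm).mul
      ((measurable_gain s).comp measurable_snd)).ennreal_ofReal

end Params

namespace Network

variable {Ω : Type*} (N : Network Ω) (p : Params)

/-- Position and marks of the `i`-th ABS. -/
def point (i : ℕ) (ω : Ω) : Plane × (ℝ × ℝ × ℝ) := (N.aerial i ω, N.marks i ω)

/-- Largest average power received from an ABS. -/
noncomputable def best (ω : Ω) : ℝ≥0∞ := ⨆ j, p.avgOf (N.point j ω)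

/-- Total instantaneous power received from the ABSs. -/
noncomputable def total (ω : Ω) : ℝ≥0∞ := ∑' j, p.rxOf (N.point j ω)

/-- Largest average power received from an ABS other than the `i`-th. -/
noncomputable def bestOther (i : ℕ) (ω : Ω) : ℝ≥0∞ :=
  ⨆ j, omitAt i (fun j => p.avgOf (N.point j ω)) j

/-- Total instantaneous power received from the ABSs other than the `i`-th. -/
noncomputable def totalOther (i : ℕ) (ω : Ω) : ℝ≥0∞ :=
  ∑' j, omitAt i (fun j => p.rxOf (N.point j ω)) j

variable {N p} [MeasurableSpace Ω] {μ : Measure Ω} [IsProbabilityMeasure μ]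

lemma measurable_point (hN : N.HasNetworkLaw p μ) (i : ℕ) : Measurable (N.point i) :=
  (hN.aerial_hppp.measurable i).prodMk (hN.marks_measurable i)

lemma measurable_best (hN : N.HasNetworkLaw p μ) : Measurable (N.best p) :=
  Measurable.iSup fun j => p.measurable_avgOf.comp (measurable_point hN j)

lemma measurable_total (hN : N.HasNetworkLaw p μ) : Measurable (N.total p) :=
  Measurable.tsum fun j => p.measurable_rxOf.comp (measurable_point hN j)

lemma measurable_bestOther (hN : N.HasNetworkLaw p μ) (i : ℕ) : Measurable (N.bestOther p i) :=
  Measurable.iSup fun j =>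
    measurable_omitAt (fun j => p.measurable_avgOf.comp (measurable_point hN j)) i j

lemma measurable_totalOther (hN : N.HasNetworkLaw p μ) (i : ℕ) :
    Measurable (N.totalOther p i) :=
  Measurable.tsum fun j =>
    measurable_omitAt (fun j => p.measurable_rxOf.comp (measurable_point hN j)) i j

lemma lintegral_infProd_point (hp : p.Valid) (hN : N.HasNetworkLaw p μ)
    {g : Plane × (ℝ × ℝ × ℝ) → ℝ≥0∞} (hgm : Measurable g) (hg : ∀ y, g y ≤ 1) :
    ∫⁻ ω, infProd (fun j => g (N.point j ω)) ∂μ =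
      expNeg (∫⁻ y, (1 - g y) ∂intensity p.lamA p.markLaw) :=
  have := Params.isProbabilityMeasure_markLaw hp
  marked_lintegral_infProd (κ := p.markLaw) hN.aerial_hppp hp.lamA_pos.le hN.marks_measurable hN.marks_law
    hN.marks_indep hN.aerial_indep_marks hgm hg

/-- Mecke formula for the ABS tier. -/
lemma mecke (hp : p.Valid) (hN : N.HasNetworkLaw p μ)
    {Φ : (Plane × (ℝ × ℝ × ℝ)) × (ℝ≥0∞ × ℝ≥0∞) → ℝ≥0∞} (hΦ : Measurable Φ) :
    ∑' i, ∫⁻ ω, Φ (N.point i ω, N.bestOther p i ω, N.totalOther p i ω) ∂μ =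
      ∫⁻ y, ∫⁻ ω, Φ (y, N.best p ω, N.total p ω) ∂μ ∂intensity p.lamA p.markLaw :=
  have := Params.isProbabilityMeasure_markLaw hp
  mecke_iSup_tsum (measurable_point hN) p.measurable_avgOf p.measurable_rxOf
    (fun _ hgm hg => lintegral_infProd_point hp hN hgm hg)
    (fun _ _ hφm hgm hφ hg => marked_mecke_infProd (κ := p.markLaw) hN.aerial_hppp hp.lamA_pos.le
      hN.marks_measurable hN.marks_law hN.marks_indep hN.aerial_indep_marks hgm hg hφm hφ) hΦ

/-! ### Joint law of the strongest ABS and of the interference -/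

/-- The integrand is a product over the ABSs, and the condition on each factor is "outside the
exclusion radius", so the Laplace functional evaluates it. -/
lemma lintegral_best_total (hp : p.Valid) (hN : N.HasNetworkLaw p μ) (s : Link) {r t : ℝ}
    (hr : 0 < r) (ht : 0 ≤ t) :
    ∫⁻ ω, (Iic (ENNReal.ofReal (p.avgPower s r))).indicator 1 (N.best p ω) *
        expNeg (ENNReal.ofReal t * N.total p ω) ∂μ =
      ENNReal.ofReal (p.absVoid s r * p.laplaceIA s r t) := by
  set u := ENNReal.ofReal (p.avgPower s r) with hu
  simp only [best, total, indicator_iSup_mul_expNeg]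
  have hgm : Measurable fun y => (Iic u).indicator (1 : ℝ≥0∞ → ℝ≥0∞) (p.avgOf y) *
      expNeg (ENNReal.ofReal t * p.rxOf y) :=
    ((measurable_one.indicator measurableSet_Iic).comp p.measurable_avgOf).mul
      (measurable_expNeg.comp (p.measurable_rxOf.const_mul _))
  rw [lintegral_infProd_point hp hN hgm fun y =>
    mul_le_one' (indicator_le_self' (fun _ _ => zero_le) _) (expNeg_le_one _),
    ← Params.voidLaplace_mul_voidLaplace,
    ← Params.expNeg_lintegral_one_sub hp ht (w := p.guard s r) fun s' => p.guard_nonneg s s' r]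
  congr 1
  refine lintegral_congr fun y => ?_
  have : (Iic u).indicator (1 : ℝ≥0∞ → ℝ≥0∞) (p.avgOf y) =
      if p.guard s r (p.linkState y.1 y.2) ≤ ‖y.1‖ then 1 else 0 := by
    rw [indicator_apply]
    refine if_congr ?_ rfl rfl
    rw [mem_Iic, ← Params.avgPower_le_iff_guard hp s _ hr (norm_nonneg _)]
    exact ENNReal.ofReal_le_ofReal_iff (Params.avgPower_pos hp s hr).le
  rw [this]
  rfl

/-- The Mecke formula for a functional of the point alone gives the mean of the total power, which
is finite. -/
lemma ae_total_lt_top (hp : p.Valid) (hN : N.HasNetworkLaw p μ) :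
    ∀ᵐ ω ∂μ, N.total p ω < ⊤ := by
  have h := mecke hp hN (Φ := fun z => p.rxOf z.1) (p.measurable_rxOf.comp measurable_fst)
  simp only [lintegral_const, measure_univ, mul_one] at h
  refine ae_lt_top (measurable_total hN) ?_
  unfold total
  rw [lintegral_tsum (f := fun j ω => p.rxOf (N.point j ω))
    fun j => (p.measurable_rxOf.comp (measurable_point hN j)).aemeasurable]
  exact (h.trans_lt (Params.lintegral_rx_lt_top hp)).ne

/-! ### Moments of the interference -/

/-- The event that no ABS is received with more average power than an ABS in state `s` at
distance `r`. -/
def weakerEvent (N : Network Ω) (p : Params) (s : Link) (r : ℝ) : Set Ω :=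
  {ω | N.best p ω ≤ ENNReal.ofReal (p.avgPower s r)}

lemma measurableSet_weakerEvent (hN : N.HasNetworkLaw p μ) (s : Link) (r : ℝ) :
    MeasurableSet (N.weakerEvent p s r) :=
  measurable_best hN measurableSet_Iic

/-- The Laplace transform is written as the moment generating function of minus the interference, to
have its derivatives at hand. The restricted measure is not normalised; its mass is the factor
`absVoid`. -/
lemma mgf_neg_total (hp : p.Valid) (hN : N.HasNetworkLaw p μ) (s : Link) {r t : ℝ}
    (hr : 0 < r) (ht : 0 ≤ t) :
    Integrable (fun ω => Real.exp (t * -(N.total p ω).toReal))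
      (μ.restrict (N.weakerEvent p s r)) ∧
    mgf (fun ω => -(N.total p ω).toReal) (μ.restrict (N.weakerEvent p s r)) t =
      p.absVoid s r * p.laplaceIA s r t := by
  have hm : Measurable fun ω => Real.exp (t * -(N.total p ω).toReal) :=
    ((measurable_total hN).ennreal_toReal.neg.const_mul t).exp
  have hle : ∀ ω, Real.exp (t * -(N.total p ω).toReal) ≤ 1 := fun ω => by
    rw [Real.exp_le_one_iff]
    have : 0 ≤ (N.total p ω).toReal := ENNReal.toReal_nonneg
    nlinarith
  constructor
  · refine Integrable.of_bound hm.aestronglyMeasurable 1 (ae_of_all _ fun ω => ?_)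
    rw [Real.norm_of_nonneg (Real.exp_pos _).le]
    exact hle ω
  · have hnn : 0 ≤ p.absVoid s r * p.laplaceIA s r t := by
      refine mul_nonneg (p.absVoid_pos s r).le ?_
      cases s <;>
      · simp only [Params.laplaceIA, Params.laplacePart]
        positivity
    rw [mgf, integral_eq_lintegral_of_nonneg_ae (ae_of_all _ fun ω => (Real.exp_pos _).le)
      hm.aestronglyMeasurable, ← ENNReal.toReal_ofReal hnn, ← lintegral_best_total hp hN s hr ht]
    congr 1
    rw [← lintegral_indicator (measurableSet_weakerEvent hN s r)]
    refine lintegral_congr_ae ?_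
    filter_upwards [ae_total_lt_top hp hN] with ω hω
    by_cases h : ω ∈ N.weakerEvent p s r
    · rw [indicator_of_mem h, indicator_of_mem (show N.best p ω ∈ Iic _ from h), Pi.one_apply,
        one_mul, expNeg_eq (ENNReal.mul_ne_top ENNReal.ofReal_ne_top hω.ne), ENNReal.toReal_mul,
        ENNReal.toReal_ofReal ht, mul_neg]
    · rw [indicator_of_notMem h, indicator_of_notMem (show N.best p ω ∉ Iic _ from h), zero_mul]

lemma mem_interior_integrableExpSet (hp : p.Valid) (hN : N.HasNetworkLaw p μ) (s : Link) {r t : ℝ}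
    (hr : 0 < r) (ht : 0 < t) :
    t ∈ interior (integrableExpSet (fun ω => -(N.total p ω).toReal)
      (μ.restrict (N.weakerEvent p s r))) := by
  rw [mem_interior_iff_mem_nhds]
  filter_upwards [Ioi_mem_nhds ht] with t' ht'
  exact (mgf_neg_total hp hN s hr (le_of_lt ht')).1

/-- The moments of the interference, tilted by `e^{-t I}`, are the derivatives of its Laplace
transform. -/
lemma integral_pow_mul_exp (hp : p.Valid) (hN : N.HasNetworkLaw p μ) (s : Link) {r t : ℝ}
    (hr : 0 < r) (ht : 0 < t) (n : ℕ) :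
    Integrable (fun ω => (N.total p ω).toReal ^ n * Real.exp (-(t * (N.total p ω).toReal)))
      (μ.restrict (N.weakerEvent p s r)) ∧
    ∫ ω in N.weakerEvent p s r, (N.total p ω).toReal ^ n *
        Real.exp (-(t * (N.total p ω).toReal)) ∂μ =
      p.absVoid s r * ((-1) ^ n * iteratedDeriv n (p.laplaceIA s r) t) := by
  have hint := mem_interior_integrableExpSet hp hN s hr ht
  have hI := integrable_pow_mul_exp_of_mem_interior_integrableExpSet hint n
  have e : ∀ ω, (N.total p ω).toReal ^ n * Real.exp (-(t * (N.total p ω).toReal)) =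
      (-1) ^ n * ((-(N.total p ω).toReal) ^ n * Real.exp (t * -(N.total p ω).toReal)) := fun ω => by
    rw [neg_pow (N.total p ω).toReal, ← mul_assoc, ← mul_assoc, ← mul_pow]
    simp
  constructor
  · simp_rw [e]
    exact hI.const_mul _
  · simp_rw [e]
    rw [integral_const_mul, ← iteratedDeriv_mgf hint]
    -- The formula is known only for nonnegative arguments; since `t > 0` it holds near `t`, which
    -- is enough for derivatives.
    have hev : mgf (fun ω => -(N.total p ω).toReal) (μ.restrict (N.weakerEvent p s r))
        =ᶠ[nhds t] fun t => p.absVoid s r * p.laplaceIA s r t := by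
      filter_upwards [Ioi_mem_nhds ht] with t' ht'
      exact (mgf_neg_total hp hN s hr (le_of_lt ht')).2
    rw [hev.iteratedDeriv_eq n, iteratedDeriv_const_mul_field]
    ring

end Network

namespace Params

variable (p : Params)

/-! ### Coverage at a given serving distance -/

/-- The user is covered when it is served from distance `r` with instantaneous power `G` and sees
the interference `I`. -/
def CoveredAt (r G I : ℝ) : Prop :=
  (r ≤ p.Rf ∧ p.epsf < p.am * G / (p.an * G + I + p.noise) ∧
      p.epst < p.an * G / (I + p.noise + p.beta * p.am * G)) ∨
    (p.Rf < r ∧ p.epst < p.am * G / (p.an * G + I + p.noise))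

/-- Coverage probability at serving distance `r`. -/
noncomputable def covProb (s : Link) (r : ℝ) : ℝ :=
  if r ≤ p.Rf then p.covNear s r else p.covFar s r

/-- Power received from an ABS in state `s` at distance `r`, per unit of channel gain. -/
noncomputable def gainAt (s : Link) (r : ℝ) : ℝ := p.PA * p.C s * r ^ (-p.alpha s)

variable {p}

lemma gainAt_pos (hp : p.Valid) (s : Link) {r : ℝ} (hr : 0 < r) : 0 < p.gainAt s r := by
  have := hp.PA_pos
  have := hp.C_pos s
  unfold gainAt
  positivity

lemma theta_eq (s : Link) (ε : ℝ) {r : ℝ} (hr : 0 < r) :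
    p.theta s ε r = p.m s * (ε / p.gainAt s r) := by
  rw [theta, gainAt, Real.rpow_neg hr.le]
  have := (Real.rpow_pos_of_pos hr (p.alpha s)).ne'
  field_simp

/-- A signal-to-interference condition as a condition on the signal. -/
lemma lt_div_add_iff {ε a b J G : ℝ} (hε : 0 < ε) (hb : 0 ≤ b) (hJ : 0 < J) (hG : 0 ≤ G) :
    ε < a * G / (b * G + J) ↔ 0 < a - b * ε ∧ ε / (a - b * ε) * J < G := by
  have hD : 0 < b * G + J := by positivity
  rw [lt_div_iff₀ hD]
  constructor
  · intro h
    have h1 : ε * J < (a - b * ε) * G := by nlinarith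
    have h2 : 0 < a - b * ε := by
      by_contra hneg
      push Not at hneg
      nlinarith [mul_pos hε hJ]
    refine ⟨h2, ?_⟩
    rw [div_mul_eq_mul_div, div_lt_iff₀ h2]
    linarith
  · rintro ⟨h2, h⟩
    rw [div_mul_eq_mul_div, div_lt_iff₀ h2] at h
    nlinarith

lemma am_pos (hp : p.Valid) : 0 < p.am := hp.an_pos.trans hp.an_lt_am

/-- Each SINR condition is a lower bound on the gain, proportional to `I + noise`; for a near user
the two bounds combine into their maximum, whence `epsStar`. If a denominator is not positive, the
condition cannot hold at all. -/
lemma coveredAt_iff (hp : p.Valid) {r c H I : ℝ} (hc : 0 < c) (hH : 0 ≤ H) (hI : 0 ≤ I) :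
    p.CoveredAt r (c * H) I ↔
      if r ≤ p.Rf then (0 < p.am - p.an * p.epsf ∧ 0 < p.an - p.beta * p.am * p.epst) ∧
        p.epsStar / c * (I + p.noise) < H
      else 0 < p.am - p.an * p.epst ∧ p.epsFar / c * (I + p.noise) < H := by
  have hG : 0 ≤ c * H := by positivity
  have hJ : 0 < I + p.noise := by linarith [hp.noise_pos]
  have key : ∀ ε, ε / c * (I + p.noise) < H ↔ ε * (I + p.noise) < c * H := fun ε => by
    rw [div_mul_eq_mul_div, div_lt_iff₀ hc, mul_comm H]
  have e1 : p.an * (c * H) + I + p.noise = p.an * (c * H) + (I + p.noise) := by ring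
  have e2 : I + p.noise + p.beta * p.am * (c * H) = p.beta * p.am * (c * H) + (I + p.noise) := by
    ring
  unfold CoveredAt
  rw [e1, e2, lt_div_add_iff hp.epsf_pos hp.an_pos.le hJ hG,
    lt_div_add_iff hp.epst_pos hp.an_pos.le hJ hG,
    lt_div_add_iff hp.epst_pos (mul_nonneg hp.beta_nonneg (am_pos hp).le) hJ hG, key, key]
  split_ifs with h
  · rw [epsStar, max_mul_of_nonneg _ _ hJ.le, max_lt_iff]
    simp only [h, not_lt.2 h, true_and, false_and, or_false]
    tauto
  · rw [epsFar]
    simp only [h, not_le.1 h, true_and, false_and, false_or]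

lemma epsStar_pos (hp : p.Valid) (h : 0 < p.am - p.an * p.epsf) : 0 < p.epsStar :=
  lt_max_of_lt_left (div_pos hp.epsf_pos h)

lemma epsFar_pos (hp : p.Valid) (h : 0 < p.am - p.an * p.epst) : 0 < p.epsFar :=
  div_pos hp.epst_pos h

end Params

namespace Network

variable {Ω : Type*} {N : Network Ω} {p : Params} [MeasurableSpace Ω] {μ : Measure Ω}
  [IsProbabilityMeasure μ]

/-- The gamma tail at the threshold is a finite sum of `(θ (noise + I))^k / k!` times `e^{-θ (noise
+ I)}`; the binomial theorem separates the noise from the moments of `I`. Nonnegativity of `covAt`,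
hidden by its signs and derivatives, is obtained from the same integral. -/
lemma lintegral_gainLaw_Ioi (hp : p.Valid) (hN : N.HasNetworkLaw p μ) (s : Link) {ε r : ℝ}
    (hε : 0 < ε) (hr : 0 < r) :
    0 ≤ p.covAt s ε r ∧
    ∫⁻ ω in N.weakerEvent p s r,
        p.gainLaw s (Ioi (ε / p.gainAt s r * ((N.total p ω).toReal + p.noise))) ∂μ =
      ENNReal.ofReal (p.absVoid s r * p.covAt s ε r) := by
  set θ := p.theta s ε r with hθdef
  have hg := Params.gainAt_pos hp s hr
  have hm := Params.m_pos hp s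
  have hσ := hp.noise_pos
  have hθ : 0 < θ := by rw [hθdef, Params.theta_eq s ε hr]; positivity
  let f : Ω → ℝ := fun ω => ∑ k ∈ Finset.range (p.m s), ∑ q ∈ Finset.range (k + 1),
    (k.choose q : ℝ) * (θ ^ k / k.factorial) * Real.exp (-θ * p.noise) * p.noise ^ q *
      ((N.total p ω).toReal ^ (k - q) * Real.exp (-(θ * (N.total p ω).toReal)))
  have hf0 : ∀ ω, 0 ≤ f ω := fun ω => by
    have : 0 ≤ (N.total p ω).toReal := ENNReal.toReal_nonneg
    exact Finset.sum_nonneg fun k _ => Finset.sum_nonneg fun q _ => by positivity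
  have hterm := fun k q : ℕ => integral_pow_mul_exp hp hN s hr hθ (k - q)
  have hfint : Integrable f (μ.restrict (N.weakerEvent p s r)) :=
    integrable_finsetSum _ fun k _ => integrable_finsetSum _ fun q _ => (hterm k q).1.const_mul _
  have hfval : ∫ ω in N.weakerEvent p s r, f ω ∂μ = p.absVoid s r * p.covAt s ε r := by
    simp only [f]
    rw [integral_finsetSum _ fun k _ => integrable_finsetSum _ fun q _ => (hterm k q).1.const_mul _]
    simp_rw [integral_finsetSum _ fun q _ => (hterm _ q).1.const_mul _, integral_const_mul,
      (hterm _ _).2]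
    rw [Params.covAt, Finset.mul_sum]
    refine Finset.sum_congr rfl fun k _ => ?_
    rw [Finset.mul_sum]
    refine Finset.sum_congr rfl fun q _ => ?_
    rw [hθdef]
    ring
  refine ⟨nonneg_of_mul_nonneg_right (hfval ▸ integral_nonneg hf0) (p.absVoid_pos s r), ?_⟩
  rw [← hfval, ofReal_integral_eq_lintegral_ofReal hfint (ae_of_all _ hf0)]
  refine lintegral_congr fun ω => ?_
  set I := (N.total p ω).toReal with hI
  have hI0 : 0 ≤ I := ENNReal.toReal_nonneg
  rw [Params.gainLaw, gammaMeasure_Ioi (hp.one_le_m s) hm (by positivity)]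
  congr 1
  have e : (p.m s : ℝ) * (ε / p.gainAt s r * (I + p.noise)) = θ * (p.noise + I) := by
    rw [hθdef, Params.theta_eq s ε hr]; ring
  rw [e, Finset.mul_sum]
  refine Finset.sum_congr rfl fun k _ => ?_
  rw [mul_pow, add_pow, mul_add, neg_add, Real.exp_add, Finset.mul_sum, Finset.sum_div,
    Finset.mul_sum]
  refine Finset.sum_congr rfl fun q _ => ?_
  rw [neg_mul]
  ring

/-- Coverage by an ABS in state `s` at distance `r`, averaged over its channel gain and over the
other ABSs, none of which is stronger. -/
lemma lintegral_coveredAt (hp : p.Valid) (hN : N.HasNetworkLaw p μ) (s : Link) {r : ℝ}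
    (hr : 0 < r) :
    0 ≤ p.covProb s r ∧
    ∫⁻ ω in N.weakerEvent p s r,
        p.gainLaw s {H | p.CoveredAt r (p.gainAt s r * H) (N.total p ω).toReal} ∂μ =
      ENNReal.ofReal (p.absVoid s r * p.covProb s r) := by
  have hg := Params.gainAt_pos hp s hr
  have hset : ∀ ω, p.gainLaw s {H | p.CoveredAt r (p.gainAt s r * H) (N.total p ω).toReal} =
      p.gainLaw s {H | if r ≤ p.Rf then
        (0 < p.am - p.an * p.epsf ∧ 0 < p.an - p.beta * p.am * p.epst) ∧
          p.epsStar / p.gainAt s r * ((N.total p ω).toReal + p.noise) < H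
        else 0 < p.am - p.an * p.epst ∧
          p.epsFar / p.gainAt s r * ((N.total p ω).toReal + p.noise) < H} := by
    intro ω
    refine measure_congr ?_
    filter_upwards [ae_nonneg_gammaMeasure (p.m s) (p.m s)] with H hH
    exact propext (Params.coveredAt_iff hp hg hH ENNReal.toReal_nonneg)
  simp_rw [hset]
  unfold Params.covProb Params.covNear Params.covFar
  split_ifs with h1 h2 h2
  · simp only [h2, true_and, and_self]
    exact lintegral_gainLaw_Ioi hp hN s (Params.epsStar_pos hp h2.1) hr
  · simp only [h2, false_and]
    simp
  · simp only [h2, true_and]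
    exact lintegral_gainLaw_Ioi hp hN s (Params.epsFar_pos hp h2) hr
  · simp only [h2, false_and]
    simp

/-- The case `t = 0` of `lintegral_best_total`, where the interference factor is 1. -/
lemma measure_weakerEvent (hp : p.Valid) (hN : N.HasNetworkLaw p μ) (s : Link) {r : ℝ}
    (hr : 0 < r) : μ (N.weakerEvent p s r) = ENNReal.ofReal (p.absVoid s r) := by
  have h := lintegral_best_total hp hN s hr le_rfl
  have h1 : p.laplaceIA s r 0 = 1 := by
    cases s <;> simp [Params.laplaceIA, Params.laplacePart]
  rw [h1, mul_one] at h
  rw [← h, ← lintegral_indicator_one (measurableSet_weakerEvent hN s r)]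
  refine lintegral_congr fun ω => ?_
  simp [weakerEvent, indicator_apply]

/-! ### The TBS tier -/

lemma measure_tbsPower_lt (hp : p.Valid) (hN : N.HasNetworkLaw p μ) (s : Link) {r : ℝ}
    (hr : p.h ≤ r) :
    μ {ω | ∀ k, N.tbsPower p k ω < p.avgPower s r} = ENNReal.ofReal (p.tbsVoid s r) := by
  have hr0 : 0 < r := hp.h_pos.trans_le hr
  have hpow := Params.avgPower_pos hp s hr0
  set ρ := p.tbsGuard s r with hρ
  have hρ0 : 0 ≤ ρ := by
    have := hp.RB_pos
    have h2 : 0 ≤ p.tauTL r := by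
      have := Params.eta_pos hp .LoS
      have := Params.etaT_pos hp
      unfold Params.tauTL; positivity
    cases s
    · exact le_min hp.RB_pos.le h2
    · exact hp.RB_pos.le
  -- The TBSs that would win lie in this disc. The origin is removed because `0 ^ (-α)` is 0 by
  -- convention, so a TBS there has power 0; a point has no area.
  set D : Set Plane := Metric.closedBall 0 ρ \ {0} with hD
  have hDm : MeasurableSet D := measurableSet_closedBall.diff (measurableSet_singleton _)
  have hmem : ∀ x : Plane, x ∈ D ↔ ¬ (if ‖x‖ ≤ p.RB then p.etaT * ‖x‖ ^ (-p.alphaT) else 0) <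
      p.avgPower s r := by
    intro x
    rw [hD, mem_sdiff, mem_closedBall_zero_iff, mem_singleton_iff]
    by_cases hx : x = 0
    · subst hx
      rw [norm_zero, if_pos hp.RB_pos.le, Real.zero_rpow (neg_ne_zero.2 hp.alphaT_pos.ne')]
      simpa using hpow
    · have hx0 : 0 < ‖x‖ := norm_pos_iff.2 hx
      split_ifs with hR
      · rw [not_lt]
        cases s
        · rw [Params.tbs_threshold_LoS hp hr0 hx0]
          simp only [hρ, Params.tbsGuard, le_min_iff, hR, hx, true_and, not_false_eq_true, and_true]
        · simp only [hρ, Params.tbsGuard, hR, hx, true_and, not_false_eq_true, true_iff]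
          exact Params.tbs_threshold_NLoS hp hr hx0 hR
      · have : ¬ ‖x‖ ≤ ρ := fun h => hR (h.trans (by
          cases s
          · exact min_le_left _ _
          · exact le_rfl))
        simp [this, hpow]
  have hvol : volume D = ENNReal.ofReal (Real.pi * ρ ^ 2) := by
    rw [hD, measure_sdiff_null (measure_singleton _), EuclideanSpace.volume_closedBall_fin_two,
      ← ENNReal.ofReal_pow hρ0, ← ENNReal.ofReal_mul (by positivity), mul_comm]
  have hcount := hN.tbs_hppp.count_eq (ι := Unit) (B := fun _ => D) (fun _ => hDm)
    (fun _ => hvol ▸ ENNReal.ofReal_lt_top) (fun i j h => absurd (Subsingleton.elim i j) h)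
    (fun _ => 0)
  have hset : {ω | ∀ k, N.tbsPower p k ω < p.avgPower s r} =
      {ω | ∀ _ : Unit, {i | N.tbs i ω ∈ D}.encard = ((0 : ℕ) : ℕ∞)} := by
    ext ω
    simp only [mem_ofPred_eq, forall_const, Nat.cast_zero, encard_eq_zero,
      eq_empty_iff_forall_notMem, hmem, not_not]
    rfl
  rw [hset, hcount]
  simp only [Finset.univ_unique, Finset.prod_const, Finset.card_singleton, pow_one]
  have hnn : 0 ≤ p.lamT * (Real.pi * ρ ^ 2) := by
    have := hp.lamT_pos
    positivity
  rw [poissonMeasure_singleton, hvol, ENNReal.toReal_ofReal (by positivity),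
    Real.coe_toNNReal _ hnn, Params.tbsVoid]
  congr 1
  simp only [pow_zero, Nat.factorial_zero, Nat.cast_one, div_one, mul_one]
  congr 1
  ring

end Network

lemma lintegral_comp_of_indepFun {Ω α β : Type*} [MeasurableSpace Ω] [MeasurableSpace α]
    [MeasurableSpace β] {μ : Measure Ω} [IsProbabilityMeasure μ] {T : Ω → α} {B : Ω → β}
    (hT : Measurable T) (hB : Measurable B) (hind : IndepFun T B μ) {G : α × β → ℝ≥0∞}
    (hG : Measurable G) :
    ∫⁻ ω, G (T ω, B ω) ∂μ = ∫⁻ ω, ∫⁻ ω', G (T ω', B ω) ∂μ ∂μ := by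
  have hPT : IsProbabilityMeasure (μ.map T) := Measure.isProbabilityMeasure_map hT.aemeasurable
  have hPB : IsProbabilityMeasure (μ.map B) := Measure.isProbabilityMeasure_map hB.aemeasurable
  have h1 := (indepFun_iff_map_prod_eq_prod_map_map hT.aemeasurable hB.aemeasurable).1 hind
  have h2 : ∫⁻ ω, G (T ω, B ω) ∂μ = ∫⁻ z, G z ∂(μ.map fun ω => (T ω, B ω)) :=
    (lintegral_map hG (hT.prodMk hB)).symm
  rw [h2, h1, lintegral_prod_symm _ hG.aemeasurable, lintegral_map hG.lintegral_prod_left' hB]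
  exact lintegral_congr fun ω => lintegral_map (hG.comp measurable_prodMk_right) hT

/-! ### Absence of ties and the almost sure form of the serving event -/

namespace Params

variable {p : Params}

lemma avgPower_injOn (hp : p.Valid) (s : Link) :
    InjOn (fun x => ENNReal.ofReal (p.avgPower s (Real.sqrt (x ^ 2 + p.h ^ 2)))) (Ioi 0) := by
  intro x hx y hy hxy
  have hx' : (0 : ℝ) < x := hx
  have hy' : (0 : ℝ) < y := hy
  have h1 := (ENNReal.ofReal_eq_ofReal_iff (avgPower_pos hp s (sqrt_add_pos hp.h_pos x)).le
    (avgPower_pos hp s (sqrt_add_pos hp.h_pos y)).le).1 hxy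
  have h2 := mul_left_cancel₀ (eta_pos hp s).ne' h1
  have h3 := (Real.rpow_left_inj (Real.sqrt_nonneg _) (Real.sqrt_nonneg _)
    (neg_ne_zero.2 (alpha_pos hp s).ne')).1 h2
  have h4 := (Real.sqrt_inj (by positivity) (by positivity)).1 h3
  nlinarith [sq_nonneg (x - y)]

/-- Ties of average powers have intensity zero. -/
lemma intensity_avgOf_eq (hp : p.Valid) (v : ℝ≥0∞) :
    ∫⁻ y, ({v} : Set ℝ≥0∞).indicator 1 (p.avgOf y) ∂intensity p.lamA p.markLaw = 0 := by
  have hm : Measurable (({v} : Set ℝ≥0∞).indicator (1 : ℝ≥0∞ → ℝ≥0∞)) :=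
    measurable_one.indicator (measurableSet_singleton v)
  have hm' : ∀ s, Measurable fun x : ℝ => ({v} : Set ℝ≥0∞).indicator (1 : ℝ≥0∞ → ℝ≥0∞)
      (ENNReal.ofReal (p.avgPower s (Real.sqrt (x ^ 2 + p.h ^ 2)))) := fun s =>
    hm.comp ((p.measurable_avgPower s).comp (by fun_prop)).ennreal_ofReal
  have h := lintegral_intensity_markLaw hp (φ := fun s x _ =>
    ({v} : Set ℝ≥0∞).indicator 1 (ENNReal.ofReal (p.avgPower s (Real.sqrt (x ^ 2 + p.h ^ 2)))))
    fun s => (hm' s).comp measurable_fst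
  refine h.trans (mul_eq_zero_of_right _ ?_)
  have hae : ∀ s, ∀ᵐ x ∂(volume.restrict (Ioi (0 : ℝ))), ({v} : Set ℝ≥0∞).indicator
      (1 : ℝ≥0∞ → ℝ≥0∞) (ENNReal.ofReal (p.avgPower s (Real.sqrt (x ^ 2 + p.h ^ 2)))) = 0 := by
    intro s
    have hsub : {x ∈ Ioi (0 : ℝ) |
        ENNReal.ofReal (p.avgPower s (Real.sqrt (x ^ 2 + p.h ^ 2))) = v}.Subsingleton :=
      fun x hx y hy => avgPower_injOn hp s hx.1 hy.1 (hx.2.trans hy.2.symm)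
    filter_upwards [ae_restrict_mem measurableSet_Ioi,
      ae_restrict_of_ae (measure_eq_zero_iff_ae_notMem.1 (hsub.measure_zero volume))]
      with x hx hx'
    exact indicator_of_notMem (s := {v}) (fun hv => hx' ⟨hx, hv⟩) _
  refine lintegral_eq_zero_of_ae_eq_zero ?_
  filter_upwards [hae .LoS, hae .NLoS] with x h1 h2
  simp [h1, h2]

end Params

namespace Network

variable {Ω : Type*} {N : Network Ω} {p : Params} [MeasurableSpace Ω] {μ : Measure Ω}
  [IsProbabilityMeasure μ]

/-- By the Mecke formula the mean number of ties is an integral over an added point whose power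
equals the maximum of an independent process. For a fixed value of the maximum such points have
intensity zero. -/
lemma ae_no_tie (hp : p.Valid) (hN : N.HasNetworkLaw p μ) :
    ∀ᵐ ω ∂μ, ∀ i, N.bestOther p i ω ≠ p.avgOf (N.point i ω) := by
  rw [ae_all_iff]
  intro i
  have hDm : MeasurableSet {z : (Plane × (ℝ × ℝ × ℝ)) × (ℝ≥0∞ × ℝ≥0∞) | p.avgOf z.1 = z.2.1} :=
    measurableSet_eq_fun (p.measurable_avgOf.comp measurable_fst) (by fun_prop)
  have h := mecke hp hN (measurable_one.indicator hDm : Measurable (indicator _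
    (1 : (Plane × (ℝ × ℝ × ℝ)) × (ℝ≥0∞ × ℝ≥0∞) → ℝ≥0∞)))
  have hzero : ∫⁻ y, ∫⁻ ω, {z : (Plane × (ℝ × ℝ × ℝ)) × (ℝ≥0∞ × ℝ≥0∞) | p.avgOf z.1 = z.2.1}.indicator
      (1 : (Plane × (ℝ × ℝ × ℝ)) × (ℝ≥0∞ × ℝ≥0∞) → ℝ≥0∞) (y, N.best p ω, N.total p ω) ∂μ
      ∂intensity p.lamA p.markLaw = 0 := by
    have := Params.isProbabilityMeasure_markLaw hp
    rw [lintegral_lintegral_swap]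
    · rw [lintegral_eq_zero_of_ae_eq_zero]
      refine ae_of_all _ fun ω => ?_
      refine Eq.trans (lintegral_congr fun y => ?_) (Params.intensity_avgOf_eq hp (N.best p ω))
      simp [indicator_apply]
    · exact ((measurable_one.indicator hDm).comp (measurable_fst.prodMk
        (((measurable_best hN).comp measurable_snd).prodMk
          ((measurable_total hN).comp measurable_snd)))).aemeasurable
  rw [hzero, ENNReal.tsum_eq_zero] at h
  have hWm : Measurable fun ω => (N.point i ω, N.bestOther p i ω, N.totalOther p i ω) :=
    (measurable_point hN i).prodMk ((measurable_bestOther hN i).prodMk (measurable_totalOther hN i))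
  have hi := (lintegral_eq_zero_iff ((measurable_one.indicator hDm).comp hWm)).1 (h i)
  filter_upwards [hi] with ω hω heq
  simp only [Function.comp, Pi.zero_apply, indicator_apply, mem_ofPred_eq, heq, if_true,
    Pi.one_apply] at hω
  exact one_ne_zero hω

lemma ae_gain_nonneg (hp : p.Valid) (hN : N.HasNetworkLaw p μ) :
    ∀ᵐ ω ∂μ, ∀ i s, 0 ≤ Params.gain s (N.marks i ω) := by
  rw [ae_all_iff]
  intro i
  have i1 := Params.isProbabilityMeasure_gainLaw hp .LoS
  have i2 := Params.isProbabilityMeasure_gainLaw hp .NLoS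
  have h1 : ∀ᵐ k ∂(p.gainLaw .LoS).prod (p.gainLaw .NLoS), 0 ≤ k.1 :=
    Measure.quasiMeasurePreserving_fst.ae (ae_nonneg_gammaMeasure _ _)
  have h2 : ∀ᵐ k ∂(p.gainLaw .LoS).prod (p.gainLaw .NLoS), 0 ≤ k.2 :=
    Measure.quasiMeasurePreserving_snd.ae (ae_nonneg_gammaMeasure _ _)
  have h3 : ∀ᵐ k ∂p.markLaw, 0 ≤ k.2.1 ∧ 0 ≤ k.2.2 :=
    Measure.quasiMeasurePreserving_snd.ae (h1.and h2)
  have h4 : ∀ᵐ k ∂(μ.map (N.marks i)), 0 ≤ k.2.1 ∧ 0 ≤ k.2.2 := by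
    rw [hN.marks_law i]; exact h3
  filter_upwards [ae_of_ae_map (hN.marks_measurable i).aemeasurable h4] with ω hω s
  cases s
  · exact hω.1
  · exact hω.2

lemma state_eq (i : ℕ) (ω : Ω) : N.state p i ω = p.linkState (N.point i ω).1 (N.point i ω).2 := rfl

lemma fading_eq (s : Link) (i : ℕ) (ω : Ω) : N.fading s i ω = Params.gain s (N.marks i ω) := by
  cases s <;> rfl

lemma rxPower_eq (i : ℕ) (ω : Ω) :
    N.rxPower p i ω = p.rxGain (N.state p i ω) ‖N.aerial i ω‖ *
      Params.gain (N.state p i ω) (N.marks i ω) := by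
  rw [rxPower, fading_eq]; rfl

lemma rxPower_eq_gainAt (i : ℕ) (ω : Ω) :
    N.rxPower p i ω = p.gainAt (N.state p i ω) (N.dist p i ω) *
      Params.gain (N.state p i ω) (N.marks i ω) := by
  rw [rxPower, fading_eq]; rfl

lemma ofReal_absPower (i : ℕ) (ω : Ω) :
    ENNReal.ofReal (N.absPower p i ω) = p.avgOf (N.point i ω) := rfl

lemma absPower_pos (hp : p.Valid) (i : ℕ) (ω : Ω) : 0 < N.absPower p i ω :=
  Params.avgPower_pos hp _ (Params.sqrt_add_pos hp.h_pos _)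

lemma serves_unique {i j : ℕ} {ω : Ω} (hi : N.Serves p i ω) (hj : N.Serves p j ω) : i = j := by
  by_contra h
  exact lt_asymm (hi.1 j (Ne.symm h)) (hj.1 i h)

/-- A supremum of strictly smaller powers may still equal the bound; conversely a weak bound by the
supremum becomes strict once a tie is excluded. So, off the null set of ties, strict comparisons
with all ABSs become one weak comparison. -/
lemma serves_iff (hp : p.Valid) {i : ℕ} {ω : Ω} (h : N.bestOther p i ω ≠ p.avgOf (N.point i ω)) :
    N.Serves p i ω ↔ N.bestOther p i ω ≤ p.avgOf (N.point i ω) ∧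
      ∀ k, N.tbsPower p k ω < N.absPower p i ω := by
  refine and_congr_left fun _ => ⟨fun hi => ?_, fun hi j hj => ?_⟩
  · refine iSup_le fun j => ?_
    unfold omitAt
    split_ifs with hj
    · exact zero_le
    · exact ENNReal.ofReal_le_ofReal (hi j hj).le
  · have h1 : p.avgOf (N.point j ω) ≤ N.bestOther p i ω := by
      refine le_trans ?_ (le_iSup _ j)
      simp [omitAt, hj]
    have h2 := h1.trans_lt (lt_of_le_of_ne hi h)
    rw [← ofReal_absPower, ← ofReal_absPower,
      ENNReal.ofReal_lt_ofReal_iff (absPower_pos hp i ω)] at h2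
    exact h2

lemma interference_eq (hp : p.Valid) {ω : Ω} (h : ∀ i s, 0 ≤ Params.gain s (N.marks i ω))
    (i : ℕ) : N.interference p i ω = (N.totalOther p i ω).toReal := by
  unfold interference totalOther
  -- This identity needs only finite terms: if the series diverges, both sides are 0 by convention.
  rw [ENNReal.tsum_toReal_eq]
  · refine tsum_congr fun j => ?_
    unfold omitAt
    split_ifs
    · simp
    · rw [rxPower_eq]
      exact (ENNReal.toReal_ofReal (mul_nonneg (Params.rxGain_pos hp _ _).le (h j _))).symm
  · intro j
    unfold omitAt
    split_ifs
    · simp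
    · exact ENNReal.ofReal_ne_top

lemma measurable_tbsPower (hN : N.HasNetworkLaw p μ) (k : ℕ) : Measurable (N.tbsPower p k) := by
  have := hN.tbs_hppp.measurable k
  unfold tbsPower
  exact Measurable.ite (measurableSet_le this.norm measurable_const)
    ((this.norm.pow_const _).const_mul _) measurable_const

end Network

lemma measurableSet_forall_lt {α : Type*} [MeasurableSpace α] {f : ℕ → α → ℝ} {g : α → ℝ}
    (hf : ∀ k, Measurable (f k)) (hg : Measurable g) : MeasurableSet {x | ∀ k, f k x < g x} := by
  rw [ofPred_forall]
  exact MeasurableSet.iInter fun k => measurableSet_lt (hf k) hg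

/-! ### The probability of being served under a condition on distance, signal and interference -/

namespace Params

variable (p : Params)

/-- Distance between the user and an ABS at horizontal distance `x`. -/
noncomputable def slant (x : ℝ) : ℝ := Real.sqrt (x ^ 2 + p.h ^ 2)

/-- Average power received from a TBS at position `x`. -/
noncomputable def tbsAvg (x : Plane) : ℝ :=
  if ‖x‖ ≤ p.RB then p.etaT * ‖x‖ ^ (-p.alphaT) else 0

lemma measurable_slant : Measurable p.slant := by unfold slant; fun_prop

lemma measurable_tbsAvg : Measurable p.tbsAvg := by
  unfold tbsAvg
  exact Measurable.ite (measurableSet_le measurable_norm measurable_const)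
    ((measurable_norm.pow_const _).const_mul _) measurable_const

lemma measurable_gainAt (s : Link) : Measurable (p.gainAt s) := by unfold gainAt; fun_prop

lemma measurable_tbsVoid (s : Link) : Measurable (p.tbsVoid s) := by
  have : Measurable (p.tbsGuard s) := by
    cases s
    · change Measurable fun r => min p.RB (p.tauTL r)
      unfold tauTL
      fun_prop
    · exact measurable_const
  unfold tbsVoid
  fun_prop

variable {p}

lemma h_le_slant (x : ℝ) : p.h ≤ p.slant x :=
  Real.le_sqrt_of_sq_le (by nlinarith [sq_nonneg x])

lemma slant_sqrt (hp : p.Valid) {r : ℝ} (hr : p.h ≤ r) :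
    p.slant (Real.sqrt (r ^ 2 - p.h ^ 2)) = r := by
  have := hp.h_pos
  rw [slant, Real.sq_sqrt (by nlinarith), sub_add_cancel, Real.sqrt_sq (by linarith)]

lemma measurableSet_linkState (s : Link) :
    MeasurableSet {y : Plane × (ℝ × ℝ × ℝ) | p.linkState y.1 y.2 = s} := by
  have h := measurable_ite_linkState (p := p)
    (φ := fun s' _ => ({s} : Set Link).indicator 1 s') (fun _ => measurable_const)
  convert h (measurableSet_singleton 1) using 1
  ext y
  by_cases hy : p.linkState y.1 y.2 = s <;> simp [hy]

variable (p)

/-- The configurations `((x, H), (v, I))` in which an ABS at horizontal distance `x` in state `s`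
with gain `H` is at least as strong as the strongest other ABS, of average power `v`, and satisfies
the condition `C` when the others produce the interference `I`. -/
def admissible (C : ℝ → ℝ → ℝ → Prop) (s : Link) : Set ((ℝ × ℝ) × (ℝ≥0∞ × ℝ≥0∞)) :=
  {z | z.2.1 ≤ ENNReal.ofReal (p.avgPower s (p.slant z.1.1)) ∧
    C (p.slant z.1.1) (p.gainAt s (p.slant z.1.1) * z.1.2) z.2.2.toReal}

/-- `admissible`, in terms of the position and the marks of the ABS. -/
def admissiblePoint (C : ℝ → ℝ → ℝ → Prop) (s : Link) :
    Set ((Plane × (ℝ × ℝ × ℝ)) × (ℝ≥0∞ × ℝ≥0∞)) :=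
  {z | p.linkState z.1.1 z.1.2 = s ∧ ((‖z.1.1‖, gain s z.1.2), z.2) ∈ p.admissible C s}

lemma measurableSet_admissible {C : ℝ → ℝ → ℝ → Prop}
    (hC : MeasurableSet {z : ℝ × ℝ × ℝ | C z.1 z.2.1 z.2.2}) (s : Link) :
    MeasurableSet (p.admissible C s) := by
  have h1 : Measurable fun z : (ℝ × ℝ) × (ℝ≥0∞ × ℝ≥0∞) => p.slant z.1.1 :=
    p.measurable_slant.comp (by fun_prop)
  refine (measurableSet_le (by fun_prop) ((p.measurable_avgPower s).comp h1).ennreal_ofReal).inter ?_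
  exact (h1.prodMk ((((p.measurable_gainAt s).comp h1).mul (by fun_prop)).prodMk
    (measurable_snd.snd.ennreal_toReal))) hC

lemma measurableSet_admissiblePoint {C : ℝ → ℝ → ℝ → Prop}
    (hC : MeasurableSet {z : ℝ × ℝ × ℝ | C z.1 z.2.1 z.2.2}) (s : Link) :
    MeasurableSet (p.admissiblePoint C s) :=
  ((measurableSet_linkState s).preimage measurable_fst).inter
    (((measurable_fst.fst.norm.prodMk ((measurable_gain s).comp measurable_fst.snd)).prodMk
      measurable_snd) (p.measurableSet_admissible hC s))

end Params

namespace Network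

variable {Ω : Type*} (N : Network Ω) (p : Params)

/-- The `i`-th ABS is in state `s`, is at least as strong as every other ABS and stronger than every
TBS, and satisfies the condition `C`. -/
def servingEvent (C : ℝ → ℝ → ℝ → Prop) (s : Link) (i : ℕ) : Set Ω :=
  {ω | (N.point i ω, N.bestOther p i ω, N.totalOther p i ω) ∈ p.admissiblePoint C s ∧
    ∀ k, p.tbsAvg (N.tbs k ω) < p.avgPower s (p.slant ‖(N.point i ω).1‖)}

variable {N p} [MeasurableSpace Ω] {μ : Measure Ω} [IsProbabilityMeasure μ]

lemma measurableSet_servingEvent (hN : N.HasNetworkLaw p μ) {C : ℝ → ℝ → ℝ → Prop}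
    (hC : MeasurableSet {z : ℝ × ℝ × ℝ | C z.1 z.2.1 z.2.2}) (s : Link) (i : ℕ) :
    MeasurableSet (N.servingEvent p C s i) := by
  refine (((measurable_point hN i).prodMk ((measurable_bestOther hN i).prodMk
    (measurable_totalOther hN i))) (p.measurableSet_admissiblePoint hC s)).inter ?_
  exact measurableSet_forall_lt (fun k => p.measurable_tbsAvg.comp (hN.tbs_hppp.measurable k))
    ((p.measurable_avgPower s).comp (p.measurable_slant.comp (measurable_point hN i).fst.norm))

/-- The TBS tier can be integrated out of the probability of a serving event. -/
lemma measure_servingEvent (hp : p.Valid) (hN : N.HasNetworkLaw p μ) {C : ℝ → ℝ → ℝ → Prop}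
    (hC : MeasurableSet {z : ℝ × ℝ × ℝ | C z.1 z.2.1 z.2.2}) (s : Link) (i : ℕ) :
    μ (N.servingEvent p C s i) =
      ∫⁻ ω, (p.admissiblePoint C s).indicator (fun z =>
        ENNReal.ofReal (p.tbsVoid s (p.slant ‖z.1.1‖)))
          (N.point i ω, N.bestOther p i ω, N.totalOther p i ω) ∂μ := by
  classical
  have hE := p.measurableSet_admissiblePoint hC s
  obtain ⟨D, hDmem⟩ : ∃ D : Set ((ℕ → Plane) × ((Plane × (ℝ × ℝ × ℝ)) × (ℝ≥0∞ × ℝ≥0∞))),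
      ∀ z, z ∈ D ↔ z.2 ∈ p.admissiblePoint C s ∧
        ∀ k, p.tbsAvg (z.1 k) < p.avgPower s (p.slant ‖z.2.1.1‖) := ⟨{z | _}, fun _ => Iff.rfl⟩
  have hD : MeasurableSet D := by
    rw [show D = {z | _} from Set.ext hDmem]
    refine (hE.preimage measurable_snd).inter ?_
    exact measurableSet_forall_lt (fun k => p.measurable_tbsAvg.comp
      ((measurable_pi_apply k).comp measurable_fst))
      ((p.measurable_avgPower s).comp (p.measurable_slant.comp measurable_snd.fst.fst.norm))
  have hT : Measurable fun ω => fun k => N.tbs k ω :=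
    measurable_pi_lambda _ fun k => hN.tbs_hppp.measurable k
  have hB : Measurable fun ω => (N.point i ω, N.bestOther p i ω, N.totalOther p i ω) :=
    (measurable_point hN i).prodMk ((measurable_bestOther hN i).prodMk (measurable_totalOther hN i))
  have hpt : ∀ j, Measurable fun z : (ℕ → Plane) × (ℕ → ℝ × ℝ × ℝ) => (z.1 j, z.2 j) :=
    fun j => ((measurable_pi_apply j).comp measurable_fst).prodMk
      ((measurable_pi_apply j).comp measurable_snd)
  have hg : Measurable fun z : (ℕ → Plane) × (ℕ → ℝ × ℝ × ℝ) =>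
      ((z.1 i, z.2 i), (⨆ j, omitAt i (fun j => p.avgOf (z.1 j, z.2 j)) j),
        ∑' j, omitAt i (fun j => p.rxOf (z.1 j, z.2 j)) j) :=
    (hpt i).prodMk ((Measurable.iSup fun j =>
      measurable_omitAt (fun j => p.measurable_avgOf.comp (hpt j)) i j).prodMk
      (Measurable.tsum fun j => measurable_omitAt (fun j => p.measurable_rxOf.comp (hpt j)) i j))
  have hind : IndepFun (fun ω k => N.tbs k ω)
      (fun ω => (N.point i ω, N.bestOther p i ω, N.totalOther p i ω)) μ :=
    hN.tbs_indep.comp measurable_id hg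
  have h := lintegral_comp_of_indepFun hT hB hind
    (measurable_const.indicator hD : Measurable (D.indicator (fun _ => (1 : ℝ≥0∞))))
  rw [← lintegral_indicator_one (measurableSet_servingEvent hN hC s i)]
  refine Eq.trans (lintegral_congr fun ω => ?_) (h.trans (lintegral_congr fun ω => ?_))
  · simp only [indicator_apply, hDmem, servingEvent, mem_ofPred_eq, Pi.one_apply]
  · by_cases hω : (N.point i ω, N.bestOther p i ω, N.totalOther p i ω) ∈ p.admissiblePoint C s
    -- With the ABS tier frozen, the inner integral is the probability that no independent TBS
    -- reaches the power of the server.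
    · rw [indicator_of_mem hω, ← measure_tbsPower_lt hp hN s (Params.h_le_slant _),
        ← lintegral_indicator_one]
      · refine lintegral_congr fun ω' => ?_
        have e : ∀ k, N.tbsPower p k ω' = p.tbsAvg (N.tbs k ω') := fun k => rfl
        simp only [indicator_apply, hDmem, hω, true_and, e, mem_ofPred_eq, Pi.one_apply]
      · exact measurableSet_forall_lt (measurable_tbsPower hN) measurable_const
    · rw [indicator_of_notMem hω]
      refine lintegral_eq_zero_of_ae_eq_zero (ae_of_all _ fun ω' => ?_)
      simp only [indicator_apply, hDmem, hω, false_and, if_false, Pi.zero_apply]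

/-- Probability, over the gain and the other ABSs, that a given ABS at horizontal distance `x` is
admissible. -/
lemma lintegral_admissible (hN : N.HasNetworkLaw p μ) {C : ℝ → ℝ → ℝ → Prop}
    (hC : MeasurableSet {z : ℝ × ℝ × ℝ | C z.1 z.2.1 z.2.2}) (s : Link) {x r : ℝ}
    (hx : p.slant x = r) [SFinite (p.gainLaw s)] :
    ∫⁻ H, ∫⁻ ω, (p.admissible C s).indicator (fun _ => (1 : ℝ≥0∞))
        ((x, H), N.best p ω, N.total p ω) ∂μ ∂p.gainLaw s =
      ∫⁻ ω in N.weakerEvent p s r,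
        p.gainLaw s {H | C r (p.gainAt s r * H) (N.total p ω).toReal} ∂μ := by
  classical
  have hAω : Measurable fun z : ℝ × Ω =>
      (p.admissible C s).indicator (fun _ => (1 : ℝ≥0∞)) ((x, z.1), N.best p z.2, N.total p z.2) :=
    (measurable_const.indicator (p.measurableSet_admissible hC s)).comp
      ((measurable_const.prodMk measurable_fst).prodMk
        (((measurable_best hN).comp measurable_snd).prodMk
          ((measurable_total hN).comp measurable_snd)))
  rw [lintegral_lintegral_swap hAω.aemeasurable,
    ← lintegral_indicator (measurableSet_weakerEvent hN s r)]
  refine lintegral_congr fun ω => ?_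
  by_cases hω : ω ∈ N.weakerEvent p s r
  · rw [indicator_of_mem hω, ← lintegral_indicator_one]
    · refine lintegral_congr fun H => ?_
      have : N.best p ω ≤ ENNReal.ofReal (p.avgPower s r) := hω
      simp only [indicator_apply, Params.admissible, mem_ofPred_eq, hx, this, true_and, Pi.one_apply]
    · exact (measurable_const.prodMk ((measurable_id.const_mul _).prodMk measurable_const)) hC
  · rw [indicator_of_notMem hω]
    refine lintegral_eq_zero_of_ae_eq_zero (ae_of_all _ fun H => ?_)
    have : ¬ N.best p ω ≤ ENNReal.ofReal (p.avgPower s r) := hω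
    simp only [indicator_apply, Params.admissible, mem_ofPred_eq, hx, this, false_and, if_false,
      Pi.zero_apply]

/-- The Mecke formula replaces the sum over servers by an integral over an added server facing the
whole ABS process; polar coordinates and the change to the true distance then leave one integral
over `r`. -/
lemma tsum_measure_servingEvent (hp : p.Valid) (hN : N.HasNetworkLaw p μ) {C : ℝ → ℝ → ℝ → Prop}
    (hC : MeasurableSet {z : ℝ × ℝ × ℝ | C z.1 z.2.1 z.2.2}) (s : Link) :
    ∑' i, μ (N.servingEvent p C s i) =
      ENNReal.ofReal (2 * Real.pi * p.lamA) * ∫⁻ r in Ioi p.h, ENNReal.ofReal r *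
        (ENNReal.ofReal (p.linkProb s (Real.sqrt (r ^ 2 - p.h ^ 2))) *
          (ENNReal.ofReal (p.tbsVoid s r) * ∫⁻ ω in N.weakerEvent p s r,
            p.gainLaw s {H | C r (p.gainAt s r * H) (N.total p ω).toReal} ∂μ)) := by
  classical
  have i1 := fun s => Params.isProbabilityMeasure_gainLaw hp s
  have hA := p.measurableSet_admissible hC s
  have hE := p.measurableSet_admissiblePoint hC s
  have hv : Measurable fun z : (Plane × (ℝ × ℝ × ℝ)) × (ℝ≥0∞ × ℝ≥0∞) =>
      ENNReal.ofReal (p.tbsVoid s (p.slant ‖z.1.1‖)) :=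
    ((p.measurable_tbsVoid s).comp (p.measurable_slant.comp measurable_fst.fst.norm)).ennreal_ofReal
  have hAω : Measurable fun z : (ℝ × ℝ) × Ω =>
      (p.admissible C s).indicator (fun _ => (1 : ℝ≥0∞)) (z.1, N.best p z.2, N.total p z.2) :=
    (measurable_const.indicator hA).comp (measurable_fst.prodMk
      (((measurable_best hN).comp measurable_snd).prodMk
        ((measurable_total hN).comp measurable_snd)))
  have hAz : ∀ z : ℝ × ℝ, Measurable fun ω =>
      (p.admissible C s).indicator (fun _ => (1 : ℝ≥0∞)) (z, N.best p ω, N.total p ω) :=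
    fun z => (measurable_const.indicator hA).comp
      (measurable_const.prodMk ((measurable_best hN).prodMk (measurable_total hN)))
  obtain ⟨W, hWm, hW⟩ : ∃ W : ℝ × ℝ → ℝ≥0∞, Measurable W ∧ ∀ z, W z =
      ∫⁻ ω, (p.admissible C s).indicator (fun _ => (1 : ℝ≥0∞)) (z, N.best p ω, N.total p ω) ∂μ :=
    ⟨fun z => ∫⁻ ω, (p.admissible C s).indicator (fun _ => (1 : ℝ≥0∞))
      (z, N.best p ω, N.total p ω) ∂μ, hAω.lintegral_prod_right', fun _ => rfl⟩
  obtain ⟨J, hJ, hJdef⟩ : ∃ J : ℝ × ℝ → ℝ≥0∞, Measurable J ∧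
      ∀ z, J z = ENNReal.ofReal (p.tbsVoid s (p.slant z.1)) * W z :=
    ⟨fun z => ENNReal.ofReal (p.tbsVoid s (p.slant z.1)) * W z, ((p.measurable_tbsVoid s).comp
      (p.measurable_slant.comp measurable_fst)).ennreal_ofReal.mul hWm, fun _ => rfl⟩
  have hφ : ∀ s', Measurable (Function.uncurry fun x H => if s' = s then J (x, H) else 0) := by
    intro s'
    by_cases hs : s' = s
    · simp only [hs, if_true]
      exact hJ
    · simp only [hs, if_false]
      exact measurable_const
  have hleft : ∀ y : Plane × (ℝ × ℝ × ℝ), ∫⁻ ω, (p.admissiblePoint C s).indicator (fun z =>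
        ENNReal.ofReal (p.tbsVoid s (p.slant ‖z.1.1‖))) (y, N.best p ω, N.total p ω) ∂μ =
      if p.linkState y.1 y.2 = s then J (‖y.1‖, Params.gain (p.linkState y.1 y.2) y.2) else 0 := by
    intro y
    split_ifs with hs
    · rw [hs, hJdef, hW, ← lintegral_const_mul _ (hAz _)]
      refine lintegral_congr fun ω => ?_
      simp only [indicator_apply, Params.admissiblePoint, mem_ofPred_eq, hs, true_and,
        mul_ite, mul_one, mul_zero]
    · refine lintegral_eq_zero_of_ae_eq_zero (ae_of_all _ fun ω => ?_)
      simp only [indicator_apply, Params.admissiblePoint, mem_ofPred_eq, hs, false_and, if_false,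
        Pi.zero_apply]
  have hsum : ∀ t, ENNReal.ofReal (p.linkProb .LoS t) *
        ∫⁻ H, (if Link.LoS = s then J (t, H) else 0) ∂p.gainLaw .LoS +
      ENNReal.ofReal (p.linkProb .NLoS t) *
        ∫⁻ H, (if Link.NLoS = s then J (t, H) else 0) ∂p.gainLaw .NLoS =
      ENNReal.ofReal (p.linkProb s t) * ∫⁻ H, J (t, H) ∂p.gainLaw s := by
    intro t
    cases s <;> simp
  have hJint : ∀ r ∈ Ioi p.h, ∫⁻ H, J (Real.sqrt (r ^ 2 - p.h ^ 2), H) ∂p.gainLaw s =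
      ENNReal.ofReal (p.tbsVoid s r) * ∫⁻ ω in N.weakerEvent p s r,
        p.gainLaw s {H | C r (p.gainAt s r * H) (N.total p ω).toReal} ∂μ := by
    intro r hr
    have hr' := Params.slant_sqrt hp (le_of_lt hr)
    rw [← lintegral_admissible hN hC s hr']
    simp_rw [hJdef, hW, hr']
    refine lintegral_const_mul _ ?_
    simp_rw [← hW]
    exact hWm.comp measurable_prodMk_left
  calc ∑' i, μ (N.servingEvent p C s i)
      = ∫⁻ y, ∫⁻ ω, (p.admissiblePoint C s).indicator (fun z =>
        ENNReal.ofReal (p.tbsVoid s (p.slant ‖z.1.1‖))) (y, N.best p ω, N.total p ω) ∂μ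
          ∂intensity p.lamA p.markLaw := by
        rw [← mecke hp hN (hv.indicator hE)]
        exact tsum_congr fun i => measure_servingEvent hp hN hC s i
    _ = ENNReal.ofReal (2 * Real.pi * p.lamA) * ∫⁻ t in Ioi 0, ENNReal.ofReal t *
        (ENNReal.ofReal (p.linkProb s t) * ∫⁻ H, J (t, H) ∂p.gainLaw s) := by
        rw [lintegral_congr hleft]
        refine (Params.lintegral_intensity_markLaw hp hφ).trans ?_
        congr 1
        exact lintegral_congr fun t => by rw [hsum]
    _ = _ := by
        rw [lintegral_sqrt_sq_add_sq hp.h_pos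
          (fun t => ENNReal.ofReal (p.linkProb s t) * ∫⁻ H, J (t, H) ∂p.gainLaw s)]
        congr 1
        refine setLIntegral_congr_fun measurableSet_Ioi fun r hr => ?_
        simp only [hJint r hr]

lemma ae_servingEvent_iff (hp : p.Valid) (hN : N.HasNetworkLaw p μ) (C : ℝ → ℝ → ℝ → Prop)
    (s : Link) :
    ∀ᵐ ω ∂μ, ∀ i, (N.Serves p i ω ∧ N.state p i ω = s ∧
      C (N.dist p i ω) (N.rxPower p i ω) (N.interference p i ω)) ↔
        ω ∈ N.servingEvent p C s i := by
  filter_upwards [ae_no_tie hp hN, ae_gain_nonneg hp hN] with ω h1 h2 i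
  rw [serves_iff hp (h1 i), interference_eq hp h2, rxPower_eq_gainAt]
  unfold servingEvent Params.admissiblePoint
  simp only [mem_ofPred_eq]
  rw [state_eq]
  by_cases hs : p.linkState (N.point i ω).1 (N.point i ω).2 = s
  · have e1 : p.avgOf (N.point i ω) = ENNReal.ofReal (p.avgPower s (p.slant ‖(N.point i ω).1‖)) := by
      rw [Params.avgOf, hs]; rfl
    have e2 : N.absPower p i ω = p.avgPower s (p.slant ‖(N.point i ω).1‖) := by
      rw [absPower, state_eq, hs]; rfl
    rw [hs, e1, e2]
    have e3 : N.dist p i ω = p.slant ‖(N.point i ω).1‖ := rfl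
    have e4 : N.marks i ω = (N.point i ω).2 := rfl
    have e5 : ∀ k, N.tbsPower p k ω = p.tbsAvg (N.tbs k ω) := fun k => rfl
    simp only [Params.admissible, mem_ofPred_eq, e3, e4, e5]
    tauto
  · simp only [hs, false_and, and_false]

/-- Probability that the user is served by an ABS in state `s` which satisfies the condition `C`. -/
lemma measure_exists_serves (hp : p.Valid) (hN : N.HasNetworkLaw p μ) {C : ℝ → ℝ → ℝ → Prop}
    (hC : MeasurableSet {z : ℝ × ℝ × ℝ | C z.1 z.2.1 z.2.2}) (s : Link) :
    μ {ω | ∃ i, N.Serves p i ω ∧ N.state p i ω = s ∧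
        C (N.dist p i ω) (N.rxPower p i ω) (N.interference p i ω)} =
      ENNReal.ofReal (2 * Real.pi * p.lamA) * ∫⁻ r in Ioi p.h, ENNReal.ofReal r *
        (ENNReal.ofReal (p.linkProb s (Real.sqrt (r ^ 2 - p.h ^ 2))) *
          (ENNReal.ofReal (p.tbsVoid s r) * ∫⁻ ω in N.weakerEvent p s r,
            p.gainLaw s {H | C r (p.gainAt s r * H) (N.total p ω).toReal} ∂μ)) := by
  have hae : {ω | ∃ i, N.Serves p i ω ∧ N.state p i ω = s ∧
      C (N.dist p i ω) (N.rxPower p i ω) (N.interference p i ω)} =ᵐ[μ]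
      ⋃ i, N.servingEvent p C s i := by
    filter_upwards [ae_servingEvent_iff hp hN C s] with ω hω
    refine propext ?_
    change (∃ i, _) ↔ ω ∈ ⋃ i, N.servingEvent p C s i
    rw [mem_iUnion]
    exact exists_congr hω
  -- At most one ABS serves, so the serving events are disjoint up to a null set and the probability
  -- of their union is the Mecke sum.
  have hm := fun i => measurableSet_servingEvent hN hC s i
  rw [measure_congr hae, ← tsum_measure_servingEvent hp hN hC s,
    measure_iUnion₀ (fun i j hij => ?_) fun i => (hm i).nullMeasurableSet]
  rw [Function.onFun, AEDisjoint]
  refine measure_mono_null (t := {ω | ¬ ∀ i, (N.Serves p i ω ∧ N.state p i ω = s ∧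
      C (N.dist p i ω) (N.rxPower p i ω) (N.interference p i ω)) ↔
        ω ∈ N.servingEvent p C s i}) (fun ω hω hall => ?_)
    (ae_iff.1 (ae_servingEvent_iff hp hN C s))
  exact hij (serves_unique ((hall i).2 hω.1).1 ((hall j).2 hω.2).1)

end Network

namespace Params

variable (p : Params)

/-! ### The density of the serving distance -/

/-- Density, on `(h, ∞)`, of the serving distance on the event of association with an ABS in
state `s`. -/
noncomputable def servingDensity (s : Link) (r : ℝ) : ℝ :=
  2 * Real.pi * p.lamA * r * p.linkProb s (Real.sqrt (r ^ 2 - p.h ^ 2)) *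
    (p.tbsVoid s r * p.absVoid s r)

lemma measurable_guard (s₀ s : Link) : Measurable fun r => p.guard s₀ r s := by
  have h1 : Measurable p.tauLN := by unfold tauLN; fun_prop
  have h2 : Measurable p.tauNL := by
    unfold tauNL
    exact Measurable.ite measurableSet_Iic measurable_const (by fun_prop)
  cases s₀ <;> cases s <;> simp only [guard] <;> fun_prop

variable {p}

lemma measurable_absVoid (hp : p.Valid) (s : Link) : Measurable (p.absVoid s) := by
  have h : ∀ s', Measurable fun r =>
      ∫ x in (0 : ℝ)..p.guard s r s', x * p.linkProb s' x := fun s' =>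
    (intervalIntegral.continuous_primitive (intervalIntegrable_mul_linkProb hp s')
      0).measurable.comp (p.measurable_guard s s')
  unfold absVoid
  exact ((h _).const_mul _).exp.mul ((h _).const_mul _).exp

lemma measurable_servingDensity (hp : p.Valid) (s : Link) : Measurable (p.servingDensity s) := by
  have h1 := (p.measurable_linkProb s).comp
    (by fun_prop : Measurable fun r : ℝ => Real.sqrt (r ^ 2 - p.h ^ 2))
  exact ((measurable_id.const_mul _).mul h1).mul ((p.measurable_tbsVoid s).mul
    (measurable_absVoid hp s))

lemma servingDensity_pos (hp : p.Valid) (s : Link) {r : ℝ} (hr : 0 < r) :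
    0 < p.servingDensity s r := by
  have h1 := hp.lamA_pos
  have h2 := linkProb_pos hp s (Real.sqrt (r ^ 2 - p.h ^ 2))
  have h3 := p.absVoid_pos s r
  have h4 : 0 < p.tbsVoid s r := Real.exp_pos _
  unfold servingDensity
  positivity

lemma servingPDFN_eq (AN r : ℝ) : p.servingPDFN AN r = p.servingDensity .NLoS r / AN := by
  have h : 1 - p.QT = p.tbsVoid .NLoS r := sub_sub_cancel _ _
  rw [servingPDFN, h]
  simp only [servingDensity, nearestPDF, voidProb, absVoid, guard]
  ring

variable (p) in
/-- Part of the probability `tbsVoid .LoS r` that belongs to the absence (`i = 0`) or the presence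
(`i = 1`) of TBSs in the LoS ball. -/
noncomputable def tbsVoidPart (i : Fin 2) (r : ℝ) : ℝ :=
  if i = 0 then 1 - p.QT
  else if r ≤ p.lLT then Real.exp (-Real.pi * p.lamT * p.tauTL r ^ 2) - (1 - p.QT) else 0

lemma measurable_tbsVoidPart (i : Fin 2) : Measurable (p.tbsVoidPart i) := by
  unfold tbsVoidPart
  split_ifs
  · exact measurable_const
  · refine Measurable.ite measurableSet_Iic ?_ measurable_const
    unfold tauTL
    fun_prop

lemma tbsVoidPart_nonneg (hp : p.Valid) (i : Fin 2) {r : ℝ} (hr : 0 < r) :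
    0 ≤ p.tbsVoidPart i r := by
  have h1 : 1 - p.QT = Real.exp (-Real.pi * p.lamT * p.RB ^ 2) := sub_sub_cancel _ _
  unfold tbsVoidPart
  rw [h1]
  split_ifs with hi h
  · exact (Real.exp_pos _).le
  · rw [sub_nonneg, Real.exp_le_exp]
    have h2 := (tauTL_le_iff hp hr).2 h
    have h3 : 0 ≤ p.tauTL r := by
      have := eta_pos hp .LoS
      have := etaT_pos hp
      unfold tauTL; positivity
    have := mul_pos Real.pi_pos hp.lamT_pos
    have := mul_le_mul_of_nonneg_left (pow_le_pow_left₀ h3 h2 2) this.le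
    linarith
  · exact le_rfl

lemma sum_tbsVoidPart (hp : p.Valid) {r : ℝ} (hr : 0 < r) :
    ∑ i, p.tbsVoidPart i r = p.tbsVoid .LoS r := by
  have h1 : 1 - p.QT = Real.exp (-Real.pi * p.lamT * p.RB ^ 2) := sub_sub_cancel _ _
  rw [Fin.sum_univ_two]
  simp only [tbsVoidPart, tbsVoid, tbsGuard, h1, if_true, one_ne_zero, if_false]
  split_ifs with h
  · rw [min_eq_right ((tauTL_le_iff hp hr).2 h)]
    ring
  · rw [min_eq_left (le_of_lt (not_le.1 fun h' => h ((tauTL_le_iff hp hr).1 h')))]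
    ring

/-- All the cases collapse: for `r ≤ lLh` the NLoS void factor is 1 because `tauNL r = h`, so only
the cut at `lLT`, contained in `tbsVoidPart`, remains. -/
lemma servingPDFL_eq (i : Fin 2) (AL r : ℝ) :
    p.servingPDFL i AL r =
      p.nearestPDF .LoS r / AL * p.voidProb .NLoS (p.tauNL r) * p.tbsVoidPart i r := by
  have h1 : r ≤ p.lLh → p.voidProb .NLoS (p.tauNL r) = 1 := fun h => by
    simp [tauNL, h, voidProb]
  unfold servingPDFL tbsVoidPart servingPDFL1 servingPDFL2
  by_cases hi : i = 0
  · simp only [hi, if_true]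
    split_ifs with h
    · rw [h1 h, mul_one]
    · rfl
  · simp only [hi, if_false]
    split_ifs with h2 h3 h4 h5
    · rw [h1 (h3.trans h2.le), mul_one]
    · rw [mul_zero]
    · rw [h1 h4, mul_one]
    · exact absurd (h4.trans (not_lt.1 h2)) ‹_›
    · ring
    · rw [mul_zero]

/-- The last factor lies in `[0, 1]` for `r > 0`, so each part inherits integrability from the full
density. -/
lemma servingPDFL_eq_mul (i : Fin 2) (AL r : ℝ) :
    p.servingPDFL i AL r =
      p.servingDensity .LoS r / AL * (p.tbsVoidPart i r / p.tbsVoid .LoS r) := by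
  have h : p.tbsVoid .LoS r ≠ 0 := (Real.exp_pos _).ne'
  rw [servingPDFL_eq]
  simp only [servingDensity, nearestPDF, voidProb, absVoid, guard]
  field_simp

lemma tbsVoidPart_div_mem (hp : p.Valid) (i : Fin 2) {r : ℝ} (hr : 0 < r) :
    p.tbsVoidPart i r / p.tbsVoid .LoS r ∈ Icc 0 1 := by
  have h : 0 < p.tbsVoid .LoS r := Real.exp_pos _
  refine ⟨div_nonneg (tbsVoidPart_nonneg hp i hr) h.le, (div_le_one h).2 ?_⟩
  rw [← sum_tbsVoidPart hp hr]
  exact Finset.single_le_sum (f := fun i => p.tbsVoidPart i r)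
    (fun j _ => tbsVoidPart_nonneg hp j hr) (Finset.mem_univ i)

lemma sum_servingPDFL (hp : p.Valid) (AL : ℝ) {r : ℝ} (hr : 0 < r) :
    ∑ i, p.servingPDFL i AL r = p.servingDensity .LoS r / AL := by
  have h : p.tbsVoid .LoS r ≠ 0 := (Real.exp_pos _).ne'
  simp_rw [servingPDFL_eq_mul]
  rw [← Finset.mul_sum, ← Finset.sum_div, sum_tbsVoidPart hp hr, div_self h, mul_one]

/-- The near and the far parts of an integral over the serving distance. -/
lemma integral_covNear_add_integral_covFar (hp : p.Valid) {s : Link} {f : ℝ → ℝ}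
    (hf : IntegrableOn (fun r => p.covProb s r * f r) (Ioi p.h)) :
    IntervalIntegrable (fun r => p.covNear s r * f r) volume p.h p.Rf ∧
    IntegrableOn (fun r => p.covFar s r * f r) (Ioi p.Rf) ∧
    (∫ r in p.h..p.Rf, p.covNear s r * f r) + ∫ r in Ioi p.Rf, p.covFar s r * f r =
      ∫ r in Ioi p.h, p.covProb s r * f r := by
  have hnear : EqOn (fun r => p.covProb s r * f r) (fun r => p.covNear s r * f r)
      (Ioc p.h p.Rf) := fun r hr => by simp only [covProb, if_pos hr.2]
  have hfar : EqOn (fun r => p.covProb s r * f r) (fun r => p.covFar s r * f r)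
      (Ioi p.Rf) := fun r hr => by simp only [covProb, if_neg (not_le_of_gt (mem_Ioi.1 hr))]
  have h1 := hf.mono_set (Ioc_subset_Ioi_self : Ioc p.h p.Rf ⊆ Ioi p.h)
  have h2 := hf.mono_set (Ioi_subset_Ioi hp.h_le_Rf)
  refine ⟨(intervalIntegrable_iff_integrableOn_Ioc_of_le hp.h_le_Rf).2
    (h1.congr_fun hnear measurableSet_Ioc), h2.congr_fun hfar measurableSet_Ioi, ?_⟩
  rw [intervalIntegral.integral_of_le hp.h_le_Rf, ← setIntegral_congr_fun measurableSet_Ioc hnear,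
    ← setIntegral_congr_fun measurableSet_Ioi hfar,
    ← setIntegral_union (Ioc_disjoint_Ioi le_rfl) measurableSet_Ioi h1 h2,
    Ioc_union_Ioi_eq_Ioi hp.h_le_Rf]

lemma measurableSet_coveredAt : MeasurableSet {z : ℝ × ℝ × ℝ | p.CoveredAt z.1 z.2.1 z.2.2} := by
  have h1 : Measurable fun z : ℝ × ℝ × ℝ => p.am * z.2.1 / (p.an * z.2.1 + z.2.2 + p.noise) := by
    fun_prop
  have h2 : Measurable fun z : ℝ × ℝ × ℝ =>
      p.an * z.2.1 / (z.2.2 + p.noise + p.beta * p.am * z.2.1) := by fun_prop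
  exact ((measurableSet_le measurable_fst measurable_const).inter
    ((measurableSet_lt measurable_const h1).inter (measurableSet_lt measurable_const h2))).union
    ((measurableSet_lt measurable_const measurable_fst).inter
      (measurableSet_lt measurable_const h1))

end Params

namespace Network

variable {Ω : Type*} {N : Network Ω} {p : Params} [MeasurableSpace Ω] {μ : Measure Ω}
  [IsProbabilityMeasure μ]

/-! ### Association and coverage events -/

lemma measure_assocEvent (hp : p.Valid) (hN : N.HasNetworkLaw p μ) (s : Link) :
    μ (N.assocEvent p s) = ∫⁻ r in Ioi p.h, ENNReal.ofReal (p.servingDensity s r) := by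
  have := Params.isProbabilityMeasure_gainLaw hp s
  have h := measure_exists_serves hp hN (C := fun _ _ _ => True) MeasurableSet.univ s
  simp only [and_true] at h
  rw [assocEvent, h, ← lintegral_const_mul' _ _ ENNReal.ofReal_ne_top]
  refine setLIntegral_congr_fun measurableSet_Ioi fun r hr => ?_
  have hr0 : 0 < r := hp.h_pos.trans hr
  have e : {_H : ℝ | True} = univ := rfl
  simp only [e, measure_univ, setLIntegral_one, measure_weakerEvent hp hN s hr0]
  have h1 := hp.lamA_pos
  have h2 := Params.linkProb_pos hp s (Real.sqrt (r ^ 2 - p.h ^ 2))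
  have h4 : 0 < p.tbsVoid s r := Real.exp_pos _
  rw [← ENNReal.ofReal_mul h4.le, ← ENNReal.ofReal_mul h2.le, ← ENNReal.ofReal_mul hr0.le,
    ← ENNReal.ofReal_mul (by positivity), Params.servingDensity]
  congr 1
  ring

lemma assocEvent_inter_coverEvent (s : Link) :
    N.assocEvent p s ∩ N.coverEvent p = {ω | ∃ i, N.Serves p i ω ∧ N.state p i ω = s ∧
      p.CoveredAt (N.dist p i ω) (N.rxPower p i ω) (N.interference p i ω)} := by
  ext ω
  constructor
  · rintro ⟨⟨i, hi, hs⟩, j, hj, hc⟩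
    obtain rfl := serves_unique hi hj
    exact ⟨i, hi, hs, hc⟩
  · rintro ⟨i, hi, hs, hc⟩
    exact ⟨⟨i, hi, hs⟩, i, hi, hc⟩

lemma measure_assocEvent_inter_coverEvent (hp : p.Valid) (hN : N.HasNetworkLaw p μ) (s : Link) :
    μ (N.assocEvent p s ∩ N.coverEvent p) =
      ∫⁻ r in Ioi p.h, ENNReal.ofReal (p.covProb s r * p.servingDensity s r) := by
  rw [assocEvent_inter_coverEvent, measure_exists_serves hp hN Params.measurableSet_coveredAt s,
    ← lintegral_const_mul' _ _ ENNReal.ofReal_ne_top]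
  refine setLIntegral_congr_fun measurableSet_Ioi fun r hr => ?_
  have hr0 : 0 < r := hp.h_pos.trans hr
  simp only [(lintegral_coveredAt hp hN s hr0).2]
  have h1 := hp.lamA_pos
  have h2 := Params.linkProb_pos hp s (Real.sqrt (r ^ 2 - p.h ^ 2))
  have h4 : 0 < p.tbsVoid s r := Real.exp_pos _
  rw [← ENNReal.ofReal_mul h4.le, ← ENNReal.ofReal_mul h2.le, ← ENNReal.ofReal_mul hr0.le,
    ← ENNReal.ofReal_mul (by positivity), Params.servingDensity]
  congr 1
  ring

/-- Measurability in `r` is not visible from the formula, with its derivatives taken at a point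
depending on `r`. On `(h, ∞)` the function is instead the quotient of a parametric integral by
`absVoid`. -/
lemma aemeasurable_covProb (hp : p.Valid) (hN : N.HasNetworkLaw p μ) (s : Link) :
    AEMeasurable (p.covProb s) (volume.restrict (Ioi p.h)) := by
  have := Params.isProbabilityMeasure_gainLaw hp s
  have hm : Measurable fun z : (ℝ × ℝ) × Ω => (p.admissible p.CoveredAt s).indicator
      (fun _ => (1 : ℝ≥0∞)) ((Real.sqrt (z.1.1 ^ 2 - p.h ^ 2), z.1.2), N.best p z.2, N.total p z.2) :=
    (measurable_const.indicator (p.measurableSet_admissible Params.measurableSet_coveredAt s)).comp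
      (Measurable.prodMk (by fun_prop)
        (((measurable_best hN).comp measurable_snd).prodMk
          ((measurable_total hN).comp measurable_snd)))
  have hm' : Measurable fun r => ∫⁻ H, ∫⁻ ω, (p.admissible p.CoveredAt s).indicator
      (fun _ => (1 : ℝ≥0∞)) ((Real.sqrt (r ^ 2 - p.h ^ 2), H), N.best p ω, N.total p ω) ∂μ
        ∂p.gainLaw s :=
    (hm.lintegral_prod_right' (ν := μ)).lintegral_prod_right' (ν := p.gainLaw s)
  refine ⟨_, hm'.ennreal_toReal.div (Params.measurable_absVoid hp s), ?_⟩
  filter_upwards [ae_restrict_mem measurableSet_Ioi] with r hr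
  have hr0 : 0 < r := hp.h_pos.trans hr
  obtain ⟨h1, h2⟩ := lintegral_coveredAt hp hN s hr0
  have h3 := p.absVoid_pos s r
  rw [Pi.div_apply, lintegral_admissible hN Params.measurableSet_coveredAt s
    (Params.slant_sqrt hp (le_of_lt hr)), h2, ENNReal.toReal_ofReal (mul_nonneg h3.le h1),
    mul_div_cancel_left₀ _ h3.ne']

/-- The integrand is nonnegative and its integral in `[0, ∞]` is a probability; this is the source
of all the convergence claims. -/
lemma integral_covProb_mul_servingDensity (hp : p.Valid) (hN : N.HasNetworkLaw p μ) (s : Link) :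
    IntegrableOn (fun r => p.covProb s r * p.servingDensity s r) (Ioi p.h) ∧
    μ.real (N.assocEvent p s ∩ N.coverEvent p) =
      ∫ r in Ioi p.h, p.covProb s r * p.servingDensity s r := by
  have h := measure_assocEvent_inter_coverEvent hp hN s
  have hnn : 0 ≤ᵐ[volume.restrict (Ioi p.h)] fun r => p.covProb s r * p.servingDensity s r := by
    filter_upwards [ae_restrict_mem measurableSet_Ioi] with r hr
    have hr0 : 0 < r := hp.h_pos.trans hr
    exact mul_nonneg (lintegral_coveredAt hp hN s hr0).1 (Params.servingDensity_pos hp s hr0).le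
  have hm : AEStronglyMeasurable (fun r => p.covProb s r * p.servingDensity s r)
      (volume.restrict (Ioi p.h)) := ((aemeasurable_covProb hp hN s).mul
    (Params.measurable_servingDensity hp s).aemeasurable).aestronglyMeasurable
  refine ⟨⟨hm, ?_⟩, ?_⟩
  · rw [hasFiniteIntegral_iff_ofReal hnn, ← h]
    exact measure_lt_top _ _
  · rw [integral_eq_lintegral_of_nonneg_ae hnn hm, ← h]
    rfl

lemma measurable_absPower (hN : N.HasNetworkLaw p μ) (hp : p.Valid) (i : ℕ) :
    Measurable (N.absPower p i) := by
  have h := (p.measurable_avgOf.comp (measurable_point hN i)).ennreal_toReal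
  have e : N.absPower p i = fun ω => (p.avgOf (N.point i ω)).toReal := by
    ext ω
    exact (ENNReal.toReal_ofReal (absPower_pos hp i ω).le).symm
  rw [e]
  exact h

lemma measurableSet_assocEvent (hp : p.Valid) (hN : N.HasNetworkLaw p μ) (s : Link) :
    MeasurableSet (N.assocEvent p s) := by
  have h : N.assocEvent p s = ⋃ i, ((⋂ j, ⋂ (_ : j ≠ i), {ω | N.absPower p j ω < N.absPower p i ω}) ∩
      {ω | ∀ k, N.tbsPower p k ω < N.absPower p i ω}) ∩
        N.point i ⁻¹' {y | p.linkState y.1 y.2 = s} := by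
    ext ω
    simp only [assocEvent, Serves, mem_iUnion, mem_inter_iff, mem_iInter, mem_ofPred_eq,
      mem_preimage, state_eq]
  rw [h]
  have hm := measurable_absPower hN hp
  exact MeasurableSet.iUnion fun i => ((MeasurableSet.iInter fun j => MeasurableSet.iInter fun _ =>
    measurableSet_lt (hm j) (hm i)).inter (measurableSet_forall_lt (measurable_tbsPower hN) (hm i))).inter
      (measurable_point hN i (Params.measurableSet_linkState s))

lemma assocABS_eq_union : N.assocABS p = N.assocEvent p .LoS ∪ N.assocEvent p .NLoS := by
  ext ω
  constructor
  · rintro ⟨i, hi⟩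
    cases hs : N.state p i ω
    · exact Or.inl ⟨i, hi, hs⟩
    · exact Or.inr ⟨i, hi, hs⟩
  · rintro (⟨i, hi, -⟩ | ⟨i, hi, -⟩) <;> exact ⟨i, hi⟩

lemma disjoint_assocEvent : Disjoint (N.assocEvent p .LoS) (N.assocEvent p .NLoS) := by
  rw [Set.disjoint_left]
  rintro ω ⟨i, hi, h1⟩ ⟨j, hj, h2⟩
  obtain rfl := serves_unique hi hj
  exact absurd (h1.symm.trans h2) (by simp)

/-- The density of the serving distance is strictly positive on all of `(h, ∞)`. -/
lemma assocProb_pos (hp : p.Valid) (hN : N.HasNetworkLaw p μ) (s : Link) :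
    0 < N.assocProb p μ s := by
  refine ENNReal.toReal_pos ?_ (measure_ne_top _ _)
  rw [measure_assocEvent hp hN, ← pos_iff_ne_zero,
    setLIntegral_pos_iff (Params.measurable_servingDensity hp s).ennreal_ofReal]
  have : Function.support (fun r => ENNReal.ofReal (p.servingDensity s r)) ∩ Ioi p.h = Ioi p.h := by
    refine inter_eq_right.2 fun r hr => ?_
    exact (ENNReal.ofReal_pos.2 (Params.servingDensity_pos hp s (hp.h_pos.trans hr))).ne'
  rw [this, Real.volume_Ioi]
  exact ENNReal.zero_lt_top

lemma assocProbABS_eq (hp : p.Valid) (hN : N.HasNetworkLaw p μ) :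
    N.assocProbABS p μ = N.assocProb p μ .LoS + N.assocProb p μ .NLoS := by
  rw [assocProbABS, assocABS_eq_union]
  exact measureReal_union disjoint_assocEvent (measurableSet_assocEvent hp hN _)

lemma coverageGiven_eq (hp : p.Valid) (hN : N.HasNetworkLaw p μ) (s : Link) :
    N.coverageGiven p μ s = μ.real (N.assocEvent p s ∩ N.coverEvent p) / N.assocProb p μ s := by
  rw [coverageGiven, Measure.real, cond_apply (measurableSet_assocEvent hp hN s),
    ENNReal.toReal_mul, ENNReal.toReal_inv, inv_mul_eq_div]
  rfl

lemma coverageABS_eq (hp : p.Valid) (hN : N.HasNetworkLaw p μ) :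
    N.coverageABS p μ =
      (μ.real (N.assocEvent p .LoS ∩ N.coverEvent p) +
        μ.real (N.assocEvent p .NLoS ∩ N.coverEvent p)) / N.assocProbABS p μ := by
  have hL := measurableSet_assocEvent hp hN .LoS
  have hN' := measurableSet_assocEvent hp hN .NLoS
  have hABS : MeasurableSet (N.assocABS p) := by rw [assocABS_eq_union]; exact hL.union hN'
  rw [coverageABS, Measure.real, cond_apply hABS, ENNReal.toReal_mul, ENNReal.toReal_inv,
    inv_mul_eq_div, assocProbABS, Measure.real]
  congr 1
  change μ.real _ = _
  rw [← measureReal_inter_add_sdiff (s := N.assocABS p ∩ N.coverEvent p) hL, assocABS_eq_union]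
  congr 2
  · ext ω
    simp only [mem_inter_iff, mem_union]
    tauto
  · ext ω
    have : ω ∈ N.assocEvent p .LoS → ω ∉ N.assocEvent p .NLoS := fun h1 =>
      Set.disjoint_left.1 disjoint_assocEvent h1
    simp only [mem_inter_iff, mem_union, mem_sdiff]
    tauto

lemma integrableOn_covProb_mul_servingPDFL (hp : p.Valid) (hN : N.HasNetworkLaw p μ) (i : Fin 2)
    (AL : ℝ) : IntegrableOn (fun r => p.covProb .LoS r * p.servingPDFL i AL r) (Ioi p.h) := by
  have h := ((integral_covProb_mul_servingDensity hp hN .LoS).1.div_const AL).mul_bdd (c := 1)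
    (g := fun r => p.tbsVoidPart i r / p.tbsVoid .LoS r)
    ((Params.measurable_tbsVoidPart i).div (p.measurable_tbsVoid .LoS)).aestronglyMeasurable (by
      filter_upwards [ae_restrict_mem measurableSet_Ioi] with r hr
      have := Params.tbsVoidPart_div_mem hp i (hp.h_pos.trans hr)
      rw [Real.norm_of_nonneg this.1]
      exact this.2)
  refine h.congr (ae_of_all _ fun r => ?_)
  simp only [Params.servingPDFL_eq_mul]
  ring

/-- Coverage given association with a LoS ABS. -/
lemma covLoS_eq (hp : p.Valid) (hN : N.HasNetworkLaw p μ) (AL : ℝ) :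
    p.covLoS AL = μ.real (N.assocEvent p .LoS ∩ N.coverEvent p) / AL := by
  have hi := fun i => integrableOn_covProb_mul_servingPDFL hp hN i AL
  rw [Params.covLoS, (integral_covProb_mul_servingDensity hp hN .LoS).2, ← integral_div]
  simp_rw [(Params.integral_covNear_add_integral_covFar hp (hi _)).2.2]
  rw [← integral_finsetSum _ fun i _ => hi i]
  refine setIntegral_congr_fun measurableSet_Ioi fun r hr => ?_
  simp only [← Finset.mul_sum, Params.sum_servingPDFL hp AL (hp.h_pos.trans hr), mul_div_assoc]

lemma integrableOn_covProb_mul_servingPDFN (hp : p.Valid) (hN : N.HasNetworkLaw p μ) (AN : ℝ) :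
    IntegrableOn (fun r => p.covProb .NLoS r * p.servingPDFN AN r) (Ioi p.h) := by
  simp_rw [Params.servingPDFN_eq, ← mul_div_assoc]
  exact (integral_covProb_mul_servingDensity hp hN .NLoS).1.div_const AN

/-- Coverage given association with a NLoS ABS. -/
lemma covNLoS_eq (hp : p.Valid) (hN : N.HasNetworkLaw p μ) (AN : ℝ) :
    p.covNLoS AN = μ.real (N.assocEvent p .NLoS ∩ N.coverEvent p) / AN := by
  rw [Params.covNLoS, (Params.integral_covNear_add_integral_covFar hp
    (integrableOn_covProb_mul_servingPDFN hp hN AN)).2.2,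
    (integral_covProb_mul_servingDensity hp hN .NLoS).2, ← integral_div]
  simp_rw [Params.servingPDFN_eq, mul_div_assoc]

end Network

end NomaHetNet

theorem mainTheorem10 {Ω : Type*} [MeasurableSpace Ω] (μ : Measure Ω) [IsProbabilityMeasure μ]
    (p : NomaHetNet.Params) (hp : p.Valid)
    (N : NomaHetNet.Network Ω) (hN : N.HasNetworkLaw p μ) :
    -- the association probabilities in the denominators do not vanish
    0 < N.assocProb p μ .LoS ∧ 0 < N.assocProb p μ .NLoS ∧
    N.assocProbABS p μ = N.assocProb p μ .LoS + N.assocProb p μ .NLoS ∧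
    -- the integrals converge
    (∀ i : Fin 2,
      IntervalIntegrable
        (fun r => p.covNear .LoS r * p.servingPDFL i (N.assocProb p μ .LoS) r)
        volume p.h p.Rf ∧
      IntegrableOn
        (fun r => p.covFar .LoS r * p.servingPDFL i (N.assocProb p μ .LoS) r) (Ioi p.Rf)) ∧
    IntervalIntegrable
      (fun r => p.covNear .NLoS r * p.servingPDFN (N.assocProb p μ .NLoS) r)
      volume p.h p.Rf ∧
    IntegrableOn
      (fun r => p.covFar .NLoS r * p.servingPDFN (N.assocProb p μ .NLoS) r) (Ioi p.Rf) ∧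
    -- they are the coverage probabilities given association with a LoS and with a NLoS ABS
    N.coverageGiven p μ .LoS = p.covLoS (N.assocProb p μ .LoS) ∧
    N.coverageGiven p μ .NLoS = p.covNLoS (N.assocProb p μ .NLoS) ∧
    -- the coverage probability of the ABS tier
    N.coverageABS p μ =
      N.assocProb p μ .LoS / N.assocProbABS p μ * p.covLoS (N.assocProb p μ .LoS) +
      N.assocProb p μ .NLoS / N.assocProbABS p μ * p.covNLoS (N.assocProb p μ .NLoS) := by
  have hL := NomaHetNet.Network.assocProb_pos hp hN .LoS
  have hNL := NomaHetNet.Network.assocProb_pos hp hN .NLoS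
  have hsum := NomaHetNet.Network.assocProbABS_eq hp hN
  have eL := NomaHetNet.Network.covLoS_eq hp hN (N.assocProb p μ .LoS)
  have eN := NomaHetNet.Network.covNLoS_eq hp hN (N.assocProb p μ .NLoS)
  have iL := fun i => NomaHetNet.Params.integral_covNear_add_integral_covFar hp
    (NomaHetNet.Network.integrableOn_covProb_mul_servingPDFL hp hN i (N.assocProb p μ .LoS))
  have iN := NomaHetNet.Params.integral_covNear_add_integral_covFar hp
    (NomaHetNet.Network.integrableOn_covProb_mul_servingPDFN hp hN (N.assocProb p μ .NLoS))
  refine ⟨hL, hNL, hsum, fun i => ⟨(iL i).1, (iL i).2.1⟩, iN.1, iN.2.1, ?_, ?_, ?_⟩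
  · rw [NomaHetNet.Network.coverageGiven_eq hp hN, eL]
  · rw [NomaHetNet.Network.coverageGiven_eq hp hN, eN]
  · rw [NomaHetNet.Network.coverageABS_eq hp hN, eL, eN, hsum]
    field_simp
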